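/- Let $Q$ be a quiver drawn on the torus $\mathbb{T}^2$, cutting it into polygonal faces that have at least three edges each and are coloured blue and red, so that the two faces incident to any edge have different colours and every edge goes clockwise around its blue face. Let $\widetilde Q$ be its lift to the universal cover $\mathbb{R}^2$. Paths and cycles are oriented. A *broken wheel* is a path obtained by removing one edge $e$ (its *interface*) from the boundary of a face $F$ of $\widetilde Q$; its *mirror image* is obtained by removing $e$ from the boundary of the other face incident to $e$. Assume that $Q$ is *shrubby*: for any paths $p\ne p'$ in $\widetilde Q$ with the same start and end points, at least one of $p,p'$ contains a broken wheel whose interface lies in the closed region between $p$ and $p'$ (the union of $p$, $p'$ and the bounded components of the complement of $p\cup p'$). A *shrub* is a subgraph $S$ of $\widetilde Q$ that contains no entire boundary of a face, contains the mirror image of every broken wheel that it contains, has a single root (a vertex that cannot be reached by a path in $S$ from any other vertex of $S$), from which all vertices of $S$ can be reached by paths in $S$, and contains all vertices lying in its interior (the region enclosed by the unoriented cycles of $S$). Let $S$ be a shrub and $i\notin S$ a vertex of $\widetilde Q$ with $k>0$ edges from vertices of $S$ to $i$, denoted $e_1,\dots,e_k$ in counterclockwise order around $i$, with $e_{k+1}=e_1$.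 Let $S+i$ be $S$ together with the vertex $i$ and these edges. For each $s$ let $p_s,p_s'$ be simple paths in $S+i$ from a common vertex of $S$ to $i$, with last edges $e_s$ and $e_{s+1}$ respectively, disjoint except for their endpoints, such that the closed region $r_s$ between them is minimal with respect to inclusion. Exactly one of the regions $r_s$ does not contain the counterclockwise angle at $i$ from $e_s$ to $e_{s+1}$; label the edges so that it is $r_k$. The index $s<k$ is *good* if $p_s$ and $p_s'$ are broken wheels that are mirror images of each other; the index $k$ is *good* if there are no edges from $i$ to $S$ outside $r_k$. The vertex $i$ is *addable* to $S$ if all $s\in\{1,\dots,k\}$ are good, and *non-addable* otherwise. **Proposition.** Consider finite sets of broken wheels contained in $S+i$ that all pass through $i$ and such that no two distinct ones intersect at any vertex other than $i$. The maximal cardinality of such a set exists; it equals $k-1$ if $i$ is addable to $S$, and it is at least $k$ if $i$ is non-addable to $S$. -/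

import Mathlib

/-! Quivers drawn on a closed oriented surface with polygonal faces coloured blue and red, every
edge having one blue and one red side and going clockwise around its blue face, are encoded by
their combinatorial map: the edge set together with the two permutations "next edge along the blue
face" and "next edge along the red face". -/

/-- A bicoloured map with edge set `E`. `next true e` (resp. `next false e`) is the edge that
follows `e` along the boundary of the blue (resp. red) face incident to `e`. -/
structure BicoloredMap (E : Type*) where
  next : Bool → Equiv.Perm E

namespace BicoloredMap

variable {E : Type*} (T : BicoloredMap E)

/-- The rotation on the edges pointing into a vertex: since the blue face lies to the right of `e`
and the red face to the left, `next true e` is the next edge after `e` in counterclockwise order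
around the head of `e` (an outgoing edge), and the one after it is the incoming edge
`rot e`. So `rot e` is the next *incoming* edge in counterclockwise order. -/
def rot : Equiv.Perm E := (T.next false)⁻¹ * T.next true

/-- A vertex is a cycle of the rotation (identified with the set of edges pointing into it). -/
def Vertex : Type _ := Quotient (Equiv.Perm.SameCycle.setoid T.rot)

/-- A face is a colour together with a cycle of `next` for that colour. -/
def Face : Type _ := Σ c : Bool, Quotient (Equiv.Perm.SameCycle.setoid (T.next c))

/-- The head of an edge. -/
def tgt (e : E) : T.Vertex := Quotient.mk _ e

/-- The tail of an edge, i.e. the head of the edge preceding it on its blue face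
(equivalently, on its red face). -/
def src (e : E) : T.Vertex := T.tgt ((T.next true)⁻¹ e)

theorem src_eq_red (e : E) : T.src e = T.tgt ((T.next false)⁻¹ e) := by
  refine Quotient.sound (s := Equiv.Perm.SameCycle.setoid T.rot) ?_
  exact ⟨1, by simp [rot]⟩

/-- The face of colour `c` incident to the edge `e`. -/
def face (c : Bool) (e : E) : T.Face := ⟨c, Quotient.mk _ e⟩

/-- The surface is a torus: the map is finite, nonempty, connected, and has Euler characteristic
`#vertices - #edges + #faces = 0`. -/
structure IsTorus : Prop where
  finite : Finite E
  nonempty : Nonempty E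
  connected : ∀ e f : E, ∃ g ∈ Subgroup.closure (Set.range T.next), g e = f
  euler : Nat.card T.Vertex + Nat.card T.Face = Nat.card E

/-- The face of colour `c` at `e` has `T.faceSize c e` edges. -/
noncomputable def faceSize (c : Bool) (e : E) : ℕ := Function.minimalPeriod (T.next c) e

/-! ### The universal cover

The surface is cut into cells with a 0-cell in the middle of every edge `e`, 1-cells
from `e` to `next c e` (cutting the corners of the faces), and a 2-cell for every blue face, every
red face and every vertex. Homotopy classes of paths from a base point are words in
the free group on the two colours, modulo the boundaries of the 2-cells. -/

/-- The action of words on edges. -/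
def act : FreeGroup Bool →* Equiv.Perm E := FreeGroup.lift T.next

/-- The words of null-homotopic loops based at `e₀`: generated by the loops that go along a word
`g`, then once around a blue face, a red face, or a vertex, and then back along `g`. -/
def nullLoops (e₀ : E) : Subgroup (FreeGroup Bool) :=
  Subgroup.closure {x | ∃ g w : FreeGroup Bool,
    (w = FreeGroup.of true ∨ w = FreeGroup.of false ∨
      w = (FreeGroup.of false)⁻¹ * FreeGroup.of true) ∧
    x = g⁻¹ * w ^ Function.minimalPeriod (T.act w) (T.act g e₀) * g}

/-- The edges of the universal cover: homotopy classes of words starting at `e₀`. -/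
abbrev CoverEdge (e₀ : E) : Type := FreeGroup Bool ⧸ T.nullLoops e₀

/-- The universal cover of a connected map, with base point `e₀`. The edge `g • nullLoops`
lies above the edge `act g e₀`. -/
def cover (e₀ : E) : BicoloredMap (T.CoverEdge e₀) where
  next c := MulAction.toPerm (FreeGroup.of c)

/-! ### Paths, broken wheels, regions -/

/-- `T.IsPath v p w`: the list of edges `p` is an oriented path from `v` to `w`. -/
def IsPath : T.Vertex → List E → T.Vertex → Prop
  | v, [], w => v = w
  | v, e :: p, w => T.src e = v ∧ IsPath (T.tgt e) p w

/-- The vertices of the path `p` starting at `v`, in order. -/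
def pathVerts (v : T.Vertex) (p : List E) : List T.Vertex := v :: p.map T.tgt

/-- The broken wheel with interface `e` in the face of colour `c`: the boundary of this face with
`e` removed, a path from the head of `e` to the tail of `e`.
Its mirror image is `T.wheel (!c) e`. -/
noncomputable def wheel (c : Bool) (e : E) : List E :=
  (List.range (T.faceSize c e - 1)).map fun m => (T.next c ^ (m + 1)) e

/-- The nontrivial path consisting of the edges in `B` passes through the vertex `v`. -/
def PassesThrough (B : List E) (v : T.Vertex) : Prop := ∃ e ∈ B, T.src e = v ∨ T.tgt e = v

/-- Two faces of the plane are adjacent off `A` if they lie on the two sides of an edge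
outside `A`. -/
def FaceAdj (A : Set E) (F G : T.Face) : Prop :=
  ∃ e ∉ A, ∃ c : Bool, F = T.face c e ∧ G = T.face (!c) e

/-- The face `F` is enclosed by the set of edges `A`: the connected component of `F` in the
complement of `A` in the plane is bounded, i.e. consists of finitely many faces. -/
def Enclosed (A : Set E) (F : T.Face) : Prop :=
  {G | Relation.ReflTransGen (T.FaceAdj A) F G}.Finite

/-- The closed region of the plane bounded by the edges in `A`, as a set of edges and faces: the
edges in `A` together with all bounded components of the complement of `A`. -/
def closedRegion (A : Set E) : Set (E ⊕ T.Face) :=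
  {x | match x with
    | Sum.inl e => e ∈ A ∨ T.Enclosed A (T.face true e)
    | Sum.inr F => T.Enclosed A F}

/-- The closed region `r(p, p')` between two paths with the same endpoints. -/
def region (p p' : List E) : Set (E ⊕ T.Face) := T.closedRegion {e | e ∈ p ∨ e ∈ p'}

/-- The shrubbiness condition on (the universal cover of) a quiver: if `p ≠ p'` are paths with the
same endpoints, one of them contains a broken wheel whose interface lies in the closed region
between the two paths. -/
def Shrubby : Prop :=
  ∀ (v w : T.Vertex) (p p' : List E), T.IsPath v p w → T.IsPath v p' w → p ≠ p' →
    ∃ (c : Bool) (e : E), (T.wheel c e <:+: p ∨ T.wheel c e <:+: p') ∧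
      Sum.inl e ∈ T.region p p'

/-! ### Shrubs -/

/-- A subgraph of the quiver. -/
structure Subgraph where
  verts : Set T.Vertex
  edges : Set E
  src_mem : ∀ e ∈ edges, T.src e ∈ verts
  tgt_mem : ∀ e ∈ edges, T.tgt e ∈ verts

namespace Subgraph

variable {T} (S : T.Subgraph)

/-- All the edges of the path `p` belong to `S`. -/
def ContainsPath (p : List E) : Prop := ∀ e ∈ p, e ∈ S.edges

/-- There is an oriented path in `S` from `v` to `w`. -/
def Reaches (v w : T.Vertex) : Prop := ∃ p, T.IsPath v p w ∧ S.ContainsPath p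

/-- A pre-shrub contains no entire face boundary, and contains the mirror image of every broken
wheel that it contains. -/
structure IsPreShrub : Prop where
  no_face : ∀ (c : Bool) (e : E), ∃ f, (T.next c).SameCycle e f ∧ f ∉ S.edges
  mirror : ∀ (c : Bool) (e : E), S.ContainsPath (T.wheel c e) → S.ContainsPath (T.wheel (!c) e)

/-- A root is a maximal vertex for the order in which `v ≥ w` if there is a path from `v` to
`w`. -/
def IsRoot (r : T.Vertex) : Prop := r ∈ S.verts ∧ ∀ v ∈ S.verts, S.Reaches v r → v = r

/-- A shrub is a pre-shrub which has a single root, from which all of its vertices can be reached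
(this last clause is automatic for finite `S`), and which contains all the vertices in its
interior (the vertices all of whose incident faces are enclosed by `S`). -/
structure IsShrub : Prop where
  isPreShrub : S.IsPreShrub
  single_root : ∃ r, S.IsRoot r ∧ (∀ r', S.IsRoot r' → r' = r) ∧ ∀ v ∈ S.verts, S.Reaches r v
  interior : ∀ v : T.Vertex,
    (∀ (c : Bool) (e : E), T.tgt e = v → T.Enclosed S.edges (T.face c e)) → v ∈ S.verts

/-- The edges from vertices of `S` to `i`. -/
def edgesTo (i : T.Vertex) : Set E := {e | T.src e ∈ S.verts ∧ T.tgt e = i}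

/-- `S + i`: add to `S` the vertex `i` and all edges from `S` to `i`. -/
def addVertex (i : T.Vertex) : T.Subgraph where
  verts := insert i S.verts
  edges := S.edges ∪ S.edgesTo i
  src_mem := by
    rintro e (h | h)
    · exact Or.inr (S.src_mem e h)
    · exact Or.inr h.1
  tgt_mem := by
    rintro e (h | h)
    · exact Or.inr (S.tgt_mem e h)
    · exact Or.inl h.2

/-- `b` is the edge that follows `a` in the counterclockwise cyclic order around `i` of the edges
from `S` to `i` (so `b = a` if there is only one such edge). -/
def Consecutive (i : T.Vertex) (a b : E) : Prop :=
  a ∈ S.edgesTo i ∧ b ∈ S.edgesTo i ∧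
    ∃ m > 0, (T.rot ^ m) a = b ∧ ∀ l, 0 < l → l < m → (T.rot ^ l) a ∉ S.edgesTo i

/-- `p` and `p'` are simple paths in `S + i` from a common vertex `j` of `S` to `i`, whose last
edges are `a` and `b` respectively, and which meet only at their endpoints. -/
def IsBigon (i : T.Vertex) (a b : E) (p p' : List E) : Prop :=
  ∃ j ∈ S.verts, T.IsPath j p i ∧ T.IsPath j p' i ∧
    (S.addVertex i).ContainsPath p ∧ (S.addVertex i).ContainsPath p' ∧
    p.getLast? = some a ∧ p'.getLast? = some b ∧
    (T.pathVerts j p).Nodup ∧ (T.pathVerts j p').Nodup ∧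
    ∀ v ∈ T.pathVerts j p, v ∈ T.pathVerts j p' → v = j ∨ v = i

/-- A bigon whose region is minimal with respect to inclusion. -/
def IsMinimalBigon (i : T.Vertex) (a b : E) (p p' : List E) : Prop :=
  S.IsBigon i a b p p' ∧
    ∀ q q', S.IsBigon i a b q q' → T.region q q' ⊆ T.region p p' → T.region p p' ⊆ T.region q q'

/-- The condition for the index of the consecutive edges `a`, `b` to be good, where `p`, `p'` is
the minimal bigon at these edges. The counterclockwise angle at `i` from `a` to `b` starts with
the corner of the blue face of `a`.
If the region between `p` and `p'` contains this angle, then `p` and `p'` have to be broken wheels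
which are mirror images of each other. If it does not (this is the exceptional index), then there
must be no edges from `i` to `S` outside the region. -/
def IsGood (i : T.Vertex) (a : E) (p p' : List E) : Prop :=
  (Sum.inr (T.face true a) ∈ T.region p p' →
    ∃ (c : Bool) (e : E), p = T.wheel c e ∧ p' = T.wheel (!c) e) ∧
  (Sum.inr (T.face true a) ∉ T.region p p' →
    ∀ e, T.src e = i → T.tgt e ∈ S.verts → Sum.inl e ∈ T.region p p')

/-- The vertex `i` is addable to `S`: all the indices are good. -/
def Addable (i : T.Vertex) : Prop :=
  ∀ a b p p', S.Consecutive i a b → S.IsMinimalBigon i a b p p' → S.IsGood i a p p'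

/-- A finite set of broken wheels contained in `S + i`, all passing through `i`, any two distinct
ones of which intersect at no vertex other than `i`. -/
structure IsWheelFamily (i : T.Vertex) (W : Finset (List E)) : Prop where
  wheel : ∀ B ∈ W, ∃ (c : Bool) (e : E), B = T.wheel c e
  contained : ∀ B ∈ W, (S.addVertex i).ContainsPath B
  through : ∀ B ∈ W, T.PassesThrough B i
  disjoint : ∀ B ∈ W, ∀ B' ∈ W, B ≠ B' →
    ∀ v, T.PassesThrough B v → T.PassesThrough B' v → v = i

/-- The sizes of the families of broken wheels as above. -/
def wheelCounts (i : T.Vertex) : Set ℕ := {n | ∃ W, S.IsWheelFamily i W ∧ W.card = n}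

end Subgraph

end BicoloredMap

/-!
The proof rests on a single way of using shrubbiness. Two paths with the same endpoints that meet
nowhere else form a simple closed curve. If one of them contains a broken wheel whose interface is
enclosed by the curve, then replacing this broken wheel by its mirror image yields a curve in the
same closed region that encloses fewer faces (`SimplePair.swap`). A shrub is closed under such
replacements, so that shrubbiness can be applied again and again, until the broken wheel that it
provides involves an edge outside the shrub. The only topological inputs are that a simple closed
curve has at most two complementary components (`SimplePair.exists_conn`, proved by walking along
the curve and rotating around its vertices) and that the universal cover has infinitely many faces;
so a curve cannot enclose both sides of one of its edges (`SimplePair.not_enclosed`). The Jordan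
curve theorem is not needed.

It follows first that a shrub `S` contains no oriented cycle (`IsPreShrub.eq_nil_of_closed`) and
that an edge between two vertices of `S` that is not in `S` is the interface of two broken wheels in
`S` (`IsShrub.contains_wheel_of_chord`).

The broken wheels in `S + i` through `i` all end at `i`; they correspond to *full corners*
`FullCorner S i c a`, where `a` is the last edge and `next c a`, an outgoing edge at `i` next to
`a`, is the interface. Comparing two paths in `S + i` that enter `i` along distinct edges produces a
full corner at each of the two edges, on the side which the two paths enclose
(`exists_fullCorner_of_in`). Likewise, comparing a path that enters `i` and leaves it towards `S`
with a path in `S` produces a full corner at the entering edge (`exists_fullCorner_of_out`). Full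
corners with distinct last edges and distinct interfaces meet only at `i`
(`FullCorner.eq_of_passesThrough`): from a further common vertex there would be paths to the tails
of both last edges, hence another full corner further down, which has to be on the other side of its
last edge, and this is excluded by `FullCorner.not_reaches`. Families of broken wheels are thus
matchings between the edges from `S` to `i` and the adjacent outgoing edges.

Not all the corners at `i` are enclosed by `S + i`, since `i` would lie in the interior of `S`
otherwise. Let `z` be the last edge from `S` before the exceptional sector, the one that is not
enclosed (`IsExceptional`). Two edges from `S` to `i` enclose the angle between them that avoids
this sector, so that, starting after `z`, all edges from `S` have full blue corners except perhaps
`z`, and all but the first one have full red corners (`fullCorner_between`). The blue corners give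
`k - 1` broken wheels. The vertex `i` is addable if and only if consecutive edges from `S` are
separated by a single outgoing edge except after `z`, and there are no edges from `i` to `S` in the
exceptional sector (`addable_iff`). In that case the interfaces are among the `k - 1` outgoing edges
that follow the edges other than `z`, so `k - 1` is the maximum. Otherwise there is a family of `k`
broken wheels: if there is a gap, one takes blue corners before it and red corners after it; if
there is an edge from `i` to `S` in the exceptional sector, then the corner of `z` or of the first
edge after it in this sector is full as well (`fullCorner_of_out`).
-/

namespace BicoloredMap

/-! ### Faces, broken wheels and paths -/

section Basics

variable {E : Type*} {T : BicoloredMap E}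

theorem src_next (c : Bool) (e : E) : T.src (T.next c e) = T.tgt e := by
  cases c
  · rw [src_eq_red]; simp
  · simp [src]

theorem tgt_next_symm (c : Bool) (e : E) : T.tgt ((T.next c).symm e) = T.src e := by
  rw [← src_next c, Equiv.apply_symm_apply]

theorem tgt_eq_iff {e f : E} : T.tgt e = T.tgt f ↔ T.rot.SameCycle e f :=
  Quotient.eq (r := Equiv.Perm.SameCycle.setoid T.rot)

theorem face_eq_iff {c : Bool} {e f : E} :
    T.face c e = T.face c f ↔ (T.next c).SameCycle e f := by
  refine Iff.trans ⟨fun h => ?_, fun h => ?_⟩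
    (Quotient.eq (r := Equiv.Perm.SameCycle.setoid (T.next c)))
  · exact eq_of_heq (Sigma.mk.inj h).2
  · exact congrArg (Sigma.mk c) h

theorem color_eq_of_face_eq {c d : Bool} {e f : E} (h : T.face c e = T.face d f) : c = d :=
  congrArg Sigma.fst h

theorem face_next (c : Bool) (e : E) : T.face c (T.next c e) = T.face c e :=
  face_eq_iff.2 (Equiv.Perm.sameCycle_apply_left.2 (Equiv.Perm.SameCycle.refl _ _))

theorem face_next_symm (c : Bool) (e : E) : T.face c ((T.next c).symm e) = T.face c e := by
  rw [← face_next, Equiv.apply_symm_apply]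

theorem next_pow_faceSize (c : Bool) (e : E) : (T.next c ^ T.faceSize c e) e = e := by
  rw [Equiv.Perm.coe_pow]
  exact Function.iterate_minimalPeriod

theorem mem_wheel {c : Bool} {e : E} (hs : 0 < T.faceSize c e) {u : E} :
    u ∈ T.wheel c e ↔ T.face c u = T.face c e ∧ u ≠ e := by
  simp only [wheel, List.mem_map, List.mem_range]
  constructor
  · rintro ⟨m, hm, rfl⟩
    refine ⟨face_eq_iff.2 (Equiv.Perm.SameCycle.symm ⟨(m + 1 : ℕ), by rw [zpow_natCast]⟩), ?_⟩
    intro h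
    rw [Equiv.Perm.coe_pow] at h
    have := Function.IsPeriodicPt.minimalPeriod_le (Nat.succ_pos m) h
    unfold faceSize at hm
    omega
  · rintro ⟨h, hne⟩
    have h1 : (T.next c).SameCycle e u := face_eq_iff.1 h.symm
    obtain ⟨z, hz⟩ := h1
    have hpz : (T.next c ^ (T.faceSize c e : ℤ)) e = e := by
      rw [zpow_natCast]; exact next_pow_faceSize c e
    have key : (T.next c ^ (z % (T.faceSize c e : ℤ))) e = u := by
      conv_rhs => rw [← hz, ← Int.emod_add_mul_ediv z (T.faceSize c e), zpow_add,
        Equiv.Perm.mul_apply, zpow_mul]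
      congr 1
      exact (Equiv.Perm.zpow_apply_eq_self_of_apply_eq_self hpz _).symm
    have h0 : (0 : ℤ) < T.faceSize c e := by exact_mod_cast hs
    have h2 := Int.emod_nonneg z h0.ne'
    have h3 := Int.emod_lt_of_pos z h0
    obtain ⟨m, hm⟩ := Int.eq_ofNat_of_zero_le h2
    rw [hm] at key h3
    rw [zpow_natCast] at key
    have hm0 : m ≠ 0 := by
      rintro rfl; exact hne (by simpa using key.symm)
    refine ⟨m - 1, by omega, ?_⟩
    rw [Nat.sub_add_cancel (by omega), key]

theorem faceSize_next (c : Bool) (e : E) (hs : 0 < T.faceSize c e) :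
    T.faceSize c (T.next c e) = T.faceSize c e :=
  Function.minimalPeriod_apply (Function.minimalPeriod_pos_iff_mem_periodicPts.1 hs)

/-- The broken wheel whose interface follows `a` ends with the edge `a`. -/
theorem wheel_next_eq (c : Bool) (a : E) (hs : 3 ≤ T.faceSize c a) :
    ∃ w, w ≠ [] ∧ T.wheel c (T.next c a) = w ++ [a] := by
  have hsz := faceSize_next (T := T) c a (by omega)
  obtain ⟨k, hk⟩ : ∃ k, T.faceSize c a = k + 3 := ⟨T.faceSize c a - 3, by omega⟩
  refine ⟨(List.range (k + 1)).map fun m => (T.next c ^ (m + 1)) (T.next c a), by simp, ?_⟩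
  rw [wheel, hsz, hk, show k + 3 - 1 = (k + 1) + 1 by omega, List.range_succ, List.map_append]
  simp only [List.map_cons, List.map_nil, List.append_cancel_left_eq, List.cons.injEq, and_true]
  rw [← Equiv.Perm.mul_apply, ← pow_succ, show k + 1 + 1 + 1 = T.faceSize c a by rw [hk]]
  exact next_pow_faceSize c a

/-- The broken wheel with interface `h` starts with the edge following `h`. -/
theorem wheel_eq_cons (c : Bool) (h : E) (hs : 3 ≤ T.faceSize c h) :
    ∃ w, w ≠ [] ∧ T.wheel c h = T.next c h :: w := by
  obtain ⟨k, hk⟩ : ∃ k, T.faceSize c h = k + 3 := ⟨T.faceSize c h - 3, by omega⟩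
  refine ⟨(List.range (k + 1)).map fun m => (T.next c ^ (m + 1 + 1)) h, by simp, ?_⟩
  rw [wheel, hk, show k + 3 - 1 = (k + 1) + 1 by omega, List.range_succ_eq_map, List.map_cons,
    List.map_map]
  rfl

theorem isPath_append {v w : T.Vertex} {p q : List E} :
    T.IsPath v (p ++ q) w ↔ ∃ u, T.IsPath v p u ∧ T.IsPath u q w := by
  induction p generalizing v with
  | nil => simp [IsPath]
  | cons e p ih => simp [IsPath, ih, and_assoc]

theorem isPath_concat {v w : T.Vertex} {p : List E} {e : E} :
    T.IsPath v (p ++ [e]) w ↔ T.IsPath v p (T.src e) ∧ T.tgt e = w := by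
  rw [isPath_append]
  constructor
  · rintro ⟨u, h, rfl, rfl⟩; exact ⟨h, rfl⟩
  · rintro ⟨h, rfl⟩; exact ⟨_, h, rfl, rfl⟩

theorem IsPath.unique_end {v w w' : T.Vertex} {p : List E} (h : T.IsPath v p w)
    (h' : T.IsPath v p w') : w = w' := by
  induction p generalizing v with
  | nil => exact h.symm.trans h'
  | cons e p ih => exact ih h.2 h'.2

theorem IsPath.unique_start {v v' w w' : T.Vertex} {p : List E} (hp : p ≠ []) (h : T.IsPath v p w)
    (h' : T.IsPath v' p w') : v = v' := by
  cases p with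
  | nil => exact absurd rfl hp
  | cons e p => exact h.1.symm.trans h'.1

theorem isPath_wheel (c : Bool) (e : E) (hs : 0 < T.faceSize c e) :
    T.IsPath (T.tgt e) (T.wheel c e) (T.src e) := by
  have key : ∀ n : ℕ, T.IsPath (T.tgt e) ((List.range n).map fun m => (T.next c ^ (m + 1)) e)
      (T.tgt ((T.next c ^ n) e)) := by
    intro n
    induction n with
    | zero => simp [IsPath]
    | succ n ih =>
      rw [List.range_succ, List.map_append, List.map_singleton, isPath_concat]
      refine ⟨?_, rfl⟩
      rw [pow_succ', Equiv.Perm.mul_apply, src_next]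
      exact ih
  have h := key (T.faceSize c e - 1)
  have h2 : T.next c ((T.next c ^ (T.faceSize c e - 1)) e) = e := by
    rw [← Equiv.Perm.mul_apply, ← pow_succ', Nat.sub_add_cancel hs]
    exact next_pow_faceSize c e
  rw [← src_next c ((T.next c ^ _) e), h2] at h
  exact h

theorem IsPath.src_mem_of_mem {v w : T.Vertex} {p : List E} (h : T.IsPath v p w) {e : E}
    (he : e ∈ p) : T.src e ∈ T.pathVerts v p := by
  induction p generalizing v with
  | nil => simp at he
  | cons f p ih =>
    rcases List.mem_cons.1 he with rfl | he
    · simp [pathVerts, h.1]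
    · exact List.mem_cons_of_mem _ (ih h.2 he)

theorem tgt_mem_pathVerts {v : T.Vertex} {p : List E} {e : E} (he : e ∈ p) :
    T.tgt e ∈ T.pathVerts v p := List.mem_cons_of_mem _ (List.mem_map_of_mem he)

theorem IsPath.end_mem {v w : T.Vertex} {p : List E} (h : T.IsPath v p w) :
    w ∈ T.pathVerts v p := by
  induction p generalizing v with
  | nil => simp [pathVerts, show v = w from h]
  | cons f p ih => exact List.mem_cons_of_mem _ (ih h.2)

theorem IsPath.pathVerts_eq {v w : T.Vertex} {p : List E} (h : T.IsPath v p w) :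
    T.pathVerts v p = p.map T.src ++ [w] := by
  induction p generalizing v with
  | nil => simp [pathVerts, show v = w from h]
  | cons f p ih =>
    have := ih h.2
    simp only [pathVerts, List.map_cons, List.cons_append] at this ⊢
    rw [this, h.1]

theorem IsPath.exists_split {v w u : T.Vertex} {p : List E} (h : T.IsPath v p w)
    (hu : u ∈ T.pathVerts v p) : ∃ s t, p = s ++ t ∧ T.IsPath v s u ∧ T.IsPath u t w := by
  induction p generalizing v with
  | nil =>
    have h0 : u = v := by simpa [pathVerts] using hu
    exact ⟨[], [], rfl, h0.symm, h0.trans h⟩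
  | cons f p ih =>
    rcases List.mem_cons.1 hu with rfl | hu
    · exact ⟨[], f :: p, rfl, rfl, h⟩
    · obtain ⟨s, t, rfl, hs, ht⟩ := ih h.2 hu
      exact ⟨f :: s, t, rfl, ⟨h.1, hs⟩, ht⟩

theorem mem_pathVerts_append_left {v x : T.Vertex} {p q : List E}
    (hx : x ∈ T.pathVerts v p) : x ∈ T.pathVerts v (p ++ q) := by
  simp only [pathVerts, List.map_append, List.mem_cons, List.mem_append] at hx ⊢
  tauto

/-- A path that visits a vertex twice contains a simple closed path. -/
theorem IsPath.nodup_or_exists_cycle {v w : T.Vertex} {p : List E} (h : T.IsPath v p w) :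
    (T.pathVerts v p).Nodup ∨ ∃ u s q t, p = s ++ q ++ t ∧ q ≠ [] ∧ T.IsPath u q u ∧
      (q.map T.tgt).Nodup := by
  induction p generalizing v with
  | nil => left; simp [pathVerts]
  | cons e p ih =>
    rcases ih h.2 with hn | ⟨u, s, q, t, rfl, hq⟩
    · by_cases hv : v ∈ T.pathVerts (T.tgt e) p
      · right
        obtain ⟨s, t, rfl, hs, ht⟩ := h.2.exists_split hv
        refine ⟨v, [], e :: s, t, by simp, by simp, ⟨h.1, hs⟩, ?_⟩
        refine List.Nodup.sublist ?_ hn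
        simp [pathVerts]
      · left
        exact List.nodup_cons.2 ⟨hv, hn⟩
    · right
      exact ⟨u, e :: s, q, t, by simp, hq⟩

theorem infix_of_infix_concat {W p : List E} {a : E} (h : W <:+: p ++ [a]) (hW : W ≠ []) :
    W <:+: p ∨ ∃ s W₀, p = s ++ W₀ ∧ W = W₀ ++ [a] := by
  obtain ⟨s, t, h⟩ := h
  rcases List.eq_nil_or_concat t with rfl | ⟨t, b, rfl⟩
  · right
    rcases List.eq_nil_or_concat W with rfl | ⟨W₀, b, rfl⟩
    · exact absurd rfl hW
    · rw [List.append_nil, List.concat_eq_append, ← List.append_assoc] at h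
      have h' := List.append_inj' h rfl
      refine ⟨s, W₀, h'.1.symm, ?_⟩
      rw [List.concat_eq_append, h'.2]
  · left
    rw [List.concat_eq_append, ← List.append_assoc] at h
    exact ⟨s, t, (List.append_inj' h rfl).1⟩

end Basics
end BicoloredMap

namespace BicoloredMap

/-! ### Connected components of the complement of a set of edges -/

section Components

variable {E : Type*} {T : BicoloredMap E}

/-- The faces `F` and `G` lie in the same component of the complement of `A`. -/
def Conn (T : BicoloredMap E) (A : Set E) (F G : T.Face) : Prop :=
  Relation.ReflTransGen (T.FaceAdj A) F G

theorem FaceAdj.symm {A : Set E} {F G : T.Face} (h : T.FaceAdj A F G) : T.FaceAdj A G F := by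
  obtain ⟨e, he, c, hF, hG⟩ := h
  exact ⟨e, he, !c, hG, by simpa using hF⟩

namespace Conn

variable {A A' : Set E} {F G H : T.Face}

theorem refl (F : T.Face) : T.Conn A F F := Relation.ReflTransGen.refl

theorem of_eq (h : F = G) : T.Conn A F G := h ▸ refl F

theorem trans (h : T.Conn A F G) (h' : T.Conn A G H) : T.Conn A F H :=
  Relation.ReflTransGen.trans h h'

theorem symm (h : T.Conn A F G) : T.Conn A G F :=
  have : Std.Symm (T.FaceAdj A) := ⟨fun _ _ => FaceAdj.symm⟩
  Std.Symm.symm (r := Relation.ReflTransGen (T.FaceAdj A)) _ _ h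

theorem cross {e : E} (he : e ∉ A) (c d : Bool) : T.Conn A (T.face c e) (T.face d e) := by
  by_cases h : d = c
  · subst h; exact refl _
  · have : d = !c := by cases c <;> cases d <;> simp_all
    subst this
    exact Relation.ReflTransGen.single ⟨e, he, c, rfl, rfl⟩

theorem mono (hA : A ⊆ A') (h : T.Conn A' F G) : T.Conn A F G :=
  Relation.ReflTransGen.lift id (fun _ _ ⟨e, he, h⟩ => ⟨e, fun h' => he (hA h'), h⟩) _ _ h

theorem enclosed_iff (h : T.Conn A F G) : T.Enclosed A F ↔ T.Enclosed A G := by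
  have : {H | T.Conn A F H} = {H | T.Conn A G H} :=
    Set.ext fun H => ⟨h.symm.trans, h.trans⟩
  unfold Enclosed
  exact this ▸ Iff.rfl

end Conn

theorem enclosed_cross {A : Set E} {e : E} (he : e ∉ A) {c : Bool} (d : Bool)
    (h : T.Enclosed A (T.face c e)) : T.Enclosed A (T.face d e) :=
  (Conn.cross he c d).enclosed_iff.1 h

theorem Enclosed.mono {A A' : Set E} (hA : A ⊆ A') {F : T.Face} (h : T.Enclosed A F) :
    T.Enclosed A' F :=
  Set.Finite.subset h fun _ hG => Conn.mono hA hG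

theorem enclosed_of_finite_closed {A : Set E} {R : Set T.Face} (hR : R.Finite)
    (hcl : ∀ e ∉ A, ∀ c, T.face c e ∈ R → T.face (!c) e ∈ R) {F : T.Face} (hF : F ∈ R) :
    T.Enclosed A F := by
  refine hR.subset fun G hG => ?_
  induction hG with
  | refl => exact hF
  | tail _ h ih =>
    obtain ⟨e, he, c, rfl, rfl⟩ := h
    exact hcl e he c ih

/-- The edges in the closed region bounded by `A`. -/
def regionEdges (T : BicoloredMap E) (A : Set E) : Set E :=
  {e | e ∈ A ∨ T.Enclosed A (T.face true e)}

theorem mem_regionEdges_of_enclosed {A : Set E} {e : E} {c : Bool}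
    (h : T.Enclosed A (T.face c e)) : e ∈ T.regionEdges A := by
  by_cases he : e ∈ A
  · exact Or.inl he
  · exact Or.inr (enclosed_cross he true h)

/-- Taking closed regions is a closure operation. -/
theorem Enclosed.of_subset_regionEdges {A A' : Set E} (hA : A' ⊆ T.regionEdges A) {F : T.Face}
    (h : T.Enclosed A' F) : T.Enclosed A F := by
  by_contra hF
  refine hF (Set.Finite.subset h fun G hG => ?_)
  change T.Conn A F G at hG
  change T.Conn A' F G
  induction hG with
  | refl => exact Conn.refl _
  | @tail G H hFG hGH ih =>
    obtain ⟨e, he, c, rfl, rfl⟩ := hGH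
    refine ih.trans (Conn.cross (fun he' => ?_) _ _)
    rcases hA he' with h1 | h1
    · exact he h1
    · exact hF ((Conn.enclosed_iff hFG).2 (enclosed_cross he c h1))

/-- A face whose boundary belongs to `A` is a component of the complement of `A`. -/
theorem enclosed_of_boundary_subset {A : Set E} {c : Bool} {e : E}
    (h : ∀ u, T.face c u = T.face c e → u ∈ A) : T.Enclosed A (T.face c e) := by
  refine enclosed_of_finite_closed (Set.finite_singleton _) (fun u hu d hd => ?_) rfl
  obtain rfl := color_eq_of_face_eq hd
  exact absurd (h u hd) hu

/-- The properties of the universal cover of a shrubby quiver on the torus on which the proof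
relies. -/
structure IsShrubbyCover (T : BicoloredMap E) : Prop where
  conn : ∀ P : E → Prop, (∃ x, P x) → (∀ c x, P x ↔ P (T.next c x)) → ∀ x, P x
  three_le : ∀ c e, 3 ≤ T.faceSize c e
  periodic : ∀ e, e ∈ Function.periodicPts T.rot
  infinite : Infinite T.Face
  shrubby : T.Shrubby

namespace IsShrubbyCover

variable (hT : T.IsShrubbyCover)
include hT

theorem exists_conn_of_mem {A : Set E} (hA : A.Nonempty) (F : T.Face) :
    ∃ e ∈ A, ∃ c, T.Conn A F (T.face c e) := by
  have key : ∀ x, ∃ e ∈ A, ∃ c, T.Conn A (T.face true x) (T.face c e) := by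
    refine hT.conn _ ?_ ?_
    · obtain ⟨a, ha⟩ := hA
      exact ⟨a, a, ha, true, Conn.refl _⟩
    · intro c x
      cases c with
      | true => rw [face_next]
      | false =>
        have hred := face_next (T := T) false x
        generalize T.next false x = y at hred
        have main : ∀ {x y : E}, T.face false y = T.face false x →
            (∃ e ∈ A, ∃ c, T.Conn A (T.face true x) (T.face c e)) →
            ∃ e ∈ A, ∃ c, T.Conn A (T.face true y) (T.face c e) := by
          intro x y hxy hx
          by_cases hy : y ∈ A
          · exact ⟨y, hy, true, Conn.refl _⟩
          · have h1 : T.Conn A (T.face true y) (T.face false x) :=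
              (Conn.cross hy true false).trans (Conn.of_eq hxy)
            by_cases hx' : x ∈ A
            · exact ⟨x, hx', false, h1⟩
            · obtain ⟨e, he, c, h⟩ := hx
              exact ⟨e, he, c, h1.trans ((Conn.cross hx' _ _).trans h)⟩
        exact ⟨main hred, main hred.symm⟩
  obtain ⟨c, q⟩ := F
  obtain ⟨x, rfl⟩ := Quotient.exists_rep q
  change ∃ e ∈ A, ∃ d, T.Conn A (T.face c x) (T.face d e)
  cases c with
  | true => exact key x
  | false =>
    by_cases hx : x ∈ A
    · exact ⟨x, hx, false, Conn.refl _⟩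
    · obtain ⟨e, he, c, h⟩ := key x
      exact ⟨e, he, c, (Conn.cross hx _ _).trans h⟩

theorem finite_enclosed {A : Set E} (hA : A.Finite) (hne : A.Nonempty) :
    {F | T.Enclosed A F}.Finite := by
  have h : {F | T.Enclosed A F} ⊆ ⋃ e ∈ A, ⋃ c ∈ {c | T.Enclosed A (T.face c e)},
      {G | T.Conn A (T.face c e) G} := by
    intro F hF
    obtain ⟨e, he, c, h⟩ := hT.exists_conn_of_mem hne F
    simp only [Set.mem_iUnion]
    exact ⟨e, he, c, h.enclosed_iff.1 hF, h.symm⟩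
  refine Set.Finite.subset ?_ h
  exact hA.biUnion fun e _ => (Set.toFinite _).biUnion fun c hc => hc

theorem encl_ncard_lt {A A' : Set E} (hA : A.Finite) (hne : A.Nonempty)
    (hsub : A' ⊆ T.regionEdges A) {F : T.Face} (hF : T.Enclosed A F) (hF' : ¬ T.Enclosed A' F) :
    {F | T.Enclosed A' F}.ncard < {F | T.Enclosed A F}.ncard := by
  refine Set.ncard_lt_ncard ?_ (hT.finite_enclosed hA hne)
  refine ⟨fun G hG => hG.of_subset_regionEdges hsub, fun h => hF' (h hF)⟩

end IsShrubbyCover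

end Components

/-! ### Rotation around a vertex -/

section Rotation

variable {E : Type*} {T : BicoloredMap E}

/-- The counterclockwise rotation on half-edges around vertices: `(e, true)` is the half of `e` at
its head, and `(e, false)` is its half at its tail. The face between a half-edge `h` and
`T.halfRot h` is `T.face h.2 h.1`. -/
def halfRot (T : BicoloredMap E) : Equiv.Perm (E × Bool) where
  toFun h := match h with
    | (e, true) => (T.next true e, false)
    | (e, false) => ((T.next false).symm e, true)
  invFun h := match h with
    | (e, false) => ((T.next true).symm e, true)
    | (e, true) => (T.next false e, false)
  left_inv := by rintro ⟨e, _ | _⟩ <;> simp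
  right_inv := by rintro ⟨e, _ | _⟩ <;> simp

/-- The vertex at a half-edge. -/
def halfVert (T : BicoloredMap E) (h : E × Bool) : T.Vertex :=
  if h.2 then T.tgt h.1 else T.src h.1

@[simp] theorem halfVert_true (e : E) : T.halfVert (e, true) = T.tgt e := rfl

theorem halfRot_true (e : E) : T.halfRot (e, true) = (T.next true e, false) := rfl

theorem snd_halfRot (h : E × Bool) : (T.halfRot h).2 = !h.2 := by
  rcases h with ⟨e, _ | _⟩ <;> rfl

theorem face_halfRot (h : E × Bool) : T.face h.2 (T.halfRot h).1 = T.face h.2 h.1 := by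
  rcases h with ⟨e, _ | _⟩
  · exact face_next_symm false e
  · exact face_next true e

theorem halfVert_halfRot (h : E × Bool) : T.halfVert (T.halfRot h) = T.halfVert h := by
  rcases h with ⟨e, _ | _⟩
  · exact tgt_next_symm false e
  · exact src_next true e

theorem halfVert_halfRot_pow (m : ℕ) (h : E × Bool) :
    T.halfVert ((T.halfRot ^ m) h) = T.halfVert h := by
  induction m with
  | zero => rfl
  | succ m ih => rw [pow_succ', Equiv.Perm.mul_apply, halfVert_halfRot, ih]

theorem halfRot_pow_two_mul (m : ℕ) (e : E) :
    (T.halfRot ^ (2 * m)) (e, true) = ((T.rot ^ m) e, true) := by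
  induction m with
  | zero => rfl
  | succ m ih =>
    rw [show 2 * (m + 1) = 1 + 1 + 2 * m by ring, pow_add, Equiv.Perm.mul_apply, ih,
      pow_succ' T.rot]
    rfl

/-- Rotating from a half-edge to another one without meeting `A` in between. -/
theorem conn_arc {A : Set E} {h : E × Bool} {m : ℕ}
    (hA : ∀ j, 0 < j → j ≤ m → ((T.halfRot ^ j) h).1 ∉ A) :
    T.Conn A (T.face h.2 h.1) (T.face ((T.halfRot ^ m) h).2 ((T.halfRot ^ m) h).1) := by
  induction m with
  | zero => exact Conn.refl _
  | succ m ih =>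
    refine (ih fun j h0 hj => hA j h0 (by omega)).trans ?_
    have h1 := hA (m + 1) (by omega) le_rfl
    rw [pow_succ', Equiv.Perm.mul_apply] at h1 ⊢
    rw [← face_halfRot]
    exact Conn.cross h1 _ _

/-- Variant of `conn_arc` ending at the clockwise side of the last half-edge, which may belong to
`A`. -/
theorem conn_arc' {A : Set E} {h : E × Bool} {m : ℕ}
    (hA : ∀ j, 0 < j → j ≤ m → ((T.halfRot ^ j) h).1 ∉ A) :
    T.Conn A (T.face h.2 h.1)
      (T.face (!((T.halfRot ^ (m + 1)) h).2) ((T.halfRot ^ (m + 1)) h).1) := by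
  refine (conn_arc hA).trans (Conn.of_eq ?_)
  rw [pow_succ', Equiv.Perm.mul_apply, snd_halfRot, Bool.not_not, face_halfRot]

theorem IsShrubbyCover.exists_rot_pow (hT : T.IsShrubbyCover) {e f : E} (h : T.tgt e = T.tgt f) :
    ∃ m < Function.minimalPeriod T.rot e, (T.rot ^ m) e = f := by
  obtain ⟨z, hz⟩ := tgt_eq_iff.1 h
  have hn : 0 < Function.minimalPeriod T.rot e :=
    Function.minimalPeriod_pos_of_mem_periodicPts (hT.periodic e)
  set n := Function.minimalPeriod T.rot e with hndef
  have hpz : (T.rot ^ (n : ℤ)) e = e := by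
    rw [zpow_natCast, Equiv.Perm.coe_pow]; exact Function.iterate_minimalPeriod
  have key : (T.rot ^ (z % (n : ℤ))) e = f := by
    conv_rhs => rw [← hz, ← Int.emod_add_mul_ediv z n, zpow_add, Equiv.Perm.mul_apply, zpow_mul]
    congr 1
    exact (Equiv.Perm.zpow_apply_eq_self_of_apply_eq_self hpz _).symm
  have hn' : (0 : ℤ) < n := by exact_mod_cast hn
  have hlt := Int.emod_lt_of_pos z hn'
  obtain ⟨m, hm⟩ := Int.eq_ofNat_of_zero_le (Int.emod_nonneg z hn'.ne')
  rw [hm] at key hlt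
  rw [zpow_natCast] at key
  exact ⟨m, by omega, key⟩

theorem IsShrubbyCover.exists_halfRot_pow (hT : T.IsShrubbyCover) {h h' : E × Bool}
    (hv : T.halfVert h = T.halfVert h') : ∃ m, (T.halfRot ^ m) h = h' := by
  have hin : ∀ {e f : E}, T.tgt e = T.tgt f → ∃ m, (T.halfRot ^ m) (e, true) = (f, true) := by
    intro e f h
    obtain ⟨m, -, hm⟩ := hT.exists_rot_pow h
    exact ⟨2 * m, by rw [halfRot_pow_two_mul, hm]⟩
  have hto : ∀ h : E × Bool, ∃ m e, (T.halfRot ^ m) h = (e, true) := by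
    rintro ⟨e, _ | _⟩
    · exact ⟨1, _, rfl⟩
    · exact ⟨0, e, rfl⟩
  have hfrom : ∀ h : E × Bool, ∃ m e, (T.halfRot ^ m) (e, true) = h := by
    rintro ⟨e, _ | _⟩
    · refine ⟨1, (T.next true).symm e, ?_⟩
      rw [pow_one, halfRot_true, Equiv.apply_symm_apply]
    · exact ⟨0, e, rfl⟩
  obtain ⟨m, e, hm⟩ := hto h
  obtain ⟨m', f, hm'⟩ := hfrom h'
  have h3 : T.tgt e = T.tgt f := by
    have h1 := halfVert_halfRot_pow (T := T) m h
    have h2 := halfVert_halfRot_pow (T := T) m' (f, true)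
    rw [hm, halfVert_true] at h1
    rw [hm', halfVert_true] at h2
    rw [h1, ← h2, hv]
  obtain ⟨l, hl⟩ := hin h3
  refine ⟨m' + (l + m), ?_⟩
  rw [pow_add, Equiv.Perm.mul_apply, pow_add, Equiv.Perm.mul_apply, hm, hl, hm']

/-- If at most two half-edges at a vertex belong to `A`, then the counterclockwise side of the first
one and the clockwise side of the second one lie in the same component. -/
theorem IsShrubbyCover.conn_of_two_halves (hT : T.IsShrubbyCover) {A : Set E} {h h' : E × Bool}
    (hv : T.halfVert h = T.halfVert h') (hne : h ≠ h')
    (hA : ∀ u, T.halfVert u = T.halfVert h → u.1 ∈ A → u = h ∨ u = h') :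
    T.Conn A (T.face h.2 h.1) (T.face (!h'.2) h'.1) := by
  classical
  have hex := hT.exists_halfRot_pow hv
  obtain ⟨m, hm, hmin⟩ : ∃ m, (T.halfRot ^ m) h = h' ∧ ∀ j < m, (T.halfRot ^ j) h ≠ h' :=
    ⟨Nat.find hex, Nat.find_spec hex, fun j hj => Nat.find_min hex hj⟩
  obtain ⟨m, rfl⟩ : ∃ k, m = k + 1 := by
    refine ⟨m - 1, ?_⟩
    have : m ≠ 0 := by rintro rfl; exact hne hm
    omega
  have := conn_arc' (T := T) (A := A) (h := h) (m := m) ?_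
  · rwa [hm] at this
  · intro j h0 hj hmem
    rcases hA _ (halfVert_halfRot_pow j h) hmem with h1 | h1
    · refine hmin (m + 1 - j) (by omega) ?_
      rw [← hm, show m + 1 = (m + 1 - j) + j by omega, pow_add, Equiv.Perm.mul_apply, h1]
      simp
    · exact hmin j (by omega) h1

/-- If no half-edge at a vertex belongs to `A`, all the faces at this vertex lie in the same
component. -/
theorem IsShrubbyCover.conn_of_no_half (hT : T.IsShrubbyCover) {A : Set E} {h h' : E × Bool}
    (hv : T.halfVert h = T.halfVert h')
    (hA : ∀ u, T.halfVert u = T.halfVert h → u.1 ∉ A) :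
    T.Conn A (T.face h.2 h.1) (T.face h'.2 h'.1) := by
  obtain ⟨m, rfl⟩ := hT.exists_halfRot_pow hv
  exact conn_arc fun j _ _ => hA _ (halfVert_halfRot_pow j h)

theorem IsShrubbyCover.finite_halves (hT : T.IsShrubbyCover) (v : T.Vertex) :
    {h | T.halfVert h = v}.Finite := by
  obtain ⟨e, rfl⟩ := Quotient.exists_rep v
  change {h | T.halfVert h = T.tgt e}.Finite
  obtain ⟨n, hn, hpe⟩ := hT.periodic e
  refine ((Finset.range (2 * n)).finite_toSet.image
    fun m => (T.halfRot ^ m) (e, true)).subset fun h hh => ?_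
  obtain ⟨m, rfl⟩ := hT.exists_halfRot_pow (h := (e, true)) hh.symm
  refine ⟨m % (2 * n), by simp [Nat.mod_lt _ (show 0 < 2 * n by omega)], ?_⟩
  have hper : (T.halfRot ^ (2 * n)) (e, true) = (e, true) := by
    rw [halfRot_pow_two_mul, Equiv.Perm.coe_pow]
    exact congrArg (·, true) hpe
  conv_rhs => rw [← Nat.mod_add_div m (2 * n), pow_add, Equiv.Perm.mul_apply, pow_mul]
  simp only
  congr 1
  exact (Equiv.Perm.pow_apply_eq_self_of_apply_eq_self hper _).symm

end Rotation

end BicoloredMap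

namespace BicoloredMap

/-! ### Simple closed curves formed by two paths -/

section SimplePairs

variable {E : Type*} {T : BicoloredMap E}

/-- The edges of two paths. -/
abbrev pairEdges (p p' : List E) : Set E := {e | e ∈ p ∨ e ∈ p'}

theorem pairEdges_comm (p p' : List E) : pairEdges p p' = pairEdges p' p :=
  Set.ext fun _ => Or.comm

theorem finite_pairEdges (p p' : List E) : (pairEdges p p').Finite :=
  (List.finite_toSet p).union (List.finite_toSet p')

/-- The paths `p` and `p'` from `v` to `w` form a simple closed curve: walking along `p`
and then backwards along `p'`, one meets the heads of the edges of `p` and the tails of those of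
`p'`, each just once. One of the paths may be empty, in which case the other one is closed. -/
structure SimplePair (T : BicoloredMap E) (v w : T.Vertex) (p p' : List E) : Prop where
  path : T.IsPath v p w
  path' : T.IsPath v p' w
  nodup : (p.map T.tgt ++ p'.map T.src).Nodup
  disj : p.Disjoint p'

namespace SimplePair

variable {v w : T.Vertex} {p p' : List E}

theorem nodup' (h : T.SimplePair v w p p') : (p'.map T.tgt ++ p.map T.src).Nodup := by
  refine (List.Perm.nodup_iff ?_).1 h.nodup
  have h1 : ((v :: p.map T.tgt : List _) : Multiset T.Vertex) = (p.map T.src ++ [w] : List _) :=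
    congrArg _ h.path.pathVerts_eq
  have h2 : ((v :: p'.map T.tgt : List _) : Multiset T.Vertex) = (p'.map T.src ++ [w] : List _) :=
    congrArg _ h.path'.pathVerts_eq
  rw [← Multiset.coe_eq_coe]
  simp only [← Multiset.cons_coe, ← Multiset.coe_add] at h1 h2 ⊢
  rw [← Multiset.cons_inj_right v, ← Multiset.cons_add, ← Multiset.cons_add, h1, h2]
  abel

theorem symm (h : T.SimplePair v w p p') : T.SimplePair v w p' p :=
  ⟨h.path', h.path, h.nodup', h.disj.symm⟩

theorem eq_of_tgt_eq (h : T.SimplePair v w p p') {a b : E} (ha : a ∈ p) (hb : b ∈ p)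
    (hab : T.tgt a = T.tgt b) : a = b :=
  List.inj_on_of_nodup_map (List.nodup_append'.1 h.nodup).1 ha hb hab

theorem eq_of_src_eq (h : T.SimplePair v w p p') {a b : E} (ha : a ∈ p) (hb : b ∈ p)
    (hab : T.src a = T.src b) : a = b :=
  List.inj_on_of_nodup_map (List.nodup_append'.1 h.nodup').2.1 ha hb hab

theorem tgt_ne_src (h : T.SimplePair v w p p') {a b : E} (ha : a ∈ p) (hb : b ∈ p') :
    T.tgt a ≠ T.src b := fun hab =>
  (List.nodup_append'.1 h.nodup).2.2 (List.mem_map_of_mem ha) (hab ▸ List.mem_map_of_mem hb)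

theorem nodup_left (h : T.SimplePair v w p p') : p.Nodup :=
  List.Nodup.of_map _ (List.nodup_append'.1 h.nodup).1

theorem conn_next (hT : T.IsShrubbyCover) (h : T.SimplePair v w p p') {a b : E} {s t : List E}
    (hp : p = s ++ a :: b :: t) (c : Bool) :
    T.Conn (pairEdges p p') (T.face c a) (T.face c b) := by
  have hab : T.tgt a = T.src b := by
    have := h.path
    rw [hp, isPath_append] at this
    obtain ⟨u, -, -, h1, -⟩ := this
    exact h1.symm
  have ha : a ∈ p := by simp [hp]
  have hb : b ∈ p := by simp [hp]
  have key : ∀ u : E × Bool, T.halfVert u = T.tgt a → u.1 ∈ pairEdges p p' →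
      u = (a, true) ∨ u = (b, false) := by
    rintro ⟨e, _ | _⟩ hu hmem
    · right
      rcases hmem with he | he
      · rw [show e = b from h.eq_of_src_eq he hb (hu.trans hab)]
      · exact absurd hu.symm (h.tgt_ne_src ha he)
    · left
      rcases hmem with he | he
      · rw [show e = a from h.eq_of_tgt_eq he ha hu]
      · exact absurd (hu.trans hab) (h.symm.tgt_ne_src he hb)
  cases c with
  | true => exact hT.conn_of_two_halves (h := (a, true)) (h' := (b, false)) hab (by simp) key
  | false =>
    exact (hT.conn_of_two_halves (h := (b, false)) (h' := (a, true)) hab.symm (by simp)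
      fun u hu hm => (key u (hu.trans hab.symm) hm).symm).symm

theorem conn_of_mem (hT : T.IsShrubbyCover) (h : T.SimplePair v w p p') {a b : E}
    (ha : a ∈ p) (hb : b ∈ p) (c : Bool) :
    T.Conn (pairEdges p p') (T.face c a) (T.face c b) := by
  have key : ∀ (t s : List E) (a : E), p = s ++ a :: t → ∀ b ∈ t,
      T.Conn (pairEdges p p') (T.face c a) (T.face c b) := by
    intro t
    induction t with
    | nil => simp
    | cons d t ih =>
      intro s a hp b hb
      have h1 := h.conn_next hT hp c
      rcases List.mem_cons.1 hb with rfl | hb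
      · exact h1
      · exact h1.trans (ih (s ++ [a]) d (by simp [hp]) b hb)
  cases hpe : p with
  | nil => rw [hpe] at ha; simp at ha
  | cons d t =>
    rw [hpe] at ha hb
    have hd : ∀ x ∈ d :: t, T.Conn (pairEdges p p') (T.face c d) (T.face c x) := by
      intro x hx
      rcases List.mem_cons.1 hx with rfl | hx
      · exact Conn.refl _
      · exact key t [] d hpe x hx
    rw [← hpe]
    exact (hd a ha).symm.trans (hd b hb)

theorem conn_of_mem_of_mem (hT : T.IsShrubbyCover) (h : T.SimplePair v w p p') {a b : E}
    (ha : a ∈ p) (hb : b ∈ p') (c : Bool) :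
    T.Conn (pairEdges p p') (T.face c a) (T.face (!c) b) := by
  obtain ⟨s, x, rfl⟩ : ∃ s x, p = s ++ [x] := by
    rcases List.eq_nil_or_concat p with rfl | ⟨s, x, rfl⟩
    · simp at ha
    · exact ⟨s, x, by simp⟩
  obtain ⟨s', y, rfl⟩ : ∃ s x, p' = s ++ [x] := by
    rcases List.eq_nil_or_concat p' with rfl | ⟨s, x, rfl⟩
    · simp at hb
    · exact ⟨s, x, by simp⟩
  have hx : x ∈ s ++ [x] := by simp
  have hy : y ∈ s' ++ [y] := by simp
  have hxw := (isPath_concat.1 h.path).2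
  have hyw := (isPath_concat.1 h.path').2
  have hxy : x ≠ y := fun hxy => h.disj hx (hxy ▸ hy)
  have key : ∀ u : E × Bool, T.halfVert u = w → u.1 ∈ pairEdges (s ++ [x]) (s' ++ [y]) →
      u = (x, true) ∨ u = (y, true) := by
    rintro ⟨e, _ | _⟩ hu hmem
    · exfalso
      rcases hmem with he | he
      · exact h.symm.tgt_ne_src hy he (hyw.trans hu.symm)
      · exact h.tgt_ne_src hx he (hxw.trans hu.symm)
    · rcases hmem with he | he
      · left; rw [show e = x from h.eq_of_tgt_eq he hx (hu.trans hxw.symm)]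
      · right; rw [show e = y from h.symm.eq_of_tgt_eq he hy (hu.trans hyw.symm)]
  have hmid : T.Conn (pairEdges (s ++ [x]) (s' ++ [y])) (T.face c x) (T.face (!c) y) := by
    cases c with
    | true =>
      exact hT.conn_of_two_halves (h := (x, true)) (h' := (y, true)) (hxw.trans hyw.symm)
        (by simpa using hxy) fun u hu => key u (hu.trans hxw)
    | false =>
      exact (hT.conn_of_two_halves (h := (y, true)) (h' := (x, true)) (hyw.trans hxw.symm)
        (by simpa using hxy.symm) fun u hu hm => (key u (hu.trans hyw) hm).symm).symm
  have hb' := h.symm.conn_of_mem hT hy hb (!c)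
  rw [pairEdges_comm] at hb'
  exact (h.conn_of_mem hT ha hx c).trans (hmid.trans hb')

/-- Every face lies in the same component of the complement of the curve as one of the two faces
incident to a given edge of the curve. -/
theorem exists_conn (hT : T.IsShrubbyCover) (h : T.SimplePair v w p p') {u : E}
    (hu : u ∈ pairEdges p p') (F : T.Face) :
    ∃ c, T.Conn (pairEdges p p') F (T.face c u) := by
  obtain ⟨e, he, c, hc⟩ := hT.exists_conn_of_mem ⟨u, hu⟩ F
  rcases he with he | he <;> rcases hu with hu | hu
  · exact ⟨c, hc.trans (h.conn_of_mem hT he hu c)⟩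
  · exact ⟨!c, hc.trans (h.conn_of_mem_of_mem hT he hu c)⟩
  · refine ⟨!c, hc.trans ?_⟩
    rw [pairEdges_comm]; exact h.symm.conn_of_mem_of_mem hT he hu c
  · refine ⟨c, hc.trans ?_⟩
    rw [pairEdges_comm]; exact h.symm.conn_of_mem hT he hu c

/-- A simple closed curve does not enclose both sides of one of its edges: there are at most two
components, and infinitely many faces. -/
theorem not_enclosed (hT : T.IsShrubbyCover) (h : T.SimplePair v w p p') {u : E}
    (hu : u ∈ pairEdges p p') {d : Bool} (hd : T.Enclosed (pairEdges p p') (T.face d u)) :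
    ¬ T.Enclosed (pairEdges p p') (T.face (!d) u) := by
  intro hd'
  have hall : (Set.univ : Set T.Face) ⊆ ⋃ c, {G | T.Conn (pairEdges p p') (T.face c u) G} := by
    intro F _
    obtain ⟨c, hc⟩ := h.exists_conn hT hu F
    exact Set.mem_iUnion.2 ⟨c, hc.symm⟩
  have hfin : (⋃ c, {G | T.Conn (pairEdges p p') (T.face c u) G}).Finite := by
    refine Set.finite_iUnion fun c => ?_
    by_cases hcd : c = d
    · subst hcd; exact hd
    · have : c = !d := by cases c <;> cases d <;> simp_all
      subst this; exact hd'
  have := hT.infinite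
  exact Set.infinite_univ (hfin.subset hall)

/-- Replacing a simple closed curve by a curve that stays in its closed region and avoids one
of its edges makes the enclosed region smaller. -/
theorem ncard_lt (hT : T.IsShrubbyCover) (h : T.SimplePair v w p p') {u : E}
    (hu : u ∈ pairEdges p p') {d : Bool} (hd : T.Enclosed (pairEdges p p') (T.face d u))
    {A : Set E} (hA : A ⊆ T.regionEdges (pairEdges p p')) (huA : u ∉ A) :
    {F | T.Enclosed A F}.ncard < {F | T.Enclosed (pairEdges p p') F}.ncard := by
  refine hT.encl_ncard_lt (finite_pairEdges p p') ⟨u, hu⟩ hA hd fun h1 => ?_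
  exact h.not_enclosed hT hu hd ((enclosed_cross huA _ h1).of_subset_regionEdges hA)

/-- Replacing a broken wheel of the curve whose interface is enclosed by its mirror image. -/
theorem swap (hT : T.IsShrubbyCover) {s t : List E} {c : Bool} {e : E}
    (h : T.SimplePair v w (s ++ T.wheel c e ++ t) p')
    (he : T.Enclosed (pairEdges (s ++ T.wheel c e ++ t) p') (T.face true e))
    (he' : e ∉ pairEdges (s ++ T.wheel c e ++ t) p') :
    T.IsPath v (s ++ T.wheel (!c) e ++ t) w ∧
    pairEdges (s ++ T.wheel (!c) e ++ t) p' ⊆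
      T.regionEdges (pairEdges (s ++ T.wheel c e ++ t) p') ∧
    {F | T.Enclosed (pairEdges (s ++ T.wheel (!c) e ++ t) p') F}.ncard <
      {F | T.Enclosed (pairEdges (s ++ T.wheel c e ++ t) p') F}.ncard := by
  have hpos : ∀ d e, 0 < T.faceSize d e := fun d e => by have := hT.three_le d e; omega
  have hpath : T.IsPath v (s ++ T.wheel (!c) e ++ t) w := by
    have := h.path
    rw [List.append_assoc, isPath_append] at this ⊢
    obtain ⟨x, h1, h2⟩ := this
    rw [isPath_append] at h2
    obtain ⟨y, h2, h3⟩ := h2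
    refine ⟨x, h1, isPath_append.2 ⟨y, ?_, h3⟩⟩
    have h4 := isPath_wheel (T := T) c e (hpos _ _)
    obtain ⟨w, -, hw⟩ := wheel_eq_cons (T := T) c e (hT.three_le _ _)
    have hne : T.wheel c e ≠ [] := by simp [hw]
    obtain rfl := IsPath.unique_start hne h4 h2
    obtain rfl := h4.unique_end h2
    exact isPath_wheel _ _ (hpos _ _)
  have hall : ∀ d u, T.face d u = T.face d e →
      T.Enclosed (pairEdges (s ++ T.wheel c e ++ t) p') (T.face d u) :=
    fun d u hu => hu ▸ enclosed_cross he' d he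
  have hsub : pairEdges (s ++ T.wheel (!c) e ++ t) p' ⊆
      T.regionEdges (pairEdges (s ++ T.wheel c e ++ t) p') := by
    rintro u (hu | hu)
    · rw [List.mem_append, List.mem_append] at hu
      rcases hu with (hu | hu) | hu
      · exact Or.inl (Or.inl (by simp [hu]))
      · exact mem_regionEdges_of_enclosed (hall (!c) u ((mem_wheel (hpos _ _)).1 hu).1)
      · exact Or.inl (Or.inl (by simp [hu]))
    · exact Or.inl (Or.inr hu)
  refine ⟨hpath, hsub, ?_⟩
  obtain ⟨w', -, hw⟩ := wheel_eq_cons (T := T) c e (hT.three_le _ _)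
  set u := T.next c e
  have hu : u ∈ T.wheel c e := by simp [hw]
  have hup : u ∈ s ++ T.wheel c e ++ t := by simp [hu]
  have huc := hall c u ((mem_wheel (hpos _ _)).1 hu).1
  have hnot := h.not_enclosed hT (Or.inl hup) huc
  refine h.ncard_lt hT (Or.inl hup) huc hsub ?_
  have hnd := h.nodup_left
  rw [List.nodup_append', List.nodup_append'] at hnd
  -- The edge `u` lies on the old curve but not on the new one: its other side is not enclosed, so
  -- that it does not belong to the mirror image.
  rintro (h1 | h1)
  · rw [List.mem_append, List.mem_append] at h1
    rcases h1 with (h1 | h1) | h1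
    · exact hnd.1.2.2 h1 hu
    · exact hnot (hall (!c) u ((mem_wheel (hpos _ _)).1 h1).1)
    · exact hnd.2.2 (List.mem_append_right _ hu) h1
  · exact h.disj hup h1

end SimplePair

end SimplePairs
end BicoloredMap

namespace BicoloredMap

/-! ### Paths in shrubs -/

section Shrubs

variable {E : Type*} {T : BicoloredMap E}

theorem IsShrubbyCover.faceSize_pos (hT : T.IsShrubbyCover) (c : Bool) (e : E) :
    0 < T.faceSize c e := by
  have := hT.three_le c e
  omega

theorem IsShrubbyCover.wheel_ne_nil (hT : T.IsShrubbyCover) (c : Bool) (e : E) :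
    T.wheel c e ≠ [] := by
  obtain ⟨w, -, hw⟩ := wheel_eq_cons (T := T) c e (hT.three_le _ _)
  simp [hw]

theorem IsShrubbyCover.mem_wheel (hT : T.IsShrubbyCover) {c : Bool} {e u : E} :
    u ∈ T.wheel c e ↔ T.face c u = T.face c e ∧ u ≠ e :=
  BicoloredMap.mem_wheel (hT.faceSize_pos c e)

theorem IsShrubbyCover.isPath_wheel (hT : T.IsShrubbyCover) (c : Bool) (e : E) :
    T.IsPath (T.tgt e) (T.wheel c e) (T.src e) :=
  BicoloredMap.isPath_wheel _ _ (hT.faceSize_pos c e)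

theorem IsShrubbyCover.isPath_append_wheel (hT : T.IsShrubbyCover) {v w : T.Vertex} {s : List E}
    {c : Bool} {e : E} (h : T.IsPath v (s ++ T.wheel c e) w) :
    T.IsPath v s (T.tgt e) ∧ w = T.src e := by
  obtain ⟨x, h1, h2⟩ := isPath_append.1 h
  have h3 := hT.isPath_wheel c e
  obtain rfl := IsPath.unique_start (hT.wheel_ne_nil c e) h2 h3
  exact ⟨h1, h2.unique_end h3⟩

/-- The last edge of a broken wheel is the one before the interface. -/
theorem IsShrubbyCover.next_eq_of_wheel (hT : T.IsShrubbyCover) {c : Bool} {e a : E} {w : List E}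
    (h : T.wheel c e = w ++ [a]) : T.next c a = e := by
  obtain ⟨w', -, hw⟩ := wheel_next_eq (T := T) c ((T.next c).symm e) (hT.three_le _ _)
  rw [Equiv.apply_symm_apply, h] at hw
  have := (List.append_inj' hw rfl).2
  rw [List.singleton_inj] at this
  rw [this, Equiv.apply_symm_apply]

theorem IsShrubbyCover.ncard_le (hT : T.IsShrubbyCover) {A A' : Set E} (hA : A.Finite)
    (hne : A.Nonempty) (hsub : A' ⊆ T.regionEdges A) :
    {F | T.Enclosed A' F}.ncard ≤ {F | T.Enclosed A F}.ncard :=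
  Set.ncard_le_ncard (fun _ hG => hG.of_subset_regionEdges hsub) (hT.finite_enclosed hA hne)

/-- Two paths with the same start have tails that meet only at their common start. -/
theorem exists_tails_meeting_once {v x y : T.Vertex} {p q : List E} (hp : T.IsPath v p x)
    (hq : T.IsPath v q y) : ∃ v' p₀ p' q₀ q', p = p₀ ++ p' ∧ q = q₀ ++ q' ∧ T.IsPath v p₀ v' ∧
      T.IsPath v q₀ v' ∧ T.IsPath v' p' x ∧ T.IsPath v' q' y ∧
      ∀ u ∈ T.pathVerts v' p', u ∈ T.pathVerts v' q' → u = v' := by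
  by_cases h : ∀ u ∈ T.pathVerts v p, u ∈ T.pathVerts v q → u = v
  · exact ⟨v, [], p, [], q, rfl, rfl, rfl, rfl, hp, hq, h⟩
  · push Not at h
    obtain ⟨u, hup, huq, hne⟩ := h
    obtain ⟨s, t, rfl, hs, ht⟩ := hp.exists_split hup
    obtain ⟨s', t', rfl, hs', ht'⟩ := hq.exists_split huq
    have hlen : 0 < s.length := by
      cases s with
      | nil => exact absurd (show v = u from hs).symm hne
      | cons => simp
    obtain ⟨v', p₀, p', q₀, q', rfl, rfl, h1, h2, h3⟩ := exists_tails_meeting_once ht ht'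
    exact ⟨v', s ++ p₀, p', s' ++ q₀, q', by simp, by simp, isPath_append.2 ⟨_, hs, h1⟩,
      isPath_append.2 ⟨_, hs', h2⟩, h3⟩
  termination_by p.length + q.length
  decreasing_by
    subst_vars
    simp only [List.length_append]
    omega

theorem nodup_of_meeting_once {v : T.Vertex} {p q : List E} (hp : (T.pathVerts v p).Nodup)
    (hq : (T.pathVerts v q).Nodup)
    (h : ∀ u ∈ T.pathVerts v p, u ∈ T.pathVerts v q → u = v) :
    (q.map T.tgt ++ T.pathVerts v p).Nodup := by
  have hq' := List.nodup_cons.1 hq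
  refine List.nodup_append'.2 ⟨hq'.2, hp, fun u h1 h2 => ?_⟩
  exact hq'.1 (h u h2 (List.mem_cons_of_mem _ h1) ▸ h1)

theorem disjoint_of_meeting_once {v : T.Vertex} {p q : List E} (hq : (T.pathVerts v q).Nodup)
    (h : ∀ u ∈ T.pathVerts v p, u ∈ T.pathVerts v q → u = v) : p.Disjoint q := by
  intro u h1 h2
  have h3 := h _ (tgt_mem_pathVerts h1) (tgt_mem_pathVerts h2)
  exact (List.nodup_cons.1 hq).1 (h3 ▸ List.mem_map_of_mem h2)

namespace Subgraph

variable {S : T.Subgraph}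

theorem ContainsPath.append {p q : List E} (hp : S.ContainsPath p) (hq : S.ContainsPath q) :
    S.ContainsPath (p ++ q) := fun e he => (List.mem_append.1 he).elim (hp e) (hq e)

theorem ContainsPath.of_infix {p q : List E} (hq : S.ContainsPath q) (h : p <:+: q) :
    S.ContainsPath p := fun e he => hq e (h.subset he)

theorem ContainsPath.left {p q : List E} (h : S.ContainsPath (p ++ q)) : S.ContainsPath p :=
  fun e he => h e (List.mem_append_left _ he)

theorem ContainsPath.right {p q : List E} (h : S.ContainsPath (p ++ q)) : S.ContainsPath q :=
  fun e he => h e (List.mem_append_right _ he)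

theorem Reaches.refl (v : T.Vertex) : S.Reaches v v := ⟨[], rfl, fun _ h => by simp at h⟩

theorem Reaches.trans {u v w : T.Vertex} (h : S.Reaches u v) (h' : S.Reaches v w) :
    S.Reaches u w := by
  obtain ⟨p, hp, hpS⟩ := h
  obtain ⟨q, hq, hqS⟩ := h'
  exact ⟨p ++ q, isPath_append.2 ⟨v, hp, hq⟩, hpS.append hqS⟩

namespace IsPreShrub

variable (hT : T.IsShrubbyCover) (hS : S.IsPreShrub)
include hT hS

theorem interface_notMem {c : Bool} {e : E} (h : S.ContainsPath (T.wheel c e)) :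
    e ∉ S.edges := by
  intro he
  obtain ⟨f, hf, hfS⟩ := hS.no_face c e
  by_cases hfe : f = e
  · exact hfS (hfe ▸ he)
  · exact hfS (h f (hT.mem_wheel.2 ⟨(face_eq_iff.2 hf).symm, hfe⟩))

/-- A pre-shrub contains no oriented cycle: shrubbiness would allow to shrink it by replacing
broken wheels by their mirror images. -/
theorem eq_nil_of_closed {v : T.Vertex} {p : List E} (hp : T.IsPath v p v)
    (hpS : S.ContainsPath p) : p = [] := by
  by_contra hne
  induction hN : {F | T.Enclosed (pairEdges p []) F}.ncard using Nat.strong_induction_on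
    generalizing v p with
  | _ N ih =>
  rcases hp.nodup_or_exists_cycle with hnd | ⟨u, s, q, t, rfl, hq, hqp, hnd⟩
  · refine (List.nodup_cons.1 hnd).1 ?_
    obtain ⟨s, a, rfl⟩ : ∃ s a, p = s ++ [a] := by
      rcases List.eq_nil_or_concat p with rfl | ⟨s, x, rfl⟩
      · exact absurd rfl hne
      · exact ⟨s, x, by simp⟩
    simp [(isPath_concat.1 hp).2]
  · have hqS : S.ContainsPath q := hpS.left.right
    have hsub : pairEdges q [] ⊆ T.regionEdges (pairEdges (s ++ q ++ t) []) := by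
      rintro e (he | he)
      · exact Or.inl (Or.inl (by simp [he]))
      · simp at he
    obtain ⟨a, ha⟩ := List.exists_mem_of_ne_nil q hq
    have hle := hT.ncard_le (finite_pairEdges _ _) ⟨a, Or.inl (by simp [ha])⟩ hsub
    have hsp : T.SimplePair u u q [] := ⟨hqp, rfl, by simpa using hnd, by simp⟩
    obtain ⟨c, e, hW, he⟩ := hT.shrubby u u q [] hqp rfl hq
    have hW : T.wheel c e <:+: q := by
      rcases hW with hW | hW
      · exact hW
      · exact absurd (List.infix_nil.1 hW) (hT.wheel_ne_nil c e)
    have hWS := hqS.of_infix hW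
    have heS := hS.interface_notMem hT hWS
    obtain ⟨s', t', rfl⟩ := hW
    have heA : e ∉ pairEdges (s' ++ T.wheel c e ++ t') [] := by
      rintro (h | h)
      · exact heS (hqS e h)
      · simp at h
    have he : T.Enclosed _ (T.face true e) := he.resolve_left heA
    obtain ⟨h1, -, h3⟩ := hsp.swap hT he heA
    refine ih _ (by omega) h1 ((hqS.left.left.append (hS.mirror c e hWS)).append hqS.right) ?_ rfl
    simp [hT.wheel_ne_nil]

theorem nodup_pathVerts {v w : T.Vertex} {p : List E} (hp : T.IsPath v p w)
    (hpS : S.ContainsPath p) : (T.pathVerts v p).Nodup := by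
  rcases hp.nodup_or_exists_cycle with h | ⟨u, s, q, t, rfl, hq, hqp, -⟩
  · exact h
  · exact absurd (hS.eq_nil_of_closed hT hqp hpS.left.right) hq

theorem reaches_antisymm {v w : T.Vertex} (h : S.Reaches v w) (h' : S.Reaches w v) : v = w := by
  obtain ⟨p, hp, hpS⟩ := h
  obtain ⟨q, hq, hqS⟩ := h'
  have := hS.eq_nil_of_closed hT (isPath_append.2 ⟨w, hp, hq⟩) (hpS.append hqS)
  obtain ⟨rfl, rfl⟩ := List.append_eq_nil_iff.1 this
  exact hp

omit hT in
theorem contains_swap {s t : List E} {c : Bool} {e : E}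
    (h : S.ContainsPath (s ++ T.wheel c e ++ t)) :
    S.ContainsPath (s ++ T.wheel (!c) e ++ t) :=
  (h.left.left.append (hS.mirror c e h.left.right)).append h.right

/-- An edge outside `S` between the ends of two paths in `S` with the same start is the interface of
a broken wheel in `S`. The induction on the number of enclosed faces has to allow the edge to vary.
-/
theorem exists_wheel_of_chord {e : E} (heS : e ∉ S.edges) {v : T.Vertex} {p q : List E}
    (hp : T.IsPath v p (T.src e)) (hpS : S.ContainsPath p) (hq : T.IsPath v q (T.tgt e))
    (hqS : S.ContainsPath q) : ∃ c, S.ContainsPath (T.wheel c e) := by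
  induction hN : {F | T.Enclosed (pairEdges (p ++ [e]) q) F}.ncard using Nat.strong_induction_on
    generalizing e v p q with
  | _ N ih =>
  -- Discarding what precedes the last common vertex turns the paths into a simple closed curve.
  obtain ⟨v', p₀, p', q₀, q', rfl, rfl, -, -, hp', hq', hmeet⟩ := exists_tails_meeting_once hp hq
  replace hpS := hpS.right
  replace hqS := hqS.right
  have hle := hT.ncard_le (finite_pairEdges ((p₀ ++ p') ++ [e]) (q₀ ++ q'))
    ⟨e, Or.inl (by simp)⟩ (A' := pairEdges (p' ++ [e]) q') (fun u hu => Or.inl <| by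
      simp only [Set.mem_ofPred_eq, List.mem_append] at hu ⊢; tauto)
  rw [hN] at hle
  clear hN hp hq
  have hpn := hS.nodup_pathVerts hT hp' hpS
  have hqn := hS.nodup_pathVerts hT hq' hqS
  have hsp : T.SimplePair v' (T.tgt e) (p' ++ [e]) q' := by
    refine SimplePair.symm ⟨hq', isPath_concat.2 ⟨hp', rfl⟩, ?_, ?_⟩
    · rw [List.map_append, List.map_singleton, ← hp'.pathVerts_eq]
      exact nodup_of_meeting_once hpn hqn hmeet
    · rw [List.disjoint_append_right]
      refine ⟨(disjoint_of_meeting_once hqn hmeet).symm, ?_⟩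
      simpa using fun h => heS (hqS e h)
  obtain ⟨c, h, hW, hreg⟩ := hT.shrubby v' (T.tgt e) (p' ++ [e]) q' hsp.path hsp.path'
    (fun h => heS (hqS e (h ▸ by simp)))
  change h ∈ T.regionEdges (pairEdges (p' ++ [e]) q') at hreg
  have houter : S.ContainsPath (T.wheel c h) → h ≠ e → h ∉ pairEdges (p' ++ [e]) q' := by
    intro h1 h2 h3
    have h4 := hS.interface_notMem hT h1
    simp only [Set.mem_ofPred_eq, List.mem_append, List.mem_singleton] at h3
    rcases h3 with (h3 | h3) | h3
    · exact h4 (hpS _ h3)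
    · exact h2 h3
    · exact h4 (hqS _ h3)
  have hcases : T.wheel c h <:+: p' ∨ T.wheel c h <:+: q' ∨
      ∃ s W₀, p' = s ++ W₀ ∧ T.wheel c h = W₀ ++ [e] := by
    rcases hW with hW | hW
    · rcases infix_of_infix_concat hW (hT.wheel_ne_nil c h) with hW | hW
      · exact Or.inl hW
      · exact Or.inr (Or.inr hW)
    · exact Or.inr (Or.inl hW)
  clear hW
  rcases hcases with hW | hW | ⟨s, W₀, rfl, hW⟩
  · have hWS := hpS.of_infix hW
    by_cases hhe : h = e
    · exact ⟨c, hhe ▸ hWS⟩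
    have hA := houter hWS hhe
    have hen := hreg.resolve_left hA
    obtain ⟨s, t, rfl⟩ := hW
    rw [show s ++ T.wheel c h ++ t ++ [e] = s ++ T.wheel c h ++ (t ++ [e]) by simp]
      at hA hen hsp hle
    obtain ⟨h1, -, h3⟩ := hsp.swap hT hen hA
    rw [show s ++ T.wheel (!c) h ++ (t ++ [e]) = s ++ T.wheel (!c) h ++ t ++ [e] by simp]
      at h1 h3
    exact ih _ (by omega) heS (isPath_concat.1 h1).1 (hS.contains_swap hpS) hq' hqS rfl
  · have hWS := hqS.of_infix hW
    by_cases hhe : h = e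
    · exact ⟨c, hhe ▸ hWS⟩
    have hA := houter hWS hhe
    have hen := hreg.resolve_left hA
    obtain ⟨s, t, rfl⟩ := hW
    rw [pairEdges_comm] at hA hen hle
    obtain ⟨h1, -, h3⟩ := hsp.symm.swap hT hen hA
    rw [pairEdges_comm (s ++ T.wheel (!c) h ++ t)] at h3
    exact ih _ (by omega) heS hp' hpS h1 (hS.contains_swap hqS) rfl
  · have hnext := hT.next_eq_of_wheel hW
    have hew : e ∈ T.wheel c h := by simp [hW]
    have hface := (hT.mem_wheel.1 hew).1
    have hne := (hT.mem_wheel.1 hew).2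
    by_cases hhS : h ∈ S.edges
    · refine ⟨c, fun u hu => ?_⟩
      obtain ⟨hu1, hu2⟩ := hT.mem_wheel.1 hu
      by_cases huh : u = h
      · exact huh ▸ hhS
      · have : u ∈ T.wheel c h := hT.mem_wheel.2 ⟨hu1.trans hface, huh⟩
        rw [hW] at this
        rcases List.mem_append.1 this with h1 | h1
        · exact hpS.right u h1
        · exact absurd (List.mem_singleton.1 h1) hu2
    · -- The broken wheel ends with `e`, and its interface `h` is a chord inside the region. By
      -- induction it is the interface of broken wheels in `S`, one of which contains `e`.
      exfalso
      have hA : h ∉ pairEdges (s ++ W₀ ++ [e]) q' := by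
        rintro (h1 | h1)
        · rcases List.mem_append.1 h1 with h1 | h1
          · exact hhS (hpS h h1)
          · exact hne (List.mem_singleton.1 h1).symm
        · exact hhS (hqS h h1)
      have hen := hreg.resolve_left hA
      have hs : T.IsPath v' s (T.tgt h) := by
        have := hsp.path
        rw [List.append_assoc, ← hW] at this
        exact (hT.isPath_append_wheel this).1
      have hqh : T.IsPath v' q' (T.src h) := by
        rw [← hnext, src_next]; exact hq'
      have hlt := hsp.ncard_lt hT (u := e) (d := c) (Or.inl (by simp))
        (hface ▸ enclosed_cross hA c hen) (A := pairEdges (q' ++ [h]) s) (by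
          rintro u (hu | hu)
          · rcases List.mem_append.1 hu with hu | hu
            · exact Or.inl (Or.inr hu)
            · rw [List.mem_singleton.1 hu]; exact hreg
          · exact Or.inl (Or.inl (by simp [hu]))) (by
          rintro (hu | hu)
          · rcases List.mem_append.1 hu with hu | hu
            · exact heS (hqS e hu)
            · exact hne (List.mem_singleton.1 hu)
          · exact heS (hpS.left e hu))
      obtain ⟨d, hd⟩ := ih _ (by omega) hhS hqh hqS hs hpS.left rfl
      have hall : S.ContainsPath (T.wheel c h) := by
        by_cases hcd : c = d
        · exact hcd ▸ hd
        · have : c = !d := by cases c <;> cases d <;> simp_all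
          exact this ▸ hS.mirror d h hd
      exact heS (hall e hew)

end IsPreShrub

/-- A chord of a shrub, that is, an edge between two of its vertices which does not belong to it,
is the interface of two broken wheels contained in the shrub. -/
theorem IsShrub.contains_wheel_of_chord (hT : T.IsShrubbyCover) (hS : S.IsShrub) {e : E}
    (heS : e ∉ S.edges) (hs : T.src e ∈ S.verts) (ht : T.tgt e ∈ S.verts) (c : Bool) :
    S.ContainsPath (T.wheel c e) := by
  obtain ⟨r, -, -, hr⟩ := hS.single_root
  obtain ⟨p, hp, hpS⟩ := hr _ hs
  obtain ⟨q, hq, hqS⟩ := hr _ ht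
  obtain ⟨d, hd⟩ := hS.isPreShrub.exists_wheel_of_chord hT heS hp hpS hq hqS
  by_cases hcd : c = d
  · exact hcd ▸ hd
  · have : c = !d := by cases c <;> cases d <;> simp_all
    exact this ▸ hS.isPreShrub.mirror d e hd

end Subgraph

end Shrubs
end BicoloredMap

namespace BicoloredMap

/-! ### Broken wheels through the added vertex -/

section AddedVertex

variable {E : Type*} {T : BicoloredMap E}

theorem next_eq_of_wheel_eq_append {c : Bool} {e a b : E} {w : List E}
    (h : T.wheel c e = w ++ [a] ++ [b]) : T.next c a = b := by
  have h1 := congrArg (fun l => l[w.length]?) h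
  have h2 := congrArg (fun l => l[w.length + 1]?) h
  have hlen := congrArg List.length h
  simp only [wheel, List.length_map, List.length_range, List.length_append, List.length_cons,
    List.length_nil] at hlen
  have e1 : (T.next c ^ (w.length + 1)) e = a := by
    simpa [wheel, List.getElem?_range (show w.length < T.faceSize c e - 1 by omega)] using h1
  have e2 : (T.next c ^ (w.length + 1 + 1)) e = b := by
    simpa [wheel, List.getElem?_range (show w.length + 1 < T.faceSize c e - 1 by omega)] using h2
  rw [← e1, ← e2, ← Equiv.Perm.mul_apply, ← pow_succ']

theorem enclosed_of_wheel_subset (hT : T.IsShrubbyCover) {A : Set E} {c : Bool} {e : E}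
    (hW : ∀ u ∈ T.wheel c e, u ∈ A) (he : e ∈ T.regionEdges A) : T.Enclosed A (T.face c e) := by
  by_cases heA : e ∈ A
  · refine enclosed_of_boundary_subset fun u hu => ?_
    by_cases hue : u = e
    · exact hue ▸ heA
    · exact hW u (hT.mem_wheel.2 ⟨hu, hue⟩)
  · exact enclosed_cross heA c (he.resolve_left heA)

/-- A path of length one contains no broken wheel. -/
theorem IsShrubbyCover.not_wheel_infix_singleton (hT : T.IsShrubbyCover) (c : Bool) (e f : E) :
    ¬ T.wheel c e <:+: [f] := by
  intro h
  obtain ⟨w, hw, hwe⟩ := wheel_eq_cons (T := T) c e (hT.three_le _ _)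
  have := h.length_le
  rw [hwe] at this
  cases w with
  | nil => exact hw rfl
  | cons => simp at this

theorem IsShrubbyCover.eq_of_src_eq_of_tgt_eq (hT : T.IsShrubbyCover) {f g : E}
    (hs : T.src f = T.src g) (ht : T.tgt f = T.tgt g) : f = g := by
  by_contra hne
  obtain ⟨c, e, hW, -⟩ := hT.shrubby (T.src f) (T.tgt f) [f] [g] ⟨rfl, rfl⟩ ⟨hs.symm, ht.symm⟩
    (by simpa using hne)
  exact hW.elim (hT.not_wheel_infix_singleton _ _ _) (hT.not_wheel_infix_singleton _ _ _)

/-- The two faces incident to an edge at a vertex are faces at this vertex. -/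
theorem exists_half_of_face {v : T.Vertex} {h : E × Bool} (hv : T.halfVert h = v) (d : Bool) :
    ∃ h', T.halfVert h' = v ∧ T.face d h.1 = T.face h'.2 h'.1 := by
  by_cases hd : d = h.2
  · exact ⟨h, hv, by rw [hd]⟩
  · refine ⟨T.halfRot.symm h, ?_, ?_⟩
    · rw [← halfVert_halfRot, Equiv.apply_symm_apply, hv]
    · have h1 := face_halfRot (T := T) (T.halfRot.symm h)
      have h2 := snd_halfRot (T := T) (T.halfRot.symm h)
      rw [Equiv.apply_symm_apply] at h1 h2
      rw [← h1]
      have : d = (T.halfRot.symm h).2 := by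
        revert h2 hd; cases d <;> cases h.2 <;> cases (T.halfRot.symm h).2 <;> simp
      rw [this]

namespace Subgraph

variable {S : T.Subgraph} {i : T.Vertex}

theorem ContainsPath.verts_mem {v w : T.Vertex} {p : List E} (h : S.ContainsPath p)
    (hp : T.IsPath v p w) (hw : w ∈ S.verts) {u : T.Vertex} (hu : u ∈ T.pathVerts v p) :
    u ∈ S.verts := by
  rw [hp.pathVerts_eq, List.mem_append, List.mem_map] at hu
  rcases hu with ⟨e, he, rfl⟩ | hu
  · exact S.src_mem e (h e he)
  · rw [List.mem_singleton.1 hu]; exact hw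

theorem verts_mem_of_contains_wheel (hT : T.IsShrubbyCover) {c : Bool} {e : E}
    (h : S.ContainsPath (T.wheel c e)) : T.src e ∈ S.verts ∧ T.tgt e ∈ S.verts := by
  obtain ⟨w, -, hw⟩ := wheel_next_eq (T := T) c ((T.next c).symm e) (hT.three_le _ _)
  obtain ⟨w', -, hw'⟩ := wheel_eq_cons (T := T) c e (hT.three_le _ _)
  rw [Equiv.apply_symm_apply] at hw
  constructor
  · rw [← tgt_next_symm c]
    exact S.tgt_mem _ (h _ (by simp [hw]))
  · rw [← src_next c]
    exact S.src_mem _ (h _ (by simp [hw']))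

/-- A path in `S + i` that ends in `S` is a path in `S`, since no edge of `S + i` starts at `i`. -/
theorem contains_of_addVertex (hi : i ∉ S.verts) {v w : T.Vertex} {p : List E}
    (hp : T.IsPath v p w) (h : (S.addVertex i).ContainsPath p) (hw : w ∈ S.verts) :
    S.ContainsPath p := by
  induction p generalizing v with
  | nil => intro e he; simp at he
  | cons f p ih =>
    have h' : (S.addVertex i).ContainsPath p := fun e he => h e (List.mem_cons_of_mem _ he)
    have hpS := ih hp.2 h'
    have hf : T.tgt f ∈ S.verts := hpS.verts_mem hp.2 hw (by simp [pathVerts])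
    intro e he
    rcases List.mem_cons.1 he with rfl | he
    · exact (h e (by simp)).resolve_right fun h1 => hi (h1.2 ▸ hf)
    · exact hpS e he

/-- The broken wheel that ends with the edge `a` into `i` and goes along the boundary of the face
of colour `c` at `a` is contained in `S + i`. -/
def FullCorner (S : T.Subgraph) (i : T.Vertex) (c : Bool) (a : E) : Prop :=
  a ∈ S.edgesTo i ∧ (S.addVertex i).ContainsPath (T.wheel c (T.next c a))

theorem src_next_of_mem_edgesTo {a : E} (ha : a ∈ S.edgesTo i) (c : Bool) :
    T.src (T.next c a) = i := by rw [src_next, ha.2]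

theorem notMem_of_tgt_eq (hi : i ∉ S.verts) {e : E} (he : T.tgt e = i) : e ∉ S.edges :=
  fun h => hi (he ▸ S.tgt_mem e h)

theorem notMem_of_src_eq (hi : i ∉ S.verts) {e : E} (he : T.src e = i) : e ∉ S.edges :=
  fun h => hi (he ▸ S.src_mem e h)

theorem fullCorner_of_wheel_eq {c : Bool} {a e : E} (ha : a ∈ S.edgesTo i) {w : List E}
    (hw : S.ContainsPath w) (he : T.next c a = e) (h : T.wheel c e = w ++ [a]) :
    S.FullCorner i c a := by
  refine ⟨ha, ?_⟩
  rw [he, h]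
  intro u hu
  rcases List.mem_append.1 hu with hu | hu
  · exact Or.inl (hw u hu)
  · rw [List.mem_singleton.1 hu]; exact Or.inr ha

namespace FullCorner

theorem exists_path (hT : T.IsShrubbyCover) (hi : i ∉ S.verts) {c : Bool} {a : E}
    (h : S.FullCorner i c a) : ∃ w, w ≠ [] ∧ T.wheel c (T.next c a) = w ++ [a] ∧
      S.ContainsPath w ∧ T.IsPath (T.tgt (T.next c a)) w (T.src a) := by
  obtain ⟨w, hw, hwe⟩ := wheel_next_eq (T := T) c a (hT.three_le _ _)
  have hp := hT.isPath_wheel c (T.next c a)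
  have hc := h.2
  rw [hwe] at hp hc
  have hp' := (isPath_concat.1 hp).1
  exact ⟨w, hw, hwe, contains_of_addVertex hi hp' hc.left h.1.1, hp'⟩

theorem reaches (hT : T.IsShrubbyCover) (hi : i ∉ S.verts) {c : Bool} {a : E}
    (h : S.FullCorner i c a) : S.Reaches (T.tgt (T.next c a)) (T.src a) := by
  obtain ⟨w, -, -, h1, h2⟩ := h.exists_path hT hi
  exact ⟨w, h2, h1⟩

theorem tgt_mem (hT : T.IsShrubbyCover) (hi : i ∉ S.verts) {c : Bool} {a : E}
    (h : S.FullCorner i c a) : T.tgt (T.next c a) ∈ S.verts := by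
  obtain ⟨w, -, -, h1, h2⟩ := h.exists_path hT hi
  exact h1.verts_mem h2 h.1.1 (by simp [pathVerts])

theorem eq_or_eq (hT : T.IsShrubbyCover) (hi : i ∉ S.verts) {c : Bool} {a e : E}
    (h : S.FullCorner i c a) (he : T.face c e = T.face c a) (heS : e ∉ S.edges) :
    e = a ∨ e = T.next c a := by
  obtain ⟨w, -, h1, h2, -⟩ := h.exists_path hT hi
  by_contra hne
  push Not at hne
  have : e ∈ T.wheel c (T.next c a) := hT.mem_wheel.2 ⟨by rw [he, face_next], hne.2⟩
  rw [h1, List.mem_append, List.mem_singleton] at this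
  exact this.elim (fun h => heS (h2 e h)) hne.1

end FullCorner

/-- An oriented path that enters `i` along `a` and returns to `S` along an edge `f`, compared with a
path in `S`, forces a broken wheel ending with `a`. -/
theorem exists_fullCorner_of_out (hT : T.IsShrubbyCover) (hS : S.IsShrub) (hi : i ∉ S.verts)
    {a f : E} (ha : a ∈ S.edgesTo i) (hf : T.src f = i) (hfS : T.tgt f ∈ S.verts) {v : T.Vertex}
    {p q : List E} (hp : T.IsPath v p (T.src a)) (hpS : S.ContainsPath p)
    (hq : T.IsPath v q (T.tgt f)) (hqS : S.ContainsPath q) :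
    ∃ c, T.Enclosed (pairEdges (p ++ [a] ++ [f]) q) (T.face c a) ∧ S.FullCorner i c a ∧
      S.Reaches v (T.tgt (T.next c a)) := by
  have hPS := hS.isPreShrub
  induction hN : {F | T.Enclosed (pairEdges (p ++ [a] ++ [f]) q) F}.ncard
    using Nat.strong_induction_on generalizing v p q with
  | _ N ih =>
  obtain ⟨v', p₀, p', q₀, q', rfl, rfl, hp₀, -, hp', hq', hmeet⟩ :=
    exists_tails_meeting_once hp hq
  have hvv' : S.Reaches v v' := ⟨p₀, hp₀, hpS.left⟩
  replace hpS := hpS.right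
  replace hqS := hqS.right
  have hsub : pairEdges (p' ++ [a] ++ [f]) q' ⊆
      pairEdges (p₀ ++ p' ++ [a] ++ [f]) (q₀ ++ q') := fun u hu => by
    simp only [Set.mem_ofPred_eq, List.mem_append] at hu ⊢; tauto
  have hle := hT.ncard_le (finite_pairEdges (p₀ ++ p' ++ [a] ++ [f]) (q₀ ++ q'))
    ⟨a, Or.inl (by simp)⟩ (hsub.trans fun u hu => Or.inl hu)
  suffices H : ∃ c, T.Enclosed (pairEdges (p' ++ [a] ++ [f]) q') (T.face c a) ∧
      S.FullCorner i c a ∧ S.Reaches v' (T.tgt (T.next c a)) by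
    obtain ⟨c, h1, h2, h3⟩ := H
    exact ⟨c, h1.mono hsub, h2, hvv'.trans h3⟩
  rw [hN] at hle
  clear hN hp hq hsub hp₀ hvv'
  have haS := notMem_of_tgt_eq hi ha.2
  have hfE := notMem_of_src_eq hi hf
  have hpn := hPS.nodup_pathVerts hT hp' hpS
  have hqn := hPS.nodup_pathVerts hT hq' hqS
  have hpV : ∀ u ∈ T.pathVerts v' p', u ∈ S.verts := fun u => hpS.verts_mem hp' ha.1
  have hqV : ∀ u ∈ T.pathVerts v' q', u ∈ S.verts := fun u => hqS.verts_mem hq' hfS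
  have hsp : T.SimplePair v' (T.tgt f) (p' ++ [a] ++ [f]) q' := by
    refine SimplePair.symm ⟨hq', isPath_concat.2 ⟨isPath_concat.2 ⟨hp', ha.2.trans hf.symm⟩, rfl⟩,
      ?_, ?_⟩
    · rw [List.map_append, List.map_append, List.map_singleton, List.map_singleton,
        ← hp'.pathVerts_eq, ← List.append_assoc]
      refine List.nodup_append'.2 ⟨nodup_of_meeting_once hpn hqn hmeet, by simp, ?_⟩
      rw [List.disjoint_singleton, hf, List.mem_append]
      rintro (h | h)
      · exact hi (hqV i (List.mem_cons_of_mem _ h))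
      · exact hi (hpV i h)
    · rw [List.disjoint_append_right, List.disjoint_append_right]
      refine ⟨⟨(disjoint_of_meeting_once hqn hmeet).symm, ?_⟩, ?_⟩
      · simpa using fun h => haS (hqS a h)
      · simpa using fun h => hfE (hqS f h)
  obtain ⟨c, h, hW, hreg⟩ := hT.shrubby v' (T.tgt f) (p' ++ [a] ++ [f]) q' hsp.path hsp.path'
    (fun h => haS (hqS a (h ▸ by simp)))
  change h ∈ T.regionEdges (pairEdges (p' ++ [a] ++ [f]) q') at hreg
  have houter : S.ContainsPath (T.wheel c h) → h ∉ pairEdges (p' ++ [a] ++ [f]) q' := by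
    intro h1 h3
    have h4 := hPS.interface_notMem hT h1
    have h5 := verts_mem_of_contains_wheel hT h1
    simp only [Set.mem_ofPred_eq, List.mem_append, List.mem_singleton] at h3
    rcases h3 with ((h3 | rfl) | rfl) | h3
    · exact h4 (hpS _ h3)
    · exact hi (ha.2 ▸ h5.2)
    · exact hi (hf ▸ h5.1)
    · exact h4 (hqS _ h3)
  have hcases : T.wheel c h <:+: p' ∨ T.wheel c h <:+: q' ∨
      (∃ s W₀, p' = s ++ W₀ ∧ T.wheel c h = W₀ ++ [a]) ∨
      ∃ s W₀, p' = s ++ W₀ ∧ T.wheel c h = W₀ ++ [a] ++ [f] := by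
    rcases hW with hW | hW
    · rcases infix_of_infix_concat hW (hT.wheel_ne_nil c h) with hW | ⟨s, W₀, hs, hW⟩
      · rcases infix_of_infix_concat hW (hT.wheel_ne_nil c h) with hW | hW
        · exact Or.inl hW
        · exact Or.inr (Or.inr (Or.inl hW))
      · refine Or.inr (Or.inr (Or.inr ?_))
        rcases List.eq_nil_or_concat W₀ with rfl | ⟨W₁, b, rfl⟩
        · exact absurd (by rw [hW]; exact List.infix_refl _) (hT.not_wheel_infix_singleton c h f)
        · rw [List.concat_eq_append, ← List.append_assoc] at hs
          have h1 := List.append_inj' hs rfl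
          refine ⟨s, W₁, h1.1, ?_⟩
          rw [hW, List.concat_eq_append, h1.2]
    · exact Or.inr (Or.inl hW)
  clear hW
  -- A broken wheel inside `S` is replaced by its mirror image. One that ends with `a` is what is
  -- wanted.
  rcases hcases with hW | hW | ⟨s, W₀, rfl, hW⟩ | ⟨s, W₀, rfl, hW⟩
  · have hA := houter (hpS.of_infix hW)
    have hen := hreg.resolve_left hA
    obtain ⟨s, t, rfl⟩ := hW
    rw [show s ++ T.wheel c h ++ t ++ [a] ++ [f] = s ++ T.wheel c h ++ (t ++ [a] ++ [f]) by simp]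
      at hA hen hsp hle ⊢
    obtain ⟨h1, h2, h3⟩ := hsp.swap hT hen hA
    rw [show s ++ T.wheel (!c) h ++ (t ++ [a] ++ [f]) =
      s ++ T.wheel (!c) h ++ t ++ [a] ++ [f] by simp] at h1 h2 h3
    obtain ⟨d, h4, h5⟩ := ih _ (by omega) (isPath_concat.1 (isPath_concat.1 h1).1).1
      (hPS.contains_swap hpS) hq' hqS rfl
    exact ⟨d, h4.of_subset_regionEdges h2, h5⟩
  · have hA := houter (hqS.of_infix hW)
    have hen := hreg.resolve_left hA
    obtain ⟨s, t, rfl⟩ := hW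
    rw [pairEdges_comm] at hA hen hle ⊢
    obtain ⟨h1, h2, h3⟩ := hsp.symm.swap hT hen hA
    rw [pairEdges_comm (s ++ T.wheel (!c) h ++ t)] at h2 h3
    obtain ⟨d, h4, h5⟩ := ih _ (by omega) hp' hpS h1 (hPS.contains_swap hqS) rfl
    exact ⟨d, h4.of_subset_regionEdges h2, h5⟩
  · have hnext := hT.next_eq_of_wheel hW
    refine ⟨c, ?_, fullCorner_of_wheel_eq ha hpS.right hnext hW, ?_⟩
    · rw [← face_next, hnext]
      refine enclosed_of_wheel_subset hT (fun u hu => Or.inl ?_) hreg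
      rw [hW] at hu
      simp only [List.mem_append] at hu ⊢; tauto
    · rw [hnext]
      have := (isPath_concat.1 hsp.path).1
      rw [List.append_assoc, ← hW] at this
      exact ⟨s, (hT.isPath_append_wheel this).1, hpS.left⟩
  · have hnext := hT.next_eq_of_wheel hW
    have hnext' := next_eq_of_wheel_eq_append hW
    have hs : T.IsPath v' s (T.tgt h) := by
      have := hsp.path
      rw [List.append_assoc, List.append_assoc, ← List.append_assoc W₀, ← hW] at this
      exact (hT.isPath_append_wheel this).1
    -- The broken wheel ends with `a` and `f`. If its interface `h` is in `S`, the broken wheel with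
    -- interface `f` of the same face is the one wanted. Otherwise `h` is a chord of `S`, so `S`
    -- contains the rest of this face and in particular `a`.
    by_cases hhS : h ∈ S.edges
    · refine ⟨c, ?_, ⟨ha, fun u hu => ?_⟩, ?_⟩
      · rw [← face_next, hnext', ← face_next, hnext]
        refine enclosed_of_wheel_subset hT (fun u hu => Or.inl ?_) hreg
        rw [hW] at hu
        simp only [List.mem_append] at hu ⊢; tauto
      · rw [hnext'] at hu
        obtain ⟨hu1, hu2⟩ := hT.mem_wheel.1 hu
        by_cases huh : u = h
        · exact huh ▸ Or.inl hhS
        · have : u ∈ T.wheel c h := hT.mem_wheel.2 ⟨by rw [hu1, ← hnext, face_next], huh⟩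
          rw [hW] at this
          simp only [List.mem_append, List.mem_singleton] at this
          rcases this with (h1 | rfl) | h1
          · exact Or.inl (hpS.right u h1)
          · exact Or.inr ha
          · exact absurd h1 hu2
      · rw [hnext']
        exact ⟨q', hq', hqS⟩
    · exfalso
      have h1 : T.tgt h ∈ S.verts := hpV _ (mem_pathVerts_append_left hs.end_mem)
      have h2 : T.src h ∈ S.verts := by rw [← hnext, src_next]; exact hfS
      exact haS (hS.contains_wheel_of_chord hT hhS h2 h1 c a (by simp [hW]))

/-- Two paths in `S + i` that enter `i` along distinct edges force a broken wheel ending with the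
first of these edges, inside the region between them. -/
theorem exists_fullCorner_of_in (hT : T.IsShrubbyCover) (hS : S.IsShrub) (hi : i ∉ S.verts)
    {a b : E} (ha : a ∈ S.edgesTo i) (hb : b ∈ S.edgesTo i) (hab : a ≠ b) {v : T.Vertex}
    {p q : List E} (hp : T.IsPath v p (T.src a)) (hpS : S.ContainsPath p)
    (hq : T.IsPath v q (T.src b)) (hqS : S.ContainsPath q) :
    ∃ c, T.Enclosed (pairEdges (p ++ [a]) (q ++ [b])) (T.face c a) ∧ S.FullCorner i c a ∧
      S.Reaches v (T.tgt (T.next c a)) := by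
  have hPS := hS.isPreShrub
  induction hN : {F | T.Enclosed (pairEdges (p ++ [a]) (q ++ [b])) F}.ncard
    using Nat.strong_induction_on generalizing v p q with
  | _ N ih =>
  obtain ⟨v', p₀, p', q₀, q', rfl, rfl, hp₀, -, hp', hq', hmeet⟩ :=
    exists_tails_meeting_once hp hq
  have hvv' : S.Reaches v v' := ⟨p₀, hp₀, hpS.left⟩
  replace hpS := hpS.right
  replace hqS := hqS.right
  have hsub : pairEdges (p' ++ [a]) (q' ++ [b]) ⊆
      pairEdges (p₀ ++ p' ++ [a]) (q₀ ++ q' ++ [b]) := fun u hu => by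
    simp only [Set.mem_ofPred_eq, List.mem_append] at hu ⊢; tauto
  have hle := hT.ncard_le (finite_pairEdges (p₀ ++ p' ++ [a]) (q₀ ++ q' ++ [b]))
    ⟨a, Or.inl (by simp)⟩ (hsub.trans fun u hu => Or.inl hu)
  suffices H : ∃ c, T.Enclosed (pairEdges (p' ++ [a]) (q' ++ [b])) (T.face c a) ∧
      S.FullCorner i c a ∧ S.Reaches v' (T.tgt (T.next c a)) by
    obtain ⟨c, h1, h2, h3⟩ := H
    exact ⟨c, h1.mono hsub, h2, hvv'.trans h3⟩
  rw [hN] at hle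
  clear hN hp hq hsub hp₀ hvv'
  have haS := notMem_of_tgt_eq hi ha.2
  have hbS := notMem_of_tgt_eq hi hb.2
  have hpn := hPS.nodup_pathVerts hT hp' hpS
  have hqn := hPS.nodup_pathVerts hT hq' hqS
  have hpV : ∀ u ∈ T.pathVerts v' p', u ∈ S.verts := fun u => hpS.verts_mem hp' ha.1
  have hqV : ∀ u ∈ T.pathVerts v' q', u ∈ S.verts := fun u => hqS.verts_mem hq' hb.1
  have hsp : T.SimplePair v' i (p' ++ [a]) (q' ++ [b]) := by
    refine SimplePair.symm ⟨isPath_concat.2 ⟨hq', hb.2⟩, isPath_concat.2 ⟨hp', ha.2⟩, ?_, ?_⟩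
    · rw [List.map_append, List.map_append, List.map_singleton, List.map_singleton,
        ← hp'.pathVerts_eq]
      have hperm : (q'.map T.tgt ++ [T.tgt b] ++ T.pathVerts v' p').Perm
          ((q'.map T.tgt ++ T.pathVerts v' p') ++ [T.tgt b]) := by
        rw [List.append_assoc, List.append_assoc]
        exact List.Perm.append_left _ List.perm_append_comm
      rw [hperm.nodup_iff]
      refine List.nodup_append'.2 ⟨nodup_of_meeting_once hpn hqn hmeet, by simp, ?_⟩
      rw [List.disjoint_singleton, hb.2, List.mem_append]
      rintro (h | h)
      · exact hi (hqV i (List.mem_cons_of_mem _ h))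
      · exact hi (hpV i h)
    · rw [List.disjoint_append_right, List.disjoint_append_left, List.disjoint_append_left]
      refine ⟨⟨(disjoint_of_meeting_once hqn hmeet).symm, ?_⟩, ?_, ?_⟩
      · simpa using fun h => hbS (hpS b h)
      · simpa using fun h => haS (hqS a h)
      · simpa using hab
  obtain ⟨c, h, hW, hreg⟩ := hT.shrubby v' i (p' ++ [a]) (q' ++ [b]) hsp.path hsp.path'
    (fun h => hsp.disj (a := a) (by simp) (h ▸ by simp))
  change h ∈ T.regionEdges (pairEdges (p' ++ [a]) (q' ++ [b])) at hreg
  have houter : S.ContainsPath (T.wheel c h) → h ∉ pairEdges (p' ++ [a]) (q' ++ [b]) := by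
    intro h1 h3
    have h4 := hPS.interface_notMem hT h1
    have h5 := verts_mem_of_contains_wheel hT h1
    simp only [Set.mem_ofPred_eq, List.mem_append, List.mem_singleton] at h3
    rcases h3 with (h3 | rfl) | (h3 | rfl)
    · exact h4 (hpS _ h3)
    · exact hi (ha.2 ▸ h5.2)
    · exact h4 (hqS _ h3)
    · exact hi (hb.2 ▸ h5.2)
  have hcases : T.wheel c h <:+: p' ∨ T.wheel c h <:+: q' ∨
      (∃ s W₀, p' = s ++ W₀ ∧ T.wheel c h = W₀ ++ [a]) ∨
      ∃ s W₀, q' = s ++ W₀ ∧ T.wheel c h = W₀ ++ [b] := by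
    rcases hW with hW | hW
    · rcases infix_of_infix_concat hW (hT.wheel_ne_nil c h) with hW | hW
      · exact Or.inl hW
      · exact Or.inr (Or.inr (Or.inl hW))
    · rcases infix_of_infix_concat hW (hT.wheel_ne_nil c h) with hW | hW
      · exact Or.inr (Or.inl hW)
      · exact Or.inr (Or.inr (Or.inr hW))
  clear hW
  -- A broken wheel inside `S` is replaced by its mirror image. One that ends with `a` is what is
  -- wanted.
  rcases hcases with hW | hW | ⟨s, W₀, rfl, hW⟩ | ⟨s, W₀, rfl, hW⟩
  · have hA := houter (hpS.of_infix hW)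
    have hen := hreg.resolve_left hA
    obtain ⟨s, t, rfl⟩ := hW
    rw [show s ++ T.wheel c h ++ t ++ [a] = s ++ T.wheel c h ++ (t ++ [a]) by simp]
      at hA hen hsp hle ⊢
    obtain ⟨h1, h2, h3⟩ := hsp.swap hT hen hA
    rw [show s ++ T.wheel (!c) h ++ (t ++ [a]) =
      s ++ T.wheel (!c) h ++ t ++ [a] by simp] at h1 h2 h3
    obtain ⟨d, h4, h5⟩ := ih _ (by omega) (isPath_concat.1 h1).1
      (hPS.contains_swap hpS) hq' hqS rfl
    exact ⟨d, h4.of_subset_regionEdges h2, h5⟩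
  · have hA := houter (hqS.of_infix hW)
    have hen := hreg.resolve_left hA
    obtain ⟨s, t, rfl⟩ := hW
    rw [show s ++ T.wheel c h ++ t ++ [b] = s ++ T.wheel c h ++ (t ++ [b]) by simp]
      at hA hen hsp hle ⊢
    rw [pairEdges_comm] at hA hen hle ⊢
    obtain ⟨h1, h2, h3⟩ := hsp.symm.swap hT hen hA
    rw [pairEdges_comm (s ++ T.wheel (!c) h ++ (t ++ [b])), show s ++ T.wheel (!c) h ++ (t ++ [b]) =
      s ++ T.wheel (!c) h ++ t ++ [b] by simp] at h2 h3
    rw [show s ++ T.wheel (!c) h ++ (t ++ [b]) =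
      s ++ T.wheel (!c) h ++ t ++ [b] by simp] at h1
    obtain ⟨d, h4, h5⟩ := ih _ (by omega) hp' hpS (isPath_concat.1 h1).1
      (hPS.contains_swap hqS) rfl
    exact ⟨d, h4.of_subset_regionEdges h2, h5⟩
  · have hnext := hT.next_eq_of_wheel hW
    refine ⟨c, ?_, fullCorner_of_wheel_eq ha hpS.right hnext hW, ?_⟩
    · rw [← face_next, hnext]
      refine enclosed_of_wheel_subset hT (fun u hu => Or.inl ?_) hreg
      rw [hW] at hu
      simp only [List.mem_append] at hu ⊢; tauto
    · rw [hnext]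
      have := hsp.path
      rw [List.append_assoc, ← hW] at this
      exact ⟨s, (hT.isPath_append_wheel this).1, hpS.left⟩
  · have hnext := hT.next_eq_of_wheel hW
    have hs : T.IsPath v' s (T.tgt h) := by
      have := hsp.path'
      rw [List.append_assoc, ← hW] at this
      exact (hT.isPath_append_wheel this).1
    -- The broken wheel ends with `b`. Its interface `h` leaves `i` inside the region, and the path
    -- along `a` and `h` can be used instead.
    obtain ⟨d, h1, h2⟩ := exists_fullCorner_of_out hT hS hi ha
      (f := h) (by rw [← hnext, src_next, hb.2])
      (hqV _ (mem_pathVerts_append_left hs.end_mem)) hp' hpS hs hqS.left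
    refine ⟨d, h1.of_subset_regionEdges ?_, h2⟩
    rintro u (hu | hu)
    · rcases List.mem_append.1 hu with hu | hu
      · exact Or.inl (Or.inl hu)
      · rw [List.mem_singleton.1 hu]; exact hreg
    · exact Or.inl (Or.inr (by simp [hu]))

/-- The edges of `S` and those at `i` cannot enclose all the faces at `i`: otherwise `i` would lie
in the interior of `S`. -/
theorem exists_not_enclosed (hT : T.IsShrubbyCover) (hS : S.IsShrub) (hi : i ∉ S.verts) {A : Set E}
    (hA : ∀ e ∈ A, e ∈ S.edges ∨ T.src e = i ∨ T.tgt e = i) :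
    ∃ h, T.halfVert h = i ∧ ¬ T.Enclosed A (T.face h.2 h.1) := by
  by_contra hcon
  push Not at hcon
  have hR : (⋃ h ∈ {h | T.halfVert h = i}, {G | T.Conn A (T.face h.2 h.1) G}).Finite :=
    (hT.finite_halves i).biUnion fun h hh => hcon h hh
  have hmem : ∀ h, T.halfVert h = i → ∀ d,
      T.face d h.1 ∈ ⋃ h ∈ {h | T.halfVert h = i}, {G | T.Conn A (T.face h.2 h.1) G} := by
    intro h hh d
    obtain ⟨h', hh', hd⟩ := exists_half_of_face hh d
    rw [hd]
    exact Set.mem_biUnion hh' (Conn.refl _)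
  refine hi (hS.interior i fun c e he => ?_)
  refine enclosed_of_finite_closed hR (fun u hu d hd => ?_) (hmem (e, true) he c)
  by_cases huA : u ∈ A
  · rcases hA u huA with h | h | h
    · exact absurd h hu
    · exact hmem (u, false) h _
    · exact hmem (u, true) h _
  · simp only [Set.mem_iUnion] at hd ⊢
    obtain ⟨h, hh, hd⟩ := hd
    exact ⟨h, hh, Conn.trans hd (Conn.cross huA _ _)⟩

theorem not_enclosed_of_tgt_eq (hT : T.IsShrubbyCover) (hS : S.IsShrub) (hi : i ∉ S.verts) {e : E}
    (he : T.tgt e = i) (d : Bool) : ¬ T.Enclosed S.edges (T.face d e) := by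
  intro h
  obtain ⟨h', hh', hd⟩ := exists_half_of_face (h := (e, true)) he d
  obtain ⟨k, hk, hkn⟩ := exists_not_enclosed hT hS hi (A := S.edges) fun e h => Or.inl h
  refine hkn ((hT.conn_of_no_half (hh'.trans hk.symm) ?_).enclosed_iff.1 (hd ▸ h))
  rintro ⟨u, _ | _⟩ hu
  · exact notMem_of_src_eq hi (hu.trans hh')
  · exact notMem_of_tgt_eq hi (hu.trans hh')

end Subgraph

end AddedVertex
end BicoloredMap

namespace BicoloredMap

/-! ### Disjointness of broken wheels -/

section Disjointness

variable {E : Type*} {T : BicoloredMap E}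

namespace Subgraph

variable {S : T.Subgraph} {i : T.Vertex}

/-- No finite set of faces that contains a face at `i` can only be left through edges of `S`: the
face would be enclosed by `S`, and `i` would lie in the interior of `S`. -/
theorem false_of_finite_closed (hT : T.IsShrubbyCover) (hS : S.IsShrub) (hi : i ∉ S.verts)
    {b : E} {c : Bool} (hb : T.tgt b = i) {R : Set T.Face} (hR : R.Finite)
    (hcl : ∀ e ∉ S.edges, ∀ d, T.face d e ∈ R → T.face (!d) e ∈ R) (hbR : T.face c b ∈ R) : False :=
  not_enclosed_of_tgt_eq hT hS hi hb c (enclosed_of_finite_closed hR hcl hbR)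

/-- If both corners at `b` are full, then the heads of the two adjacent outgoing edges at `i` are
not comparable: a path in `S` between them would surround either `i` or the tail of `b`. -/
theorem FullCorner.not_reaches (hT : T.IsShrubbyCover) (hS : S.IsShrub) (hi : i ∉ S.verts)
    {b : E} {c : Bool} (h₁ : S.FullCorner i c b) (h₂ : S.FullCorner i (!c) b) :
    ¬ S.Reaches (T.tgt (T.next c b)) (T.tgt (T.next (!c) b)) := by
  have hPS := hS.isPreShrub
  rintro ⟨q, hq, hqS⟩
  set g := T.next c b with hg
  set g' := T.next (!c) b with hg'
  have hgi : T.src g = i := src_next_of_mem_edgesTo h₁.1 c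
  have hgi' : T.src g' = i := src_next_of_mem_edgesTo h₁.1 _
  have hgS := notMem_of_src_eq hi hgi
  have hgS' := notMem_of_src_eq hi hgi'
  have hbi : T.tgt b = i := h₁.1.2
  have hgm : T.tgt g ∈ S.verts := h₁.tgt_mem hT hi
  have hgm' : T.tgt g' ∈ S.verts := h₂.tgt_mem hT hi
  have hfg : T.face c g = T.face c b := face_next c b
  have hfg' : T.face (!c) g' = T.face (!c) b := face_next (!c) b
  -- If the two interfaces coincide, the two faces at `b` can only be left through edges of `S`.
  by_cases hne : g = g'
  · refine false_of_finite_closed hT hS hi (c := c) hbi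
      (Set.toFinite {T.face c b, T.face (!c) b}) (fun e he d hd => ?_) (by simp)
    rcases hd with hd | hd
    · obtain rfl := color_eq_of_face_eq hd
      rcases h₁.eq_or_eq hT hi hd he with rfl | rfl
      · simp
      · right
        rw [← hg, hne]; exact hfg'
    · obtain rfl := color_eq_of_face_eq hd
      rw [Bool.not_not]
      rcases h₂.eq_or_eq hT hi hd he with rfl | rfl
      · simp
      · left
        rw [← hg', ← hne]; exact hfg
  induction hN : {F | T.Enclosed (pairEdges (g :: q) [g']) F}.ncard
    using Nat.strong_induction_on generalizing q with
  | _ N ih =>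
  have hqn := hPS.nodup_pathVerts hT hq hqS
  have hqV : ∀ u ∈ T.pathVerts (T.tgt g) q, u ∈ S.verts := fun u => hqS.verts_mem hq hgm'
  have hsp : T.SimplePair i (T.tgt g') (g :: q) [g'] := by
    refine ⟨⟨hgi, hq⟩, ⟨hgi', rfl⟩, ?_, ?_⟩
    · change (T.pathVerts (T.tgt g) q ++ [T.src g']).Nodup
      refine List.nodup_append'.2 ⟨hqn, by simp, ?_⟩
      rw [List.disjoint_singleton, hgi']
      exact fun h => hi (hqV i h)
    · rw [List.disjoint_singleton, List.mem_cons]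
      rintro (h | h)
      · exact hne h.symm
      · exact hgS' (hqS _ h)
  obtain ⟨c', h, hW, hreg⟩ := hT.shrubby i (T.tgt g') (g :: q) [g'] hsp.path hsp.path'
    (fun h => hne (List.cons.inj h).1)
  change h ∈ T.regionEdges (pairEdges (g :: q) [g']) at hreg
  replace hW := hW.resolve_right (hT.not_wheel_infix_singleton _ _ _)
  rcases List.infix_cons_iff.1 hW with hW | hW
  · obtain ⟨t, ht⟩ := hW
    obtain ⟨W', hW'ne, hW'⟩ := wheel_eq_cons (T := T) c' h (hT.three_le _ _)
    rw [hW', List.cons_append] at ht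
    obtain ⟨hhg, rfl⟩ := List.cons.inj ht
    have hhi : T.tgt h = i := by rw [← src_next c', hhg, hgi]
    have hpW := hT.isPath_wheel c' h
    rw [hW', hhg] at hpW
    obtain ⟨x, hx1, hx2⟩ := isPath_append.1 hq
    obtain rfl := hx1.unique_end hpW.2
    have hhS : T.src h ∈ S.verts := hqV _ (mem_pathVerts_append_left hx1.end_mem)
    have hA : h ∉ pairEdges (g :: (W' ++ t)) [g'] := by
      rintro (h1 | h1)
      · rcases List.mem_cons.1 h1 with rfl | h1
        · exact hi (hhi ▸ hgm)
        · exact notMem_of_tgt_eq hi hhi (hqS h h1)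
      · rw [List.mem_singleton.1 h1] at hhi
        exact hi (hhi ▸ hgm')
    have hen := hreg.resolve_left hA
    -- The broken wheel starts with `g`, so its interface `h` ends at `i`. If `h = b`, there is an
    -- oriented cycle through the tail of `b`. If not, the curve encloses the angle at `i` that does
    -- not contain `b`, so that together with the two faces at `b` it surrounds `i`.
    by_cases hcc : c' = c
    · subst hcc
      obtain rfl : h = b := (T.next c').injective hhg
      have hy := hPS.reaches_antisymm hT ⟨t, hx2, hqS.right⟩ (h₂.reaches hT hi)
      obtain ⟨w, hw, -, hwS, hwp⟩ := h₂.exists_path hT hi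
      rw [hy] at hwp
      exact hw (hPS.eq_nil_of_closed hT hwp hwS)
    · have hcc : c' = !c := by cases c <;> cases c' <;> simp_all
      subst hcc
      have hgen : T.Enclosed (pairEdges (g :: (W' ++ t)) [g']) (T.face (!c) g) := by
        have hgh : T.face (!c) g = T.face (!c) h := by rw [← hhg, face_next]
        rw [hgh]
        exact enclosed_cross hA _ hen
      have hkey : ∀ u : E × Bool, T.halfVert u = i → u.1 ∈ pairEdges (g :: (W' ++ t)) [g'] →
          u = (g, false) ∨ u = (g', false) := by
        rintro ⟨e, _ | _⟩ hu hm
        · rcases hm with hm | hm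
          · rcases List.mem_cons.1 hm with rfl | hm
            · exact Or.inl rfl
            · exact absurd (hqS _ hm) (notMem_of_src_eq hi hu)
          · rw [show e = g' from List.mem_singleton.1 hm]; exact Or.inr rfl
        · exfalso
          have hu : T.tgt e = i := hu
          rcases hm with hm | hm
          · rcases List.mem_cons.1 hm with rfl | hm
            · exact hi (hu ▸ hgm)
            · exact notMem_of_tgt_eq hi hu (hqS _ hm)
          · rw [show e = g' from List.mem_singleton.1 hm] at hu; exact hi (hu ▸ hgm')
      have hgen' : T.Enclosed (pairEdges (g :: (W' ++ t)) [g']) (T.face c g') := by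
        refine (Conn.enclosed_iff ?_).1 hgen
        clear_value g g'
        cases c with
        | true =>
          exact hT.conn_of_two_halves (h := (g, false)) (h' := (g', false)) (hgi.trans hgi'.symm)
            (by simpa using hne) fun u hu => hkey u (hu.trans hgi)
        | false =>
          exact (hT.conn_of_two_halves (h := (g', false)) (h' := (g, false)) (hgi'.trans hgi.symm)
            (by simpa using Ne.symm hne) fun u hu hm => (hkey u (hu.trans hgi') hm).symm).symm
      refine false_of_finite_closed hT hS hi (c := c) hbi
        (R := {F | T.Enclosed (pairEdges (g :: (W' ++ t)) [g']) F} ∪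
          {T.face c b, T.face (!c) b})
        ((hT.finite_enclosed (finite_pairEdges _ _) ⟨g, Or.inl (by simp)⟩).union (Set.toFinite _))
        (fun e he d hd => ?_) (by simp)
      rcases hd with hd | hd | hd
      · by_cases heA : e ∈ pairEdges (g :: (W' ++ t)) [g']
        · have : e = g ∨ e = g' := by
            rcases heA with h1 | h1
            · exact (List.mem_cons.1 h1).imp id fun h2 => absurd (hqS _ h2) he
            · exact Or.inr (List.mem_singleton.1 h1)
          rcases this with rfl | rfl
          · by_cases hdc : d = c
            · subst hdc; exact Or.inl hgen
            · have : d = !c := by cases c <;> cases d <;> simp_all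
              subst this
              right; left; rw [Bool.not_not]; exact hfg
          · by_cases hdc : d = c
            · subst hdc; right; right; exact hfg'
            · have : d = !c := by cases c <;> cases d <;> simp_all
              subst this
              left; rw [Bool.not_not]; exact hgen'
        · exact Or.inl (enclosed_cross heA _ hd)
      · obtain rfl := color_eq_of_face_eq hd
        rcases h₁.eq_or_eq hT hi hd he with rfl | rfl
        · simp
        · exact Or.inl hgen
      · obtain rfl := color_eq_of_face_eq hd
        rw [Bool.not_not]
        rcases h₂.eq_or_eq hT hi hd he with rfl | rfl
        · simp
        · exact Or.inl hgen'
  · -- The broken wheel is in `S` and can be replaced by its mirror image.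
    have hWS := hqS.of_infix hW
    have h4 := hPS.interface_notMem hT hWS
    have hA : h ∉ pairEdges (g :: q) [g'] := by
      have h5 := verts_mem_of_contains_wheel hT hWS
      rintro (h1 | h1)
      · rcases List.mem_cons.1 h1 with h1 | h1
        · rw [h1] at h5; exact hi (hgi ▸ h5.1)
        · exact h4 (hqS _ h1)
      · rw [List.mem_singleton.1 h1] at h5; exact hi (hgi' ▸ h5.1)
    have hen := hreg.resolve_left hA
    obtain ⟨s, t, rfl⟩ := hW
    rw [show g :: (s ++ T.wheel c' h ++ t) = (g :: s) ++ T.wheel c' h ++ t by simp]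
      at hA hen hsp hN
    obtain ⟨h1, -, h3⟩ := hsp.swap hT hen hA
    rw [show (g :: s) ++ T.wheel (!c') h ++ t = g :: (s ++ T.wheel (!c') h ++ t) by simp] at h1 h3
    refine ih _ ?_ _ (hPS.contains_swap hqS) h1.2 rfl
    omega

theorem FullCorner.reaches_of_passesThrough (hT : T.IsShrubbyCover) (hi : i ∉ S.verts)
    {c : Bool} {a : E} (h : S.FullCorner i c a) {v : T.Vertex} (hv : v ≠ i)
    (hp : T.PassesThrough (T.wheel c (T.next c a)) v) :
    S.Reaches (T.tgt (T.next c a)) v ∧ S.Reaches v (T.src a) := by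
  obtain ⟨w, -, hw, hwS, hwp⟩ := h.exists_path hT hi
  have hmem : v ∈ T.pathVerts (T.tgt (T.next c a)) w := by
    obtain ⟨e, he, hev⟩ := hp
    rw [hw, List.mem_append, List.mem_singleton] at he
    rcases he with he | rfl <;> rcases hev with rfl | rfl
    · exact hwp.src_mem_of_mem he
    · exact tgt_mem_pathVerts he
    · exact hwp.end_mem
    · exact absurd h.1.2 hv
  obtain ⟨s, t, rfl, h1, h2⟩ := hwp.exists_split hmem
  exact ⟨⟨s, h1, hwS.left⟩, ⟨t, h2, hwS.right⟩⟩

/-- A vertex of the broken wheel of a full corner at `a`, other than `i`, that also reaches the tail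
of another edge into `i` is the start of the broken wheel. Indeed, there is a full corner at `a`
whose broken wheel starts below `v`, and `not_reaches` shows that it is the given one. -/
theorem FullCorner.eq_start (hT : T.IsShrubbyCover) (hS : S.IsShrub) (hi : i ∉ S.verts)
    {c : Bool} {a b : E} (ha : S.FullCorner i c a) (hb : b ∈ S.edgesTo i) (hab : a ≠ b)
    {v : T.Vertex} (hv : S.Reaches (T.tgt (T.next c a)) v) (hva : S.Reaches v (T.src a))
    (hvb : S.Reaches v (T.src b)) : v = T.tgt (T.next c a) := by
  obtain ⟨p, hp, hpS⟩ := hva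
  obtain ⟨q, hq, hqS⟩ := hvb
  obtain ⟨d, -, hd, hvd⟩ := exists_fullCorner_of_in hT hS hi ha.1 hb hab hp hpS hq hqS
  by_cases hdc : d = c
  · subst hdc
    exact hS.isPreShrub.reaches_antisymm hT hvd hv
  · have : d = !c := by cases c <;> cases d <;> simp_all
    subst this
    exact absurd (hv.trans hvd) (ha.not_reaches hT hS hi hd)

/-- Broken wheels at `i` with distinct last edges and distinct interfaces meet only at `i`. -/
theorem FullCorner.eq_of_passesThrough (hT : T.IsShrubbyCover) (hS : S.IsShrub) (hi : i ∉ S.verts)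
    {c d : Bool} {a b : E} (ha : S.FullCorner i c a) (hb : S.FullCorner i d b) (hab : a ≠ b)
    (hne : T.next c a ≠ T.next d b) {v : T.Vertex}
    (hva : T.PassesThrough (T.wheel c (T.next c a)) v)
    (hvb : T.PassesThrough (T.wheel d (T.next d b)) v) : v = i := by
  by_contra hv
  obtain ⟨h1, h2⟩ := ha.reaches_of_passesThrough hT hi hv hva
  obtain ⟨h3, h4⟩ := hb.reaches_of_passesThrough hT hi hv hvb
  have h5 := ha.eq_start hT hS hi hb.1 hab h1 h2 h4
  have h6 := hb.eq_start hT hS hi ha.1 hab.symm h3 h4 h2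
  exact hne (hT.eq_of_src_eq_of_tgt_eq
    ((src_next_of_mem_edgesTo ha.1 c).trans (src_next_of_mem_edgesTo hb.1 d).symm)
    (h5.symm.trans h6))

/-! ### Families of broken wheels -/

/-- Full corners with distinct last edges and distinct interfaces form a family of broken wheels. -/
theorem exists_wheelFamily (hT : T.IsShrubbyCover) (hS : S.IsShrub) (hi : i ∉ S.verts)
    {D : Set E} (hD : D.Finite) (col : E → Bool) (hfull : ∀ a ∈ D, S.FullCorner i (col a) a)
    (hinj : ∀ a ∈ D, ∀ b ∈ D, a ≠ b → T.next (col a) a ≠ T.next (col b) b) :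
    D.ncard ∈ S.wheelCounts i := by
  classical
  have hlast : ∀ a ∈ D, (T.wheel (col a) (T.next (col a) a)).getLast? = some a := by
    intro a ha
    obtain ⟨w, -, hw, -⟩ := (hfull a ha).exists_path hT hi
    simp [hw]
  refine ⟨hD.toFinset.image fun a => T.wheel (col a) (T.next (col a) a), ⟨?_, ?_, ?_, ?_⟩, ?_⟩
  · intro B hB
    obtain ⟨a, -, rfl⟩ := Finset.mem_image.1 hB
    exact ⟨_, _, rfl⟩
  · intro B hB
    obtain ⟨a, ha, rfl⟩ := Finset.mem_image.1 hB
    exact (hfull a (by simpa using ha)).2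
  · intro B hB
    obtain ⟨a, ha, rfl⟩ := Finset.mem_image.1 hB
    have ha : a ∈ D := by simpa using ha
    exact ⟨a, List.mem_of_getLast? (hlast a ha), Or.inr (hfull a ha).1.2⟩
  · intro B hB B' hB' hne v hv hv'
    obtain ⟨a, ha, rfl⟩ := Finset.mem_image.1 hB
    obtain ⟨b, hb, rfl⟩ := Finset.mem_image.1 hB'
    have ha : a ∈ D := by simpa using ha
    have hb : b ∈ D := by simpa using hb
    have hab : a ≠ b := fun h => hne (by rw [h])
    exact (hfull a ha).eq_of_passesThrough hT hS hi (hfull b hb) hab (hinj a ha b hb hab) hv hv'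
  · rw [Finset.card_image_of_injOn, Set.ncard_eq_toFinset_card D hD]
    intro a ha b hb hab
    have ha : a ∈ D := by simpa using ha
    have hb : b ∈ D := by simpa using hb
    have := hlast a ha
    simp only at hab
    rw [hab, hlast b hb] at this
    exact (Option.some.inj this).symm

/-- A broken wheel in `S + i` through `i` ends at `i`: it is given by a full corner. -/
theorem exists_fullCorner_of_passesThrough (hT : T.IsShrubbyCover) (hi : i ∉ S.verts) {c : Bool}
    {e : E} (h : (S.addVertex i).ContainsPath (T.wheel c e))
    (hp : T.PassesThrough (T.wheel c e) i) : ∃ a, T.next c a = e ∧ S.FullCorner i c a := by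
  obtain ⟨a, rfl⟩ := (T.next c).surjective e
  refine ⟨a, rfl, ?_, h⟩
  obtain ⟨w, -, hw⟩ := wheel_next_eq (T := T) c a (hT.three_le _ _)
  have hpath := hT.isPath_wheel c (T.next c a)
  rw [hw] at h hp hpath
  have hsrc : ∀ e ∈ (S.addVertex i).edges, T.src e ∈ S.verts := by
    rintro e (he | he)
    · exact S.src_mem e he
    · exact he.1
  have ha := h a (by simp)
  have hwS := contains_of_addVertex hi (isPath_concat.1 hpath).1 h.left (hsrc a ha)
  obtain ⟨u, hu, hui⟩ := hp
  have hui' : T.tgt u = i := hui.resolve_left fun h1 => hi (h1 ▸ hsrc u (h u hu))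
  rcases List.mem_append.1 hu with hu | hu
  · exact absurd (hwS u hu) (notMem_of_tgt_eq hi hui')
  · rw [List.mem_singleton.1 hu] at hui'
    exact ha.resolve_left (notMem_of_tgt_eq hi hui')

/-- The broken wheels of a family inject into the edges into `i` by their last edges, and into the
edges out of `i` by their interfaces. -/
theorem IsWheelFamily.exists_injections (hT : T.IsShrubbyCover) (hi : i ∉ S.verts)
    {W : Finset (List E)} (hW : S.IsWheelFamily i W) :
    ∃ (col : List E → Bool) (a : List E → E), (∀ B ∈ W, S.FullCorner i (col B) (a B)) ∧
      (∀ B ∈ W, ∀ B' ∈ W, a B = a B' → B = B') ∧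
      ∀ B ∈ W, ∀ B' ∈ W, T.next (col B) (a B) = T.next (col B') (a B') → B = B' := by
  have hex : ∀ B : List E, ∃ x : Bool × E, B ∈ W →
      B = T.wheel x.1 (T.next x.1 x.2) ∧ S.FullCorner i x.1 x.2 := by
    intro B
    by_cases hB : B ∈ W
    · obtain ⟨c, e, rfl⟩ := hW.wheel B hB
      obtain ⟨a, rfl, ha⟩ := exists_fullCorner_of_passesThrough hT hi (hW.contained _ hB)
        (hW.through _ hB)
      exact ⟨(c, a), fun _ => ⟨rfl, ha⟩⟩
    · by_cases hE : Nonempty E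
      · exact ⟨(true, hE.some), fun h => absurd h hB⟩
      · exfalso
        obtain ⟨e, -⟩ := Quotient.exists_rep i
        exact hE ⟨e⟩
  choose x hx using hex
  refine ⟨fun B => (x B).1, fun B => (x B).2, fun B hB => (hx B hB).2, ?_, ?_⟩
  · intro B hB B' hB' hab
    by_contra hne
    have hpass : ∀ B ∈ W, T.PassesThrough B (T.src (x B).2) := by
      intro B hB
      obtain ⟨w, -, hw, -⟩ := (hx B hB).2.exists_path hT hi
      have hm : (x B).2 ∈ T.wheel (x B).1 (T.next (x B).1 (x B).2) := by rw [hw]; simp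
      exact ⟨(x B).2, (hx B hB).1.symm.subst (motive := fun l => (x B).2 ∈ l) hm, Or.inl rfl⟩
    have h1 := hW.disjoint B hB B' hB' hne _ (hpass B hB)
      (by have := hpass B' hB'; simp only at hab; rwa [← hab] at this)
    exact hi (h1 ▸ (hx B hB).2.1.1)
  · intro B hB B' hB' hab
    by_contra hne
    have hpass : ∀ B ∈ W, T.PassesThrough B (T.tgt (T.next (x B).1 (x B).2)) := by
      intro B hB
      obtain ⟨w, -, hw⟩ := wheel_eq_cons (T := T) (x B).1 (T.next (x B).1 (x B).2)
        (hT.three_le _ _)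
      have hm : T.next (x B).1 (T.next (x B).1 (x B).2) ∈
          T.wheel (x B).1 (T.next (x B).1 (x B).2) := by rw [hw]; exact List.mem_cons_self
      exact ⟨_, (hx B hB).1.symm.subst
        (motive := fun l => T.next (x B).1 (T.next (x B).1 (x B).2) ∈ l) hm, Or.inl (src_next _ _)⟩
    have h1 := hW.disjoint B hB B' hB' hne _ (hpass B hB)
      (by have := hpass B' hB'; simp only at hab; rwa [← hab] at this)
    exact hi (h1 ▸ (hx B hB).2.tgt_mem hT hi)

theorem le_ncard_of_mem_wheelCounts (hT : T.IsShrubbyCover) (hi : i ∉ S.verts)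
    (hfin : (S.edgesTo i).Finite) {n : ℕ} (hn : n ∈ S.wheelCounts i) :
    n ≤ (S.edgesTo i).ncard := by
  obtain ⟨W, hW, rfl⟩ := hn
  obtain ⟨col, a, h1, h2, -⟩ := hW.exists_injections hT hi
  rw [← Set.ncard_coe_finset]
  exact Set.ncard_le_ncard_of_injOn a (fun B hB => (h1 B hB).1) (fun B hB B' hB' => h2 B hB B' hB')
    hfin

end Subgraph

end Disjointness
end BicoloredMap

namespace BicoloredMap

/-! ### The order of the edges around the added vertex -/

section Sectors

variable {E : Type*} {T : BicoloredMap E}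

theorem rot_apply_eq_iff {a b : E} : T.rot a = b ↔ T.next true a = T.next false b := by
  change (T.next false).symm (T.next true a) = b ↔ _
  rw [Equiv.symm_apply_eq]

theorem rot_pow_minimalPeriod_add (z : E) (j : ℕ) :
    (T.rot ^ (Function.minimalPeriod T.rot z + j)) z = (T.rot ^ j) z := by
  rw [add_comm, pow_add, Equiv.Perm.mul_apply, Equiv.Perm.coe_pow _ (Function.minimalPeriod _ _),
    Function.iterate_minimalPeriod]

theorem rot_pow_minimalPeriod (z : E) : (T.rot ^ Function.minimalPeriod T.rot z) z = z := by
  simpa using rot_pow_minimalPeriod_add z 0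

theorem rot_pow_ne {z : E} {l m : ℕ} (h : l < m) (h' : m < l + Function.minimalPeriod T.rot z) :
    (T.rot ^ l) z ≠ (T.rot ^ m) z := by
  intro heq
  obtain ⟨d, rfl⟩ := Nat.exists_eq_add_of_lt h
  rw [add_assoc, pow_add, Equiv.Perm.mul_apply] at heq
  have h1 := (T.rot ^ l).injective heq
  have := Function.IsPeriodicPt.minimalPeriod_le (Nat.succ_pos d)
    (show (T.rot)^[d + 1] z = z by rw [← Equiv.Perm.coe_pow]; exact h1.symm)
  omega

theorem tgt_rot_pow (z : E) (m : ℕ) : T.tgt ((T.rot ^ m) z) = T.tgt z :=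
  tgt_eq_iff.2 (Equiv.Perm.SameCycle.symm ⟨(m : ℕ), by rw [zpow_natCast]⟩)

theorem face_false_rot (e : E) : T.face false (T.rot e) = T.face false (T.next true e) := by
  rw [← face_next, rot_apply_eq_iff.1 rfl]

theorem conn_rot_succ {A : Set E} {z : E} {x : ℕ} (hout : T.next true ((T.rot ^ x) z) ∉ A) :
    T.Conn A (T.face true ((T.rot ^ x) z)) (T.face false ((T.rot ^ (x + 1)) z)) := by
  rw [pow_succ', Equiv.Perm.mul_apply, face_false_rot, ← face_next]
  exact Conn.cross hout _ _

theorem conn_rot_pow {A : Set E} {z : E} {x y : ℕ} (hxy : x ≤ y)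
    (hout : ∀ l, x ≤ l → l < y → T.next true ((T.rot ^ l) z) ∉ A)
    (hin : ∀ l, x < l → l ≤ y → (T.rot ^ l) z ∉ A) :
    T.Conn A (T.face true ((T.rot ^ x) z)) (T.face true ((T.rot ^ y) z)) := by
  induction y, hxy using Nat.le_induction with
  | base => exact Conn.refl _
  | succ y hy ih =>
    refine (ih (fun l h1 h2 => hout l h1 (by omega)) fun l h1 h2 => hin l h1 (by omega)).trans ?_
    exact (conn_rot_succ (hout y hy (by omega))).trans
      (Conn.cross (hin (y + 1) (by omega) le_rfl) _ _)

theorem IsShrubbyCover.exists_rot_pow_pos (hT : T.IsShrubbyCover) {z e : E}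
    (h : T.tgt e = T.tgt z) :
    ∃ m, 0 < m ∧ m ≤ Function.minimalPeriod T.rot z ∧ (T.rot ^ m) z = e := by
  obtain ⟨m, hm, rfl⟩ := hT.exists_rot_pow h.symm
  rcases Nat.eq_zero_or_pos m with rfl | h0
  · exact ⟨_, hm, le_rfl, rot_pow_minimalPeriod z⟩
  · exact ⟨m, h0, hm.le, rfl⟩

namespace Subgraph

variable {S : T.Subgraph} {i : T.Vertex}

theorem src_mem_of_mem_addVertex {e : E} (he : e ∈ (S.addVertex i).edges) : T.src e ∈ S.verts :=
  he.elim (S.src_mem e) fun h => h.1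

theorem notMem_addVertex_of_src_eq (hi : i ∉ S.verts) {e : E} (he : T.src e = i) :
    e ∉ (S.addVertex i).edges := fun h => hi (he ▸ src_mem_of_mem_addVertex h)

theorem mem_edgesTo_of_mem_addVertex (hi : i ∉ S.verts) {e : E} (he : T.tgt e = i)
    (h : e ∈ (S.addVertex i).edges) : e ∈ S.edgesTo i :=
  h.resolve_left (notMem_of_tgt_eq hi he)

theorem finite_edgesTo (hT : T.IsShrubbyCover) : (S.edgesTo i).Finite := by
  refine ((hT.finite_halves i).image Prod.fst).subset fun e he => ?_
  exact ⟨(e, true), he.2, rfl⟩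

/-- Some edge `z` into `i` is followed by a corner that `S + i` does not enclose. -/
theorem exists_exceptional (hT : T.IsShrubbyCover) (hS : S.IsShrub) (hi : i ∉ S.verts)
    (hne : (S.edgesTo i).Nonempty) :
    ∃ z ∈ S.edgesTo i, ¬ T.Enclosed (S.addVertex i).edges (T.face true z) := by
  obtain ⟨a, ha⟩ := hne
  have key : ∀ m, ∃ z ∈ S.edgesTo i, T.Conn (S.addVertex i).edges (T.face true z)
      (T.face ((T.halfRot ^ m) (a, true)).2 ((T.halfRot ^ m) (a, true)).1) := by
    intro m
    induction m with
    | zero => exact ⟨a, ha, Conn.refl _⟩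
    | succ m ih =>
      have hv := halfVert_halfRot_pow (T := T) (m + 1) (a, true)
      by_cases hA : ((T.halfRot ^ (m + 1)) (a, true)).1 ∈ (S.addVertex i).edges
      · rw [halfVert_true, ha.2] at hv
        generalize (T.halfRot ^ (m + 1)) (a, true) = h at hv hA
        obtain ⟨e, _ | _⟩ := h
        · exact absurd hA (notMem_addVertex_of_src_eq hi hv)
        · exact ⟨e, mem_edgesTo_of_mem_addVertex hi hv hA, Conn.refl _⟩
      · obtain ⟨z, hz, h⟩ := ih
        refine ⟨z, hz, h.trans ?_⟩
        rw [pow_succ', Equiv.Perm.mul_apply] at hA ⊢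
        rw [← face_halfRot]
        exact Conn.cross hA _ _
  obtain ⟨h, hh, hn⟩ := exists_not_enclosed hT hS hi (A := (S.addVertex i).edges) (by
    rintro e (h | h)
    · exact Or.inl h
    · exact Or.inr (Or.inr h.2))
  obtain ⟨m, rfl⟩ := hT.exists_halfRot_pow (h := (a, true)) (ha.2.trans hh.symm)
  obtain ⟨z, hz, hc⟩ := key m
  exact ⟨z, hz, fun h => hn (hc.enclosed_iff.1 h)⟩

/-- An edge `z` into `i` such that the corner following it is not enclosed by `S + i`. It is unique,
and the edges from `S` to `i` are enumerated in counterclockwise order starting after `z`. -/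
structure IsExceptional (S : T.Subgraph) (i : T.Vertex) (z : E) : Prop where
  mem : z ∈ S.edgesTo i
  not_enclosed : ¬ T.Enclosed (S.addVertex i).edges (T.face true z)

theorem pairEdges_subset_addVertex {a b : E} (ha : a ∈ S.edgesTo i) (hb : b ∈ S.edgesTo i)
    {p q : List E} (hp : S.ContainsPath p) (hq : S.ContainsPath q) :
    pairEdges (p ++ [a]) (q ++ [b]) ⊆ (S.addVertex i).edges := by
  intro u hu
  simp only [Set.mem_ofPred_eq, List.mem_append, List.mem_singleton] at hu
  rcases hu with (h | rfl) | (h | rfl)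
  · exact Or.inl (hp u h)
  · exact Or.inr ha
  · exact Or.inl (hq u h)
  · exact Or.inr hb

theorem eq_or_eq_of_mem_pairEdges (hi : i ∉ S.verts) {a b u : E} {p q : List E}
    (hp : S.ContainsPath p) (hq : S.ContainsPath q) (hu : T.tgt u = i)
    (h : u ∈ pairEdges (p ++ [a]) (q ++ [b])) : u = a ∨ u = b := by
  simp only [Set.mem_ofPred_eq, List.mem_append, List.mem_singleton] at h
  have := notMem_of_tgt_eq hi hu
  rcases h with (h | h) | (h | h)
  · exact absurd (hp u h) this
  · exact Or.inl h
  · exact absurd (hq u h) this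
  · exact Or.inr h

/-- Two paths in `S` from a common vertex to two given vertices of `S`. -/
theorem IsShrub.exists_paths (hS : S.IsShrub) {x y : T.Vertex} (hx : x ∈ S.verts)
    (hy : y ∈ S.verts) : ∃ v p q, T.IsPath v p x ∧ S.ContainsPath p ∧ T.IsPath v q y ∧
      S.ContainsPath q := by
  obtain ⟨r, -, -, hr⟩ := hS.single_root
  obtain ⟨p, hp, hpS⟩ := hr _ hx
  obtain ⟨q, hq, hqS⟩ := hr _ hy
  exact ⟨r, p, q, hp, hpS, hq, hqS⟩

namespace IsExceptional

variable {z : E} (hT : T.IsShrubbyCover) (hS : S.IsShrub) (hi : i ∉ S.verts)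
  (hz : S.IsExceptional i z)
include hT hS hi hz

omit hS hi in
theorem exists_pos {e : E} (he : e ∈ S.edgesTo i) :
    ∃ m, 0 < m ∧ m ≤ Function.minimalPeriod T.rot z ∧ (T.rot ^ m) z = e :=
  hT.exists_rot_pow_pos (he.2.trans hz.mem.2.symm)

omit hT hS hi in
theorem tgt_rot_pow (m : ℕ) : T.tgt ((T.rot ^ m) z) = i :=
  (BicoloredMap.tgt_rot_pow z m).trans hz.mem.2

omit hT hS in
theorem next_rot_pow_notMem (m : ℕ) : T.next true ((T.rot ^ m) z) ∉ (S.addVertex i).edges :=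
  notMem_addVertex_of_src_eq hi ((src_next _ _).trans (hz.tgt_rot_pow m))

/-- Two paths of `S + i` that enter `i` along two edges enclose the angle between these edges that
avoids the exceptional corner. -/
theorem enclosed_between {x y : ℕ} (hx : 0 < x) (hxy : x < y)
    (hy : y ≤ Function.minimalPeriod T.rot z) {a b : E} (hxa : (T.rot ^ x) z = a)
    (hyb : (T.rot ^ y) z = b) (ha : a ∈ S.edgesTo i) (hb : b ∈ S.edgesTo i) {v : T.Vertex}
    {p q : List E} (hp : T.IsPath v p (T.src a)) (hpS : S.ContainsPath p)
    (hq : T.IsPath v q (T.src b)) (hqS : S.ContainsPath q) :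
    (T.Enclosed (pairEdges (p ++ [a]) (q ++ [b])) (T.face true a) ∧ S.FullCorner i true a) ∧
    (T.Enclosed (pairEdges (p ++ [a]) (q ++ [b])) (T.face false b) ∧ S.FullCorner i false b) ∧
    ¬ T.Enclosed (pairEdges (p ++ [a]) (q ++ [b])) (T.face true b) := by
  have hab : a ≠ b := by
    rw [← hxa, ← hyb]
    exact rot_pow_ne hxy (by omega)
  have hsub := pairEdges_subset_addVertex ha hb hpS hqS
  set A := pairEdges (p ++ [a]) (q ++ [b]) with hA
  have hout : ∀ l, T.next true ((T.rot ^ l) z) ∉ A := fun l h =>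
    hz.next_rot_pow_notMem hi l (hsub h)
  have hin : ∀ l, (T.rot ^ l) z ≠ a → (T.rot ^ l) z ≠ b → (T.rot ^ l) z ∉ A := fun l h1 h2 h3 =>
    (eq_or_eq_of_mem_pairEdges hi hpS hqS (hz.tgt_rot_pow l) h3).elim h1 h2
  have hzA : ¬ T.Enclosed A (T.face true z) := fun h => hz.not_enclosed (h.mono hsub)
  -- No edge of `A` lies between the exceptional corner and the clockwise side of `a`, nor between
  -- the counterclockwise side of `b` and this corner.
  have hfa : ¬ T.Enclosed A (T.face false a) := by
    intro h
    refine hzA ((Conn.enclosed_iff ?_).2 h)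
    have h1 := (conn_rot_pow (A := A) (z := z) (x := 0) (y := x - 1) (by omega)
      (fun l _ _ => hout l) (fun l h1 h2 => hin l
        (by rw [← hxa]; exact rot_pow_ne (by omega) (by omega))
        (by rw [← hyb]; exact rot_pow_ne (by omega) (by omega)))).trans (conn_rot_succ (hout _))
    rw [Nat.sub_add_cancel hx, hxa] at h1
    exact h1
  have htb : ¬ T.Enclosed A (T.face true b) := by
    intro h
    refine hzA ((Conn.enclosed_iff ?_).1 h)
    have h1 := conn_rot_pow (A := A) (z := z) hy (fun l _ _ => hout l) (fun l h1 h2 => hin l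
        (by rw [← hxa]; exact (rot_pow_ne (by omega) (by omega)).symm)
        (by rw [← hyb]; exact (rot_pow_ne (by omega) (by omega)).symm))
    rwa [hyb, rot_pow_minimalPeriod] at h1
  refine ⟨?_, ?_, htb⟩
  · obtain ⟨c, h1, h2, -⟩ := exists_fullCorner_of_in hT hS hi ha hb hab hp hpS hq hqS
    cases c with
    | true => exact ⟨h1, h2⟩
    | false => exact absurd h1 hfa
  · obtain ⟨c, h1, h2, -⟩ := exists_fullCorner_of_in hT hS hi hb ha hab.symm hq hqS hp hpS
    rw [pairEdges_comm, ← hA] at h1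
    cases c with
    | true => exact absurd h1 htb
    | false => exact ⟨h1, h2⟩

theorem fullCorner_between {x y : ℕ} (hx : 0 < x) (hxy : x < y)
    (hy : y ≤ Function.minimalPeriod T.rot z) (ha : (T.rot ^ x) z ∈ S.edgesTo i)
    (hb : (T.rot ^ y) z ∈ S.edgesTo i) :
    S.FullCorner i true ((T.rot ^ x) z) ∧ S.FullCorner i false ((T.rot ^ y) z) := by
  obtain ⟨v, p, q, hp, hpS, hq, hqS⟩ := hS.exists_paths ha.1 hb.1
  obtain ⟨h1, h2, -⟩ := hz.enclosed_between hT hS hi hx hxy hy rfl rfl ha hb hp hpS hq hqS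
  exact ⟨h1.2, h2.2⟩

theorem enclosed_of_mem {x : ℕ} (hx : 0 < x) (hxn : x < Function.minimalPeriod T.rot z)
    (ha : (T.rot ^ x) z ∈ S.edgesTo i) :
    T.Enclosed (S.addVertex i).edges (T.face true ((T.rot ^ x) z)) := by
  obtain ⟨v, p, q, hp, hpS, hq, hqS⟩ := hS.exists_paths ha.1 hz.mem.1
  obtain ⟨h1, -⟩ := hz.enclosed_between hT hS hi hx hxn le_rfl rfl (rot_pow_minimalPeriod z) ha
    hz.mem hp hpS hq hqS
  exact h1.1.mono (pairEdges_subset_addVertex ha hz.mem hpS hqS)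

/-- The corners that follow `z`, up to the next edge from `S`, are the ones that `S + i` does not
enclose. -/
theorem not_enclosed_iff {t : ℕ} (ht : t < Function.minimalPeriod T.rot z) :
    ¬ T.Enclosed (S.addVertex i).edges (T.face true ((T.rot ^ t) z)) ↔
      ∀ l, 0 < l → l ≤ t → (T.rot ^ l) z ∉ S.edgesTo i := by
  constructor
  · induction t with
    | zero => intro _ l h1 h2; omega
    | succ t ih =>
      intro h
      have h1 : (T.rot ^ (t + 1)) z ∉ S.edgesTo i := fun h1 =>
        h (hz.enclosed_of_mem hT hS hi (by omega) ht h1)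
      have h2 : ¬ T.Enclosed (S.addVertex i).edges (T.face true ((T.rot ^ t) z)) := by
        intro h3
        refine h ((Conn.enclosed_iff ?_).1 h3)
        refine conn_rot_pow (by omega) (fun l _ _ => hz.next_rot_pow_notMem hi l) ?_
        intro l h4 h5 h6
        obtain rfl : l = t + 1 := by omega
        exact h1 (mem_edgesTo_of_mem_addVertex hi (hz.tgt_rot_pow _) h6)
      intro l h4 h5
      rcases Nat.lt_or_ge t l with h6 | h6
      · obtain rfl : l = t + 1 := by omega
        exact h1
      · exact ih (by omega) h2 l h4 h6
  · intro h1 h2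
    refine hz.not_enclosed ((Conn.enclosed_iff ?_).2 h2)
    exact conn_rot_pow (x := 0) (by omega) (fun l _ _ => hz.next_rot_pow_notMem hi l)
      fun l h3 h4 h5 => h1 l h3 h4 (mem_edgesTo_of_mem_addVertex hi (hz.tgt_rot_pow _) h5)

theorem ncard_sub_one_mem_wheelCounts : (S.edgesTo i).ncard - 1 ∈ S.wheelCounts i := by
  rw [← Set.ncard_sdiff_singleton_of_mem hz.mem]
  refine exists_wheelFamily hT hS hi ((finite_edgesTo hT).subset Set.sdiff_subset)
    (fun _ => true) ?_ ?_
  · rintro a ⟨ha, hne⟩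
    obtain ⟨m, h0, hm, rfl⟩ := hz.exists_pos hT ha
    have hlt : m < Function.minimalPeriod T.rot z := by
      refine lt_of_le_of_ne hm ?_
      rintro rfl
      exact hne (rot_pow_minimalPeriod z)
    have hzn : (T.rot ^ Function.minimalPeriod T.rot z) z ∈ S.edgesTo i := by
      rw [rot_pow_minimalPeriod]; exact hz.mem
    exact (hz.fullCorner_between hT hS hi h0 hlt le_rfl ha hzn).1
  · intro a _ b _ hab h
    exact hab ((T.next true).injective h)

/-- A gap: if an edge `a ≠ z` from `S` to `i` is not followed by another one, there is a broken
wheel for each of the edges from `S` to `i`: the blue ones up to `a`, and the red ones after `a`. -/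
theorem ncard_mem_wheelCounts_of_gap {a : E} (ha : a ∈ S.edgesTo i) (haz : a ≠ z)
    (hgap : T.rot a ∉ S.edgesTo i) : (S.edgesTo i).ncard ∈ S.wheelCounts i := by
  classical
  obtain ⟨x, h0, hx, rfl⟩ := hz.exists_pos hT ha
  have hxn : x < Function.minimalPeriod T.rot z := by
    refine lt_of_le_of_ne hx ?_
    rintro rfl
    exact haz (rot_pow_minimalPeriod z)
  have hzn : (T.rot ^ Function.minimalPeriod T.rot z) z ∈ S.edgesTo i := by
    rw [rot_pow_minimalPeriod]; exact hz.mem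
  have hcol : ∀ m, 0 < m → m ≤ Function.minimalPeriod T.rot z →
      ((∃ l, 0 < l ∧ l ≤ x ∧ (T.rot ^ l) z = (T.rot ^ m) z) ↔ m ≤ x) := by
    intro m h1 h2
    refine ⟨fun ⟨l, h3, h4, h5⟩ => ?_, fun h => ⟨m, h1, h, rfl⟩⟩
    by_contra hlt
    exact rot_pow_ne (T := T) (z := z) (l := l) (m := m) (by omega) (by omega) h5
  have hblue : ∀ l m, 0 < l → l ≤ x → x < m → m ≤ Function.minimalPeriod T.rot z →
      (T.rot ^ m) z ∈ S.edgesTo i → T.next true ((T.rot ^ l) z) ≠ T.next false ((T.rot ^ m) z) := by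
    intro l m h1 h2 h3 h4 h5 h6
    have h7 := rot_apply_eq_iff.2 h6
    rw [← Equiv.Perm.mul_apply, ← pow_succ'] at h7
    rcases Nat.lt_or_ge (l + 1) m with h8 | h8
    · exact rot_pow_ne (T := T) (z := z) h8 (by omega) h7
    · obtain rfl : m = x + 1 := by omega
      rw [pow_succ', Equiv.Perm.mul_apply] at h5
      exact hgap h5
  -- The outgoing edge after `a` is used by the blue corner of `a` only, because of the gap.
  refine exists_wheelFamily hT hS hi (finite_edgesTo hT)
    (fun e => decide (∃ l, 0 < l ∧ l ≤ x ∧ (T.rot ^ l) z = e)) ?_ ?_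
  · intro e he
    obtain ⟨m, h1, h2, rfl⟩ := hz.exists_pos hT he
    by_cases hm : m ≤ x
    · rw [decide_eq_true ((hcol m h1 h2).2 hm)]
      exact (hz.fullCorner_between hT hS hi h1 (by omega) le_rfl he hzn).1
    · rw [decide_eq_false (fun h => hm ((hcol m h1 h2).1 h))]
      exact (hz.fullCorner_between hT hS hi h0 (by omega) h2 ha he).2
  · intro e he e' he' hne
    obtain ⟨m, h1, h2, rfl⟩ := hz.exists_pos hT he
    obtain ⟨m', h1', h2', rfl⟩ := hz.exists_pos hT he'
    by_cases hm : m ≤ x <;> by_cases hm' : m' ≤ x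
    · rw [decide_eq_true ((hcol m h1 h2).2 hm), decide_eq_true ((hcol m' h1' h2').2 hm')]
      exact fun h => hne ((T.next true).injective h)
    · rw [decide_eq_true ((hcol m h1 h2).2 hm),
        decide_eq_false (fun h => hm' ((hcol m' h1' h2').1 h))]
      exact hblue m m' h1 hm (by omega) h2' he'
    · rw [decide_eq_false (fun h => hm ((hcol m h1 h2).1 h)),
        decide_eq_true ((hcol m' h1' h2').2 hm')]
      exact (hblue m' m h1' hm' (by omega) h2 he).symm
    · rw [decide_eq_false (fun h => hm ((hcol m h1 h2).1 h)),
        decide_eq_false (fun h => hm' ((hcol m' h1' h2').1 h))]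
      exact fun h => hne ((T.next false).injective h)

/-- Let `f` be an edge from `i` to `S` at a corner between `z` and the next edge `e` from `S` to
`i`. The paths entering `i` along `z` or along `e` and leaving along `f` give a broken wheel on the
exceptional side of `z` or of `e`; otherwise the faces enclosed by these paths would include all the
ones at `i`. -/
theorem fullCorner_of_out {t y : ℕ} (hty : t < y) (hy : y ≤ Function.minimalPeriod T.rot z)
    (hyS : (T.rot ^ y) z ∈ S.edgesTo i) (hf : T.tgt (T.next true ((T.rot ^ t) z)) ∈ S.verts) :
    S.FullCorner i true z ∨ S.FullCorner i false ((T.rot ^ y) z) := by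
  set n := Function.minimalPeriod T.rot z with hn
  set f := T.next true ((T.rot ^ t) z) with hfdef
  have hfi : T.src f = i := (src_next _ _).trans (hz.tgt_rot_pow t)
  by_contra hcon
  push Not at hcon
  have hmain : ∀ {a : E}, a ∈ S.edgesTo i → ∃ A : Set E, ∃ c, A ⊆ insert f (S.addVertex i).edges ∧
      (∀ l, (T.rot ^ l) z ≠ a → (T.rot ^ l) z ∉ A) ∧ T.Enclosed A (T.face c a) ∧
      S.FullCorner i c a := by
    intro a ha
    obtain ⟨v, p, q, hp, hpS, hq, hqS⟩ := hS.exists_paths ha.1 hf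
    obtain ⟨c, h1, h2, -⟩ := exists_fullCorner_of_out hT hS hi ha hfi hf hp hpS hq hqS
    refine ⟨_, c, ?_, ?_, h1, h2⟩
    · intro u hu
      simp only [Set.mem_ofPred_eq, List.mem_append, List.mem_singleton] at hu
      rcases hu with ((h | rfl) | rfl) | h
      · exact Or.inr (Or.inl (hpS u h))
      · exact Or.inr (Or.inr ha)
      · exact Or.inl rfl
      · exact Or.inr (Or.inl (hqS u h))
    · intro l hl hu
      have hti := hz.tgt_rot_pow l
      simp only [Set.mem_ofPred_eq, List.mem_append, List.mem_singleton] at hu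
      rcases hu with ((h | h) | h) | h
      · exact notMem_of_tgt_eq hi hti (hpS _ h)
      · exact hl h
      · exact hi (by rw [← hti, h]; exact hf)
      · exact notMem_of_tgt_eq hi hti (hqS _ h)
  have hout : ∀ {A : Set E}, A ⊆ insert f (S.addVertex i).edges → ∀ l,
      (T.rot ^ l) z ≠ (T.rot ^ t) z → T.next true ((T.rot ^ l) z) ∉ A := by
    intro A hA l hl h
    rcases hA h with h | h
    · exact hl ((T.next true).injective h)
    · exact hz.next_rot_pow_notMem hi l h
  -- `A` comes from `z` and `f`, and `A'` from the next edge and `f`.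
  obtain ⟨A, c, hA, hAin, hAe, hAc⟩ := hmain hz.mem
  obtain ⟨A', c', hA', hAin', hAe', hAc'⟩ := hmain hyS
  have hc : c = false := by
    cases c with
    | true => exact absurd hAc hcon.1
    | false => rfl
  have hc' : c' = true := by
    cases c' with
    | true => rfl
    | false => exact absurd hAc' hcon.2
  subst hc hc'
  -- `A'` encloses the corners from the next edge, past `z`, to `f`; `A` encloses those from `f`,
  -- past the next edge, to `z`.
  have h1 : ∀ j, y ≤ j → j ≤ n + t → T.Enclosed A' (T.face true ((T.rot ^ j) z)) := by
    intro j hj hj'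
    refine (Conn.enclosed_iff ?_).1 hAe'
    refine conn_rot_pow hj (fun l h1 h2 => hout hA' l ?_) (fun l h1 h2 => hAin' l ?_)
    · exact (rot_pow_ne (by omega) (by omega)).symm
    · exact (rot_pow_ne (by omega) (by omega)).symm
  have h2 : ∀ j, t < j → j < n → T.Enclosed A (T.face true ((T.rot ^ j) z)) := by
    intro j hj hj'
    refine (Conn.enclosed_iff ?_).2 hAe
    have h3 := (conn_rot_pow (A := A) (z := z) (x := j) (y := n - 1) (by omega)
      (fun l h1 h2 => hout hA l (rot_pow_ne (by omega) (by omega)).symm)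
      (fun l h1 h2 => hAin l ?_)).trans (conn_rot_succ (hout hA _
        (rot_pow_ne (by omega) (by omega)).symm))
    · rwa [Nat.sub_add_cancel (by omega), hn, rot_pow_minimalPeriod] at h3
    · have := (rot_pow_ne (T := T) (z := z) (l := l) (m := n) (by omega) (by omega))
      rwa [hn, rot_pow_minimalPeriod] at this
  have h3 : ∀ j, j ≤ n → T.Enclosed (insert f (S.addVertex i).edges)
      (T.face true ((T.rot ^ j) z)) := by
    intro j hj
    by_cases h4 : j ≤ t
    · have := h1 (n + j) (by omega) (by omega)
      rw [hn, rot_pow_minimalPeriod_add] at this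
      exact this.mono hA'
    · by_cases h5 : j < n
      · exact (h2 j (by omega) h5).mono hA
      · exact (h1 j (by omega) (by omega)).mono hA'
  have h4 : ∀ j, j < n → T.Enclosed (insert f (S.addVertex i).edges)
      (T.face false ((T.rot ^ (j + 1)) z)) := by
    intro j hj
    by_cases hjt : j = t
    · subst hjt
      by_cases hjn : j + 1 < n
      · refine (enclosed_cross (hAin _ ?_) false (h2 (j + 1) (by omega) hjn)).mono hA
        have := (rot_pow_ne (T := T) (z := z) (l := j + 1) (m := n) (by omega) (by omega))
        rwa [hn, rot_pow_minimalPeriod] at this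
      · rw [show j + 1 = n by omega, hn, rot_pow_minimalPeriod]
        exact hAe.mono hA
    · refine (Conn.enclosed_iff (conn_rot_succ (hout subset_rfl j ?_))).1 (h3 j hj.le)
      rcases Nat.lt_or_gt_of_ne hjt with h | h
      · exact rot_pow_ne h (by omega)
      · exact (rot_pow_ne h (by omega)).symm
  obtain ⟨⟨e, b⟩, hh, hne⟩ := exists_not_enclosed hT hS hi
    (A := insert f (S.addVertex i).edges) (by
      rintro e (rfl | h | h)
      · exact Or.inr (Or.inl hfi)
      · exact Or.inl h
      · exact Or.inr (Or.inr h.2))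
  cases b with
  | true =>
    obtain ⟨m, hm, rfl⟩ := hT.exists_rot_pow (hz.mem.2.trans (show T.tgt e = i from hh).symm)
    exact hne (h3 m hm.le)
  | false =>
    have hti : T.tgt z = T.tgt ((T.next true).symm e) := by
      rw [tgt_next_symm]; exact hz.mem.2.trans hh.symm
    obtain ⟨m, hm, hme⟩ := hT.exists_rot_pow hti
    have := h4 m hm
    rw [pow_succ', Equiv.Perm.mul_apply, hme, face_false_rot, Equiv.apply_symm_apply] at this
    exact hne this

/-- An edge from `i` to `S` at a corner that is not enclosed also gives a broken wheel for each edge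
from `S` to `i`: either all the blue ones, or all the red ones. -/
theorem ncard_mem_wheelCounts_of_out {f : E} (hf : T.src f = i) (hfS : T.tgt f ∈ S.verts)
    (hfe : ¬ T.Enclosed (S.addVertex i).edges (T.face true f)) :
    (S.edgesTo i).ncard ∈ S.wheelCounts i := by
  classical
  have hti : T.tgt z = T.tgt ((T.next true).symm f) := by
    rw [tgt_next_symm]; exact hz.mem.2.trans hf.symm
  obtain ⟨t, ht, hte⟩ := hT.exists_rot_pow hti
  have htf : T.next true ((T.rot ^ t) z) = f := by rw [hte, Equiv.apply_symm_apply]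
  rw [← htf, face_next, hz.not_enclosed_iff hT hS hi ht] at hfe
  have hzn : (T.rot ^ Function.minimalPeriod T.rot z) z ∈ S.edgesTo i := by
    rw [rot_pow_minimalPeriod]; exact hz.mem
  have hn : 0 < Function.minimalPeriod T.rot z := by omega
  have hex : ∃ y, 0 < y ∧ (T.rot ^ y) z ∈ S.edgesTo i := ⟨_, hn, hzn⟩
  obtain ⟨y, ⟨hy0, hyS⟩, hymin⟩ : ∃ y, (0 < y ∧ (T.rot ^ y) z ∈ S.edgesTo i) ∧
      ∀ l < y, ¬ (0 < l ∧ (T.rot ^ l) z ∈ S.edgesTo i) :=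
    ⟨Nat.find hex, Nat.find_spec hex, fun l hl => Nat.find_min hex hl⟩
  have hyn : y ≤ Function.minimalPeriod T.rot z := by
    by_contra h
    exact hymin _ (by omega) ⟨hn, hzn⟩
  have hty : t < y := by
    by_contra h
    exact hfe y hy0 (by omega) hyS
  rcases hz.fullCorner_of_out hT hS hi hty hyn hyS (htf ▸ hfS) with h | h
  · refine exists_wheelFamily hT hS hi (finite_edgesTo hT) (fun _ => true) ?_ ?_
    · intro e he
      obtain ⟨m, h1, h2, rfl⟩ := hz.exists_pos hT he
      rcases Nat.lt_or_ge m (Function.minimalPeriod T.rot z) with h3 | h3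
      · exact (hz.fullCorner_between hT hS hi h1 h3 le_rfl he hzn).1
      · rw [show m = Function.minimalPeriod T.rot z by omega, rot_pow_minimalPeriod]
        exact h
    · intro a _ b _ hab h
      exact hab ((T.next true).injective h)
  · refine exists_wheelFamily hT hS hi (finite_edgesTo hT) (fun _ => false) ?_ ?_
    · intro e he
      obtain ⟨m, h1, h2, rfl⟩ := hz.exists_pos hT he
      rcases Nat.lt_or_ge y m with h3 | h3
      · exact (hz.fullCorner_between hT hS hi hy0 h3 h2 hyS he).2
      · obtain rfl : m = y := by
          by_contra hne
          exact hymin m (by omega) ⟨h1, he⟩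
        exact h
    · intro a _ b _ hab h
      exact hab ((T.next false).injective h)

/-- Without gaps and without edges from `i` to `S` at corners that are not enclosed, the interfaces
follow the edges from `S` to `i` other than `z`. -/
theorem le_of_mem_wheelCounts (hgap : ∀ a ∈ S.edgesTo i, a ≠ z → T.rot a ∈ S.edgesTo i)
    (hout : ∀ f, T.src f = i → T.tgt f ∈ S.verts →
      T.Enclosed (S.addVertex i).edges (T.face true f)) {n : ℕ} (hn : n ∈ S.wheelCounts i) :
    n ≤ (S.edgesTo i).ncard - 1 := by
  obtain ⟨W, hW, rfl⟩ := hn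
  obtain ⟨col, a, h1, -, h2⟩ := hW.exists_injections hT hi
  rw [← Set.ncard_sdiff_singleton_of_mem hz.mem, ← Set.ncard_coe_finset]
  refine Set.ncard_le_ncard_of_injOn
    (fun B => (T.next true).symm (T.next (col B) (a B))) (fun B hB => ?_)
    (fun B hB B' hB' h => h2 B hB B' hB' ((T.next true).symm.injective h))
    ((finite_edgesTo hT).subset Set.sdiff_subset)
  have hB := h1 B hB
  have hsrc := src_next_of_mem_edgesTo hB.1 (col B)
  have henc := hout _ hsrc (hB.tgt_mem hT hi)
  generalize T.next (col B) (a B) = f at hsrc henc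
  have hti : T.tgt z = T.tgt ((T.next true).symm f) := by
    rw [tgt_next_symm]; exact hz.mem.2.trans hsrc.symm
  obtain ⟨t, ht, hte⟩ := hT.exists_rot_pow hti
  -- The interface is enclosed, so some edge from `S` other than `z` comes before it, and without
  -- gaps all the edges into `i` from there to the interface come from `S`.
  have hexists : ∃ l, 0 < l ∧ l ≤ t ∧ (T.rot ^ l) z ∈ S.edgesTo i := by
    by_contra hcon
    push Not at hcon
    refine (hz.not_enclosed_iff hT hS hi ht).2 hcon ?_
    rwa [hte, face_next_symm]
  obtain ⟨l, hl0, hlt, hlS⟩ := hexists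
  have hall : ∀ m, l ≤ m → m ≤ t → (T.rot ^ m) z ∈ S.edgesTo i := by
    intro m hm
    induction m, hm using Nat.le_induction with
    | base => exact fun _ => hlS
    | succ m hm ih =>
      intro hmt
      rw [pow_succ', Equiv.Perm.mul_apply]
      refine hgap _ (ih (by omega)) ?_
      have := rot_pow_ne (T := T) (z := z) (l := 0) (m := m) (by omega) (by omega)
      simpa using this.symm
  rw [← hte]
  refine ⟨hall t hlt le_rfl, ?_⟩
  have := rot_pow_ne (T := T) (z := z) (l := 0) (m := t) (by omega) (by omega)
  simpa using this.symm

end IsExceptional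

end Subgraph

end Sectors
end BicoloredMap

namespace BicoloredMap

/-! ### Minimal bigons and good indices -/

section Bigons

variable {E : Type*} {T : BicoloredMap E}

theorem closedRegion_subset {A A' : Set E} (h : A' ⊆ T.regionEdges A) :
    T.closedRegion A' ⊆ T.closedRegion A := by
  rintro (e | F) hx
  · rcases hx with hx | hx
    · exact h hx
    · exact Or.inr (Enclosed.of_subset_regionEdges h hx)
  · exact Enclosed.of_subset_regionEdges h hx

theorem mem_of_conn_of_closed {A : Set E} {R : Set T.Face}
    (hcl : ∀ e ∉ A, ∀ c, T.face c e ∈ R → T.face (!c) e ∈ R) {F G : T.Face} (hF : F ∈ R)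
    (h : T.Conn A F G) : G ∈ R := by
  induction h with
  | refl => exact hF
  | tail _ h ih =>
    obtain ⟨e, he, c, rfl, rfl⟩ := h
    exact hcl e he c ih

theorem IsShrubbyCover.finite_closedRegion (hT : T.IsShrubbyCover) {A : Set E} (hA : A.Finite)
    (hne : A.Nonempty) : (T.closedRegion A).Finite := by
  have hfin := hT.finite_enclosed hA hne
  have hedges : (A ∪ ⋃ F ∈ {F | T.Enclosed A F}, {e | T.face true e = F}).Finite := by
    refine hA.union (hfin.biUnion fun F _ => ?_)
    by_cases hF : ∃ e, T.face true e = F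
    · obtain ⟨e, rfl⟩ := hF
      refine (List.finite_toSet (e :: T.wheel true e)).subset fun u hu => ?_
      by_cases hue : u = e
      · simp [hue]
      · exact List.mem_cons_of_mem _ (hT.mem_wheel.2 ⟨hu, hue⟩)
    · refine Set.finite_empty.subset fun e he => hF ⟨e, he⟩
  refine ((hedges.image Sum.inl).union (hfin.image Sum.inr)).subset ?_
  rintro (e | F) hx
  · refine Or.inl ⟨e, ?_, rfl⟩
    rcases hx with hx | hx
    · exact Or.inl hx
    · exact Or.inr (Set.mem_biUnion hx rfl)
  · exact Or.inr ⟨F, hx, rfl⟩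

namespace Subgraph

variable {S : T.Subgraph} {i : T.Vertex}

theorem IsBigon.exists_paths (hi : i ∉ S.verts) {a b : E} (ha : a ∈ S.edgesTo i)
    (hb : b ∈ S.edgesTo i) {p p' : List E} (h : S.IsBigon i a b p p') :
    ∃ v q q', p = q ++ [a] ∧ p' = q' ++ [b] ∧ T.IsPath v q (T.src a) ∧ S.ContainsPath q ∧
      T.IsPath v q' (T.src b) ∧ S.ContainsPath q' := by
  obtain ⟨v, -, hp, hp', hpS, hpS', hl, hl', -⟩ := h
  obtain ⟨q, rfl⟩ := List.getLast?_eq_some_iff.1 hl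
  obtain ⟨q', rfl⟩ := List.getLast?_eq_some_iff.1 hl'
  have h1 := (isPath_concat.1 hp).1
  have h2 := (isPath_concat.1 hp').1
  exact ⟨v, q, q', rfl, rfl, h1, contains_of_addVertex hi h1 hpS.left ha.1, h2,
    contains_of_addVertex hi h2 hpS'.left hb.1⟩

theorem isBigon_of_meeting_once (hT : T.IsShrubbyCover) (hS : S.IsShrub) (hi : i ∉ S.verts)
    {a b : E} (ha : a ∈ S.edgesTo i) (hb : b ∈ S.edgesTo i) {v : T.Vertex} {p q : List E}
    (hp : T.IsPath v p (T.src a)) (hpS : S.ContainsPath p)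
    (hq : T.IsPath v q (T.src b)) (hqS : S.ContainsPath q)
    (hmeet : ∀ u ∈ T.pathVerts v p, u ∈ T.pathVerts v q → u = v) :
    S.IsBigon i a b (p ++ [a]) (q ++ [b]) := by
  have hPS := hS.isPreShrub
  have hverts : ∀ {p : List E} {a : E}, a ∈ S.edgesTo i →
      T.pathVerts v (p ++ [a]) = T.pathVerts v p ++ [i] := by
    intro p a ha
    simp [pathVerts, ha.2]
  have hnd : ∀ {p : List E} {a : E}, a ∈ S.edgesTo i → T.IsPath v p (T.src a) →
      S.ContainsPath p → (T.pathVerts v (p ++ [a])).Nodup := by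
    intro p a ha hp hpS
    rw [hverts ha]
    refine List.nodup_append'.2 ⟨hPS.nodup_pathVerts hT hp hpS, by simp, ?_⟩
    rw [List.disjoint_singleton]
    exact fun h => hi (hpS.verts_mem hp ha.1 h)
  have hcont : ∀ {p : List E} {a : E}, a ∈ S.edgesTo i → S.ContainsPath p →
      (S.addVertex i).ContainsPath (p ++ [a]) := by
    intro p a ha hpS u hu
    rcases List.mem_append.1 hu with hu | hu
    · exact Or.inl (hpS u hu)
    · rw [List.mem_singleton.1 hu]; exact Or.inr ha
  refine ⟨v, hpS.verts_mem hp ha.1 (by simp [pathVerts]), isPath_concat.2 ⟨hp, ha.2⟩,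
    isPath_concat.2 ⟨hq, hb.2⟩, hcont ha hpS, hcont hb hqS, by simp, by simp, hnd ha hp hpS,
    hnd hb hq hqS, ?_⟩
  intro u hu hu'
  rw [hverts ha, List.mem_append, List.mem_singleton] at hu
  rw [hverts hb, List.mem_append, List.mem_singleton] at hu'
  rcases hu with hu | hu
  · rcases hu' with hu' | hu'
    · exact Or.inl (hmeet u hu hu')
    · exact Or.inr hu'
  · exact Or.inr hu

theorem exists_minimalBigon (hT : T.IsShrubbyCover) (hS : S.IsShrub) (hi : i ∉ S.verts)
    {a b : E} (ha : a ∈ S.edgesTo i) (hb : b ∈ S.edgesTo i) :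
    ∃ p p', S.IsMinimalBigon i a b p p' := by
  classical
  have hex : ∃ n p p', S.IsBigon i a b p p' ∧ (T.region p p').ncard = n := by
    obtain ⟨v, p, q, hp, hpS, hq, hqS⟩ := hS.exists_paths ha.1 hb.1
    obtain ⟨v', p₀, p', q₀, q', rfl, rfl, -, -, hp', hq', hmeet⟩ :=
      exists_tails_meeting_once hp hq
    exact ⟨_, _, _, isBigon_of_meeting_once hT hS hi ha hb hp' hpS.right hq' hqS.right hmeet, rfl⟩
  obtain ⟨p, p', hpp, hn⟩ := Nat.find_spec hex
  refine ⟨p, p', hpp, fun q q' hq hsub => ?_⟩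
  have hle : (T.region p p').ncard ≤ (T.region q q').ncard := by
    rw [hn]
    exact Nat.find_min' hex ⟨q, q', hq, rfl⟩
  obtain ⟨v, r, r', rfl, rfl, -⟩ := hpp.exists_paths hi ha hb
  exact (Set.eq_of_subset_of_ncard_le hsub hle
    (hT.finite_closedRegion (finite_pairEdges _ _) ⟨a, Or.inl (by simp)⟩)).symm.subset

/-- A path in a shrub which only uses the edges of two paths meeting at their common start `x`, and
which ends like the first one, is a tail of the first one. -/
theorem IsPreShrub.exists_eq_append (hT : T.IsShrubbyCover) (hS : S.IsPreShrub)
    {x y y' : T.Vertex} {w w' : List E} (hw : T.IsPath x w y) (hwS : S.ContainsPath w)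
    (hw' : T.IsPath x w' y') (hwS' : S.ContainsPath w')
    (hmeet : ∀ u ∈ T.pathVerts x w, u ∈ T.pathVerts x w' → u = x) {v : T.Vertex} {p : List E}
    (hp : T.IsPath v p y) (hsub : ∀ e ∈ p, e ∈ w ∨ e ∈ w') : ∃ s, w = s ++ p := by
  have hnd := hS.nodup_pathVerts hT hw hwS
  have hx : ∀ e, (e ∈ w ∨ e ∈ w') → T.tgt e ≠ x := by
    intro e he hex
    have heS : e ∈ S.edges := he.elim (hwS e) (hwS' e)
    have hr : S.Reaches x (T.src e) := by
      rcases he with he | he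
      · obtain ⟨s, t, rfl, h1, -⟩ := hw.exists_split (hw.src_mem_of_mem he)
        exact ⟨s, h1, hwS.left⟩
      · obtain ⟨s, t, rfl, h1, -⟩ := hw'.exists_split (hw'.src_mem_of_mem he)
        exact ⟨s, h1, hwS'.left⟩
    obtain ⟨r, hr, hrS⟩ := hr
    have := hS.eq_nil_of_closed hT (isPath_concat.2 ⟨hr, hex⟩)
      (hrS.append fun u hu => by rw [List.mem_singleton.1 hu]; exact heS)
    simp at this
  induction p generalizing v with
  | nil => exact ⟨w, by simp⟩
  | cons e p ih =>
    obtain ⟨s, rfl⟩ := ih hp.2 fun e he => hsub e (List.mem_cons_of_mem _ he)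
    have hs : T.IsPath x s (T.tgt e) := by
      obtain ⟨u, h1, h2⟩ := isPath_append.1 hw
      cases p with
      | nil =>
        obtain rfl : u = y := h2
        obtain rfl : T.tgt e = u := hp.2
        exact h1
      | cons f p =>
        obtain rfl := IsPath.unique_start (by simp) h2 hp.2
        exact h1
    have hex := hx e (hsub e (by simp))
    rcases List.eq_nil_or_concat s with rfl | ⟨s, g, rfl⟩
    · exact absurd (show x = T.tgt e from hs).symm hex
    · rw [List.concat_eq_append] at *
      have hge := (isPath_concat.1 hs).2
      have hg : g ∈ s ++ [g] ++ p := by simp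
      have : e = g := by
        rcases hsub e (by simp) with he | he
        · exact List.inj_on_of_nodup_map (List.nodup_cons.1 hnd).2 he hg hge.symm
        · exact absurd (hmeet _ (hge ▸ tgt_mem_pathVerts hg) (tgt_mem_pathVerts he)) hex
      subst this
      exact ⟨s, by simp⟩

/-- If two consecutive edges into `i` are separated by a single outgoing edge `f`, a minimal bigon
around `f` consists of the two broken wheels with interface `f`. -/
theorem IsMinimalBigon.eq_wheels (hT : T.IsShrubbyCover) (hS : S.IsShrub) (hi : i ∉ S.verts)
    {a b : E} (hab : a ≠ b) (ha : S.FullCorner i true a) (hb : S.FullCorner i false b)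
    (hrot : T.rot a = b) {p p' : List E} (h : S.IsMinimalBigon i a b p p')
    (hea : T.Enclosed (pairEdges p p') (T.face true a))
    (heb : T.Enclosed (pairEdges p p') (T.face false b)) :
    p = T.wheel true (T.next true a) ∧ p' = T.wheel false (T.next true a) := by
  have hPS := hS.isPreShrub
  obtain ⟨w, -, hw, hwS, hwp⟩ := ha.exists_path hT hi
  obtain ⟨w', -, hw', hwS', hwp'⟩ := hb.exists_path hT hi
  have hfi := src_next_of_mem_edgesTo ha.1 true
  have hfa : T.face true (T.next true a) = T.face true a := face_next _ _
  have hfb : T.face false (T.next true a) = T.face false b := by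
    rw [rot_apply_eq_iff.1 hrot, face_next]
  rw [← rot_apply_eq_iff.1 hrot] at hw' hwp'
  set f := T.next true a with hf
  have hmeet : ∀ u ∈ T.pathVerts (T.tgt f) w, u ∈ T.pathVerts (T.tgt f) w' → u = T.tgt f := by
    intro u hu hu'
    obtain ⟨s, t, rfl, h1, h2⟩ := hwp.exists_split hu
    obtain ⟨s', t', rfl, h1', h2'⟩ := hwp'.exists_split hu'
    exact ha.eq_start hT hS hi hb.1 hab ⟨s, h1, hwS.left⟩ ⟨t, h2, hwS.right⟩ ⟨t', h2', hwS'.right⟩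
  have hbig := isBigon_of_meeting_once hT hS hi ha.1 hb.1 hwp hwS hwp' hwS' hmeet
  have hB : ∀ u ∈ pairEdges (w ++ [a]) (w' ++ [b]), T.face true u = T.face true a ∨
      T.face false u = T.face false b := by
    rintro u (hu | hu)
    · left
      rw [← hw] at hu
      rw [(hT.mem_wheel.1 hu).1, hfa]
    · right
      rw [← hw'] at hu
      rw [(hT.mem_wheel.1 hu).1, hfb]
  have hsub := h.2 _ _ hbig (closedRegion_subset fun u hu => by
    rcases hB u hu with h1 | h1
    · exact mem_regionEdges_of_enclosed (h1 ▸ hea)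
    · exact mem_regionEdges_of_enclosed (h1 ▸ heb))
  obtain ⟨v, q, q', rfl, rfl, hq, hqS, hq', hqS'⟩ := h.1.exists_paths hi ha.1 hb.1
  -- The region between the broken wheels consists of the two faces incident to `f`, so by
  -- minimality the edges of `S` in the given bigon belong to the two broken wheels.
  have hcl : ∀ u ∉ pairEdges (w ++ [a]) (w' ++ [b]), ∀ c,
      T.face c u ∈ ({T.face true a, T.face false b} : Set T.Face) →
      T.face (!c) u ∈ ({T.face true a, T.face false b} : Set T.Face) := by
    intro u hu c hc
    have huf : u = f := by
      by_contra hne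
      rcases hc with hc | hc
      · obtain rfl := color_eq_of_face_eq hc
        exact hu (Or.inl (hw ▸ hT.mem_wheel.2 ⟨hc.trans hfa.symm, hne⟩))
      · obtain rfl := color_eq_of_face_eq hc
        exact hu (Or.inr (hw' ▸ hT.mem_wheel.2 ⟨hc.trans hfb.symm, hne⟩))
    rw [huf]
    cases c
    · left; exact hfa
    · right; exact hfb
  have hsp : T.SimplePair (T.tgt f) i (w ++ [a]) (w' ++ [b]) := by
    obtain ⟨j, -, h1, h2, -, -, -, -, h3, h4, h5⟩ := hbig
    obtain rfl := IsPath.unique_start (by simp) h1 (isPath_concat.2 ⟨hwp, ha.1.2⟩)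
    refine ⟨h1, h2, ?_, ?_⟩
    · rw [h2.pathVerts_eq] at h4 h5
      refine List.nodup_append'.2 ⟨(List.nodup_cons.1 h3).2, (List.nodup_append'.1 h4).1, ?_⟩
      intro u hu hu'
      rcases h5 u (List.mem_cons_of_mem _ hu) (List.mem_append_left _ hu') with rfl | rfl
      · exact (List.nodup_cons.1 h3).1 hu
      · exact (List.nodup_append'.1 h4).2.2 hu' (by simp)
    · have haS := notMem_of_tgt_eq hi ha.1.2
      have hbS := notMem_of_tgt_eq hi hb.1.2
      rw [List.disjoint_append_right, List.disjoint_append_left, List.disjoint_append_left]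
      refine ⟨⟨disjoint_of_meeting_once (hPS.nodup_pathVerts hT hwp' hwS') hmeet, ?_⟩, ?_, ?_⟩
      · simpa using fun h => haS (hwS' a h)
      · simpa using fun h => hbS (hwS b h)
      · simpa using hab.symm
  have hen : T.Enclosed (pairEdges (w ++ [a]) (w' ++ [b])) (T.face true a) :=
    enclosed_of_finite_closed (Set.toFinite _) hcl (by simp)
  have hall : ∀ G, T.Enclosed (pairEdges (w ++ [a]) (w' ++ [b])) G →
      G ∈ ({T.face true a, T.face false b} : Set T.Face) := by
    intro G hG
    obtain ⟨c, hc⟩ := hsp.exists_conn hT (u := a) (Or.inl (by simp)) G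
    cases c with
    | true => exact mem_of_conn_of_closed hcl (by simp) hc.symm
    | false =>
      exact absurd (hc.enclosed_iff.1 hG) (hsp.not_enclosed hT (Or.inl (by simp)) hen)
  have hedge : ∀ u ∈ S.edges, u ∈ pairEdges (q ++ [a]) (q' ++ [b]) → u ∈ w ∨ u ∈ w' := by
    intro u huS hu
    have haS := notMem_of_tgt_eq hi ha.1.2
    have hbS := notMem_of_tgt_eq hi hb.1.2
    have hmem : u ∈ w ++ [a] ∨ u ∈ w' ++ [b] → u ∈ w ∨ u ∈ w' := by
      intro h1
      simp only [List.mem_append, List.mem_singleton] at h1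
      rcases h1 with (h1 | rfl) | (h1 | rfl)
      · exact Or.inl h1
      · exact absurd huS haS
      · exact Or.inr h1
      · exact absurd huS hbS
    have hreg : u ∈ T.regionEdges (pairEdges (w ++ [a]) (w' ++ [b])) :=
      hsub (show Sum.inl u ∈ T.region (q ++ [a]) (q' ++ [b]) from Or.inl hu)
    rcases hreg with h1 | h1
    · exact hmem h1
    · rcases hall _ h1 with h2 | h2
      · by_cases huf : u = f
        · exact absurd huS (huf ▸ notMem_of_src_eq hi hfi)
        · refine hmem (Or.inl ?_)
          rw [← hw]
          exact hT.mem_wheel.2 ⟨h2.trans hfa.symm, huf⟩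
      · exact absurd (color_eq_of_face_eq h2) (by simp)
  obtain ⟨s, hs⟩ := hPS.exists_eq_append hT hwp hwS hwp' hwS' hmeet hq
    fun e he => hedge e (hqS e he) (Or.inl (by simp [he]))
  obtain ⟨s', hs'⟩ := hPS.exists_eq_append hT hwp' hwS' hwp hwS (fun u h1 h2 => hmeet u h2 h1) hq'
    fun e he => (hedge e (hqS' e he) (Or.inr (by simp [he]))).symm
  have hstart : ∀ {w q s : List E} {y : T.Vertex}, w = s ++ q → T.IsPath (T.tgt f) w y →
      T.IsPath v q y → T.IsPath (T.tgt f) s v := by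
    rintro w q s y rfl h1 h2
    obtain ⟨u, h3, h4⟩ := isPath_append.1 h1
    cases q with
    | nil =>
      obtain rfl : u = y := h4
      obtain rfl : v = u := h2
      exact h3
    | cons e q =>
      obtain rfl := IsPath.unique_start (by simp) h4 h2
      exact h3
  have h1 := hstart hs hwp hq
  have h2 := hstart hs' hwp' hq'
  have hv : v = T.tgt f := hmeet v (by rw [hs]; exact mem_pathVerts_append_left h1.end_mem)
    (by rw [hs']; exact mem_pathVerts_append_left h2.end_mem)
  rw [hv] at h1 h2
  rw [hs] at hwS
  rw [hs'] at hwS'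
  have h3 := hPS.eq_nil_of_closed hT h1 hwS.left
  have h4 := hPS.eq_nil_of_closed hT h2 hwS'.left
  rw [hw, hw', hs, hs', h3, h4]
  simp

namespace IsExceptional

variable {z : E} (hT : T.IsShrubbyCover) (hS : S.IsShrub) (hi : i ∉ S.verts)
  (hz : S.IsExceptional i z)
include hT hS hi hz

omit hS hi in
/-- Consecutive edges are enumerated by increasing exponents of the rotation, starting at `z`. -/
theorem exists_of_consecutive {a b : E} (h : S.Consecutive i a b) :
    ∃ x y, x < y ∧ y ≤ Function.minimalPeriod T.rot z ∧ (T.rot ^ x) z = a ∧ (T.rot ^ y) z = b ∧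
      ∀ l, x < l → l < y → (T.rot ^ l) z ∉ S.edgesTo i := by
  obtain ⟨ha, hb, m, hm, hmb, hl⟩ := h
  obtain ⟨x, hx, rfl⟩ := hT.exists_rot_pow (hz.mem.2.trans ha.2.symm)
  refine ⟨x, x + m, by omega, ?_, rfl, ?_, ?_⟩
  · by_contra hlt
    refine hl (Function.minimalPeriod T.rot z - x) (by omega) (by omega) ?_
    rw [← Equiv.Perm.mul_apply, ← pow_add, Nat.sub_add_cancel hx.le, rot_pow_minimalPeriod]
    exact hz.mem
  · rw [add_comm, pow_add, Equiv.Perm.mul_apply]; exact hmb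
  · intro l h1 h2
    have := hl (l - x) (by omega) (by omega)
    rwa [← Equiv.Perm.mul_apply, ← pow_add, Nat.sub_add_cancel h1.le] at this

omit hT hS hi in
/-- Every edge `rot ^ x z` from `S` with `x < minimalPeriod` has a successor in the enumeration. -/
theorem exists_consecutive {x : ℕ} (hx : x < Function.minimalPeriod T.rot z)
    (ha : (T.rot ^ x) z ∈ S.edgesTo i) :
    ∃ y, x < y ∧ y ≤ Function.minimalPeriod T.rot z ∧ (T.rot ^ y) z ∈ S.edgesTo i ∧
      S.Consecutive i ((T.rot ^ x) z) ((T.rot ^ y) z) := by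
  classical
  have hzn : (T.rot ^ Function.minimalPeriod T.rot z) z ∈ S.edgesTo i := by
    rw [rot_pow_minimalPeriod]; exact hz.mem
  have hex : ∃ y, x < y ∧ (T.rot ^ y) z ∈ S.edgesTo i := ⟨_, hx, hzn⟩
  obtain ⟨h1, h2⟩ := Nat.find_spec hex
  refine ⟨Nat.find hex, h1, Nat.find_min' hex ⟨hx, hzn⟩, h2, ha, h2, Nat.find hex - x, by omega,
    ?_, ?_⟩
  · rw [← Equiv.Perm.mul_apply, ← pow_add, Nat.sub_add_cancel h1.le]
  · intro l h3 h4
    rw [← Equiv.Perm.mul_apply, ← pow_add]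
    exact fun h => Nat.find_min hex (m := l + x) (by omega) ⟨by omega, h⟩

theorem rot_mem_of_addable (hadd : S.Addable i) {a : E} (ha : a ∈ S.edgesTo i) (haz : a ≠ z) :
    T.rot a ∈ S.edgesTo i := by
  obtain ⟨x, hx0, hxn, rfl⟩ := hz.exists_pos hT ha
  have hx : x < Function.minimalPeriod T.rot z := by
    refine lt_of_le_of_ne hxn ?_
    rintro rfl
    exact haz (rot_pow_minimalPeriod z)
  obtain ⟨y, hxy, hy, hb, hcons⟩ := hz.exists_consecutive hx ha
  obtain ⟨p, p', hmin⟩ := exists_minimalBigon hT hS hi ha hb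
  have hgood := (hadd _ _ p p' hcons hmin).1
  obtain ⟨v, q, q', rfl, rfl, hq, hqS, hq', hqS'⟩ := hmin.1.exists_paths hi ha hb
  obtain ⟨⟨h1, -⟩, -, h3⟩ :=
    hz.enclosed_between hT hS hi hx0 hxy hy rfl rfl ha hb hq hqS hq' hqS'
  obtain ⟨c, e, hp, hp'⟩ := hgood h1
  have hna := hT.next_eq_of_wheel hp.symm
  have hnb := hT.next_eq_of_wheel hp'.symm
  cases c with
  | true =>
    rw [rot_apply_eq_iff.2 (hna.trans hnb.symm)]
    exact hb
  | false =>
    -- With the colours exchanged, the region would contain the blue corner at `b`.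
    exfalso
    refine h3 (enclosed_of_finite_closed (Set.toFinite {T.face false e, T.face true e})
      (fun u hu d hd => ?_) (Or.inr ?_))
    · have hue : u = e := by
        by_contra hne
        rcases hd with hd | hd
        · obtain rfl := color_eq_of_face_eq hd
          exact hu (Or.inl (hp ▸ hT.mem_wheel.2 ⟨hd, hne⟩))
        · obtain rfl := color_eq_of_face_eq hd
          exact hu (Or.inr (hp' ▸ hT.mem_wheel.2 ⟨hd, hne⟩))
      rw [hue]
      cases d <;> simp
    · rw [Set.mem_singleton_iff, ← hnb, Bool.not_false, face_next]

theorem enclosed_of_addable (hadd : S.Addable i) {f : E} (hf : T.src f = i)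
    (hfS : T.tgt f ∈ S.verts) : T.Enclosed (S.addVertex i).edges (T.face true f) := by
  have hn : 0 < Function.minimalPeriod T.rot z :=
    Function.minimalPeriod_pos_of_mem_periodicPts (hT.periodic z)
  obtain ⟨y, -, -, hb, hcons⟩ := hz.exists_consecutive (x := 0) hn hz.mem
  have hcons : S.Consecutive i z ((T.rot ^ y) z) := hcons
  obtain ⟨p, p', hmin⟩ := exists_minimalBigon hT hS hi hz.mem hb
  have hgood := (hadd _ _ p p' hcons hmin).2
  obtain ⟨v, q, q', rfl, rfl, -, hqS, -, hqS'⟩ := hmin.1.exists_paths hi hz.mem hb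
  have hsub := pairEdges_subset_addVertex hz.mem hb hqS hqS'
  rcases hgood (fun h => hz.not_enclosed (Enclosed.mono hsub h)) f hf hfS with h | h
  · exact absurd (hsub h) (notMem_addVertex_of_src_eq hi hf)
  · exact Enclosed.mono hsub h

/-- Addability in terms of the rotation around `i`: the edges from `S` are separated by single
outgoing edges except after `z`, where there are no outgoing edges to `S`. -/
theorem addable_iff : S.Addable i ↔ (∀ a ∈ S.edgesTo i, a ≠ z → T.rot a ∈ S.edgesTo i) ∧
    ∀ f, T.src f = i → T.tgt f ∈ S.verts →
      T.Enclosed (S.addVertex i).edges (T.face true f) := by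
  refine ⟨fun h => ⟨fun a => hz.rot_mem_of_addable hT hS hi h,
    fun f => hz.enclosed_of_addable hT hS hi h⟩, fun ⟨hgap, hout⟩ => ?_⟩
  intro a b p p' hcons hmin
  have ha := hcons.1
  have hb := hcons.2.1
  obtain ⟨x, y, hxy, hy, hxa, hyb, hno⟩ := hz.exists_of_consecutive hT hcons
  obtain ⟨v, q, q', rfl, rfl, hq, hqS, hq', hqS'⟩ := hmin.1.exists_paths hi ha hb
  have hsub := pairEdges_subset_addVertex ha hb hqS hqS'
  rcases Nat.eq_zero_or_pos x with rfl | hx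
  · obtain rfl : z = a := hxa
    refine ⟨fun h => absurd (Enclosed.mono hsub h) hz.not_enclosed, fun _ f hf hfS => ?_⟩
    have henc := hout f hf hfS
    have hti : T.tgt z = T.tgt ((T.next true).symm f) := by
      rw [tgt_next_symm]; exact hz.mem.2.trans hf.symm
    obtain ⟨t, ht, hte⟩ := hT.exists_rot_pow hti
    rw [← face_next_symm, ← hte] at henc
    have hyt : y ≤ t := by
      by_contra hlt
      exact (hz.not_enclosed_iff hT hS hi ht).2
        (fun l h1 h2 => hno l h1 (by omega)) henc
    obtain ⟨⟨h1, -⟩, -⟩ := hz.enclosed_between hT hS hi (by omega) (by omega) le_rfl hyb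
      (rot_pow_minimalPeriod z) hb hz.mem hq' hqS' hq hqS
    rw [pairEdges_comm] at h1
    right
    change T.Enclosed (pairEdges (q ++ [z]) (q' ++ [b])) (T.face true f)
    rw [← face_next_symm, ← hte]
    refine (Conn.enclosed_iff ?_).1 h1
    rw [← hyb]
    refine conn_rot_pow hyt (fun l _ _ h => hz.next_rot_pow_notMem hi l (hsub (hyb ▸ h)))
      fun l h2 h3 h4 => ?_
    rw [hyb] at h4
    rcases eq_or_eq_of_mem_pairEdges hi hqS hqS' (hz.tgt_rot_pow l) h4 with h5 | h5
    · exact rot_pow_ne (T := T) (z := z) (l := 0) (m := l) (by omega) (by omega) h5.symm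
    · rw [← hyb] at h5
      exact rot_pow_ne (T := T) (z := z) h2 (by omega) h5.symm
  · have haz : a ≠ z := by
      rw [← hxa]
      have := rot_pow_ne (T := T) (z := z) (l := 0) (m := x) (by omega) (by omega)
      simpa using this.symm
    have hrotS := hgap a ha haz
    obtain ⟨⟨h1, h2⟩, ⟨h3, h4⟩, -⟩ :=
      hz.enclosed_between hT hS hi hx hxy hy hxa hyb ha hb hq hqS hq' hqS'
    have hrot : T.rot a = b := by
      rw [← hxa, ← Equiv.Perm.mul_apply, ← pow_succ'] at hrotS ⊢
      rw [← hyb]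
      congr 2
      by_contra hne
      exact hno (x + 1) (by omega) (by omega) hrotS
    have hab : a ≠ b := by
      rw [← hxa, ← hyb]
      exact rot_pow_ne hxy (by omega)
    refine ⟨fun _ => ?_, fun h => absurd h1 h⟩
    obtain ⟨h5, h6⟩ := hmin.eq_wheels hT hS hi hab h2 h4 hrot h1 h3
    exact ⟨true, _, h5, h6⟩

end IsExceptional

/-- The maximal size of a family of broken wheels at a vertex with `k` edges from `S` is `k - 1` if
the vertex is addable, and exactly `k` otherwise. -/
theorem isGreatest_wheelCounts (hT : T.IsShrubbyCover) (hS : S.IsShrub) (hi : i ∉ S.verts)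
    (hne : (S.edgesTo i).Nonempty) :
    (S.Addable i → IsGreatest (S.wheelCounts i) ((S.edgesTo i).ncard - 1)) ∧
    (¬ S.Addable i → IsGreatest (S.wheelCounts i) (S.edgesTo i).ncard) := by
  obtain ⟨z, hzS, hzE⟩ := exists_exceptional hT hS hi hne
  have hz : S.IsExceptional i z := ⟨hzS, hzE⟩
  rw [hz.addable_iff hT hS hi]
  refine ⟨fun ⟨h1, h2⟩ => ⟨hz.ncard_sub_one_mem_wheelCounts hT hS hi,
    fun n hn => hz.le_of_mem_wheelCounts hT hS hi h1 h2 hn⟩, fun h => ⟨?_, fun n hn =>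
      le_ncard_of_mem_wheelCounts hT hi (finite_edgesTo hT) hn⟩⟩
  rw [not_and_or] at h
  push Not at h
  rcases h with ⟨a, ha, haz, hgap⟩ | ⟨f, hf, hfS, hfe⟩
  · exact hz.ncard_mem_wheelCounts_of_gap hT hS hi ha haz hgap
  · exact hz.ncard_mem_wheelCounts_of_out hT hS hi hf hfS hfe

end Subgraph

end Bigons
end BicoloredMap

namespace BicoloredMap

/-! ### The universal cover -/

section Cover

variable {E : Type*} (Q : BicoloredMap E) (e₀ : E)

theorem act_of (c : Bool) : Q.act (FreeGroup.of c) = Q.next c := FreeGroup.lift_apply_of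

theorem act_eq_of_mem_nullLoops {x : FreeGroup Bool} (hx : x ∈ Q.nullLoops e₀) :
    Q.act x e₀ = e₀ := by
  have hle : Q.nullLoops e₀ ≤ (MulAction.stabilizer (Equiv.Perm E) e₀).comap Q.act := by
    rw [nullLoops, Subgroup.closure_le]
    rintro _ ⟨g, w, -, rfl⟩
    change Q.act (g⁻¹ * w ^ _ * g) e₀ = e₀
    rw [map_mul, map_mul, map_pow, map_inv, Equiv.Perm.mul_apply, Equiv.Perm.mul_apply,
      Equiv.Perm.coe_pow, Function.iterate_minimalPeriod]
    simp
  exact hle hx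

/-- The covering map on edges. -/
def coverProj : Q.CoverEdge e₀ → E :=
  Quotient.lift (fun g : FreeGroup Bool => Q.act g e₀) fun a b h => by
    have h1 := Q.act_eq_of_mem_nullLoops e₀ (QuotientGroup.leftRel_apply.1 h)
    rw [map_mul, map_inv, Equiv.Perm.mul_apply, Equiv.Perm.inv_eq_iff_eq] at h1
    exact h1.symm

theorem coverProj_mk (g : FreeGroup Bool) :
    Q.coverProj e₀ (g : Q.CoverEdge e₀) = Q.act g e₀ := rfl

theorem cover_next_mk (c : Bool) (g : FreeGroup Bool) :
    (Q.cover e₀).next c (g : Q.CoverEdge e₀) = ((FreeGroup.of c * g : FreeGroup Bool) :) := rfl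

theorem coverProj_next (c : Bool) (x : Q.CoverEdge e₀) :
    Q.coverProj e₀ ((Q.cover e₀).next c x) = Q.next c (Q.coverProj e₀ x) := by
  obtain ⟨g, rfl⟩ := QuotientGroup.mk_surjective x
  rw [cover_next_mk, coverProj_mk, coverProj_mk, map_mul, Equiv.Perm.mul_apply, act_of]

theorem smul_pow_mem {w : FreeGroup Bool} (hw : w = FreeGroup.of true ∨ w = FreeGroup.of false ∨
      w = (FreeGroup.of false)⁻¹ * FreeGroup.of true) (x : Q.CoverEdge e₀) :
    w ^ Function.minimalPeriod (Q.act w) (Q.coverProj e₀ x) • x = x := by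
  obtain ⟨g, rfl⟩ := QuotientGroup.mk_surjective x
  rw [coverProj_mk, MulAction.Quotient.smul_mk, eq_comm, QuotientGroup.eq]
  refine Subgroup.subset_closure ⟨g, w, hw, ?_⟩
  rw [smul_eq_mul, mul_assoc]

theorem cover_next_pow (c : Bool) (n : ℕ) (x : Q.CoverEdge e₀) :
    (((Q.cover e₀).next c)^[n]) x = FreeGroup.of c ^ n • x := by
  induction n with
  | zero => simp
  | succ n ih => rw [Function.iterate_succ_apply', ih, pow_succ', mul_smul]; rfl

theorem cover_rot_pow (n : ℕ) (x : Q.CoverEdge e₀) :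
    ((Q.cover e₀).rot^[n]) x = ((FreeGroup.of false)⁻¹ * FreeGroup.of true) ^ n • x := by
  induction n with
  | zero => simp
  | succ n ih =>
    rw [Function.iterate_succ_apply', ih, pow_succ', mul_smul _ (_ ^ n), mul_smul]
    rfl

theorem faceSize_le_cover (hface : ∀ (c : Bool) (e : E), 3 ≤ Q.faceSize c e) (c : Bool)
    (x : Q.CoverEdge e₀) : 3 ≤ (Q.cover e₀).faceSize c x := by
  have hQ := hface c (Q.coverProj e₀ x)
  have hw : FreeGroup.of c = FreeGroup.of true ∨ FreeGroup.of c = FreeGroup.of false ∨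
      FreeGroup.of c = (FreeGroup.of false)⁻¹ * FreeGroup.of true := by
    cases c <;> simp
  have hpos : 0 < (Q.cover e₀).faceSize c x := by
    refine Function.minimalPeriod_pos_of_mem_periodicPts ⟨Q.faceSize c (Q.coverProj e₀ x),
      by omega, ?_⟩
    change ((Q.cover e₀).next c)^[_] x = x
    rw [cover_next_pow, faceSize, ← act_of]
    exact Q.smul_pow_mem e₀ hw x
  have hper : Function.IsPeriodicPt (Q.next c) ((Q.cover e₀).faceSize c x)
      (Q.coverProj e₀ x) := by
    have hsc : Function.Semiconj (Q.coverProj e₀) ((Q.cover e₀).next c) (Q.next c) :=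
      Q.coverProj_next e₀ c
    have h1 := (hsc.iterate_right ((Q.cover e₀).faceSize c x)) x
    rw [faceSize, Function.iterate_minimalPeriod] at h1
    exact h1.symm
  exact hQ.trans (hper.minimalPeriod_le hpos)

/-- The universal cover of a finite shrubby quiver has the properties that the proof uses, provided
that it contains a shrub and a vertex outside it. It is infinite because in a finite map all faces
are enclosed, so that all vertices would lie in the interior of the shrub. -/
theorem isShrubbyCover_cover [Finite E]
    (hface : ∀ (c : Bool) (e : E), 3 ≤ Q.faceSize c e)
    (hshrubby : (Q.cover e₀).Shrubby) {S : (Q.cover e₀).Subgraph} (hS : S.IsShrub)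
    {i : (Q.cover e₀).Vertex} (hi : i ∉ S.verts) : (Q.cover e₀).IsShrubbyCover where
  conn P hP hnext x := by
    have hall : ∀ w : FreeGroup Bool, ∀ x : Q.CoverEdge e₀, P x ↔ P (w • x) := by
      intro w
      induction w using FreeGroup.induction_on with
      | C1 => simp
      | of c => exact hnext c
      | inv_of c h =>
        intro x
        have := h ((FreeGroup.of c)⁻¹ • x)
        rw [smul_inv_smul] at this
        exact this.symm
      | mul a b ha hb => intro x; rw [hb x, ha, mul_smul]
    obtain ⟨y, hy⟩ := hP
    obtain ⟨w, rfl⟩ := MulAction.exists_smul_eq (FreeGroup Bool) y x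
    exact (hall w y).1 hy
  three_le := Q.faceSize_le_cover e₀ hface
  periodic x := by
    refine ⟨_, ?_, (Q.cover_rot_pow e₀ _ x).trans (Q.smul_pow_mem e₀ (Or.inr (Or.inr rfl)) x)⟩
    refine Function.minimalPeriod_pos_of_mem_periodicPts ?_
    exact Function.Injective.mem_periodicPts (Equiv.injective _) _
  infinite := by
    by_contra hfin
    rw [not_infinite_iff_finite] at hfin
    exact hi (hS.interior i fun c e _ => Set.toFinite _)
  shrubby := hshrubby

end Cover
end BicoloredMap

theorem mainTheorem7 {E : Type*} (Q : BicoloredMap E) (hQ : Q.IsTorus)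
    (hface : ∀ (c : Bool) (e : E), 3 ≤ Q.faceSize c e)
    (e₀ : E) (hshrubby : (Q.cover e₀).Shrubby)
    (S : (Q.cover e₀).Subgraph) (hS : S.IsShrub)
    (i : (Q.cover e₀).Vertex) (hi : i ∉ S.verts)
    (k : ℕ) (hk : (S.edgesTo i).ncard = k) (hk0 : 0 < k) :
    (S.Addable i → IsGreatest (S.wheelCounts i) (k - 1)) ∧
    (¬ S.Addable i → ∃ m, IsGreatest (S.wheelCounts i) m ∧ k ≤ m) := by
  subst hk
  have := hQ.finite
  have hT := Q.isShrubbyCover_cover e₀ hface hshrubby hS hi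
  obtain ⟨h1, h2⟩ := BicoloredMap.Subgraph.isGreatest_wheelCounts hT hS hi
    (Set.nonempty_of_ncard_ne_zero hk0.ne')
  exact ⟨h1, fun h => ⟨_, h2 h, le_rfl⟩⟩
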